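/- For an integer $k\ge 2$ put $\alpha_{\mathrm{lbd}}=2^k\log 2-2$ and $\alpha_{\mathrm{ubd}}=2^k\log 2$. For $\alpha>0$ and a probability measure $\mu$ on $[0,1]$, let $d^+,d^-$ be $\mathrm{Pois}(\alpha k/2)$ random variables and let $\vec\eta=[(\eta_j)_{j\ge1},(\eta^+_{ij},\eta^-_{ij})_{i,j\ge1}]$ be an array of samples from $\mu$, all these random variables being independent. Define $$\Pi^{\pm}=\prod_{i=1}^{d^\pm}\Big(1-\prod_{j=1}^{k-1}\eta^\pm_{ij}\Big),$$ and let $\mathbf R^\alpha\mu$ be the law of $$\frac{(1-\Pi^-)\Pi^+}{\Pi^++\Pi^--\Pi^+\Pi^-}$$ (read as $0$ if $\Pi^+=\Pi^-=0$). Let $\mu^\alpha_0=\delta_{1/2}$ and $\mu^\alpha_\ell=\mathbf R^\alpha\mu^\alpha_{\ell-1}$ for $\ell\ge1$; let $\mu_\alpha$ be the weak limit of $\mu^\alpha_\ell$ as $\ell\to\infty$, when it exists, and let $$\Phi(\alpha)=\mathbb E\left[\log\frac{\Pi^++\Pi^--\Pi^+\Pi^-}{\big(1-\prod_{j=1}^k\eta_j\big)^{\alpha(k-1)}}\right],$$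 where the expectation is over $(d^+,d^-)$ and $\vec\eta$ with $\mu=\mu_\alpha$. There are absolute constants $k_0$ and $C$ such that for all $k\ge k_0$ the following hold. (i) $\Phi$ is well-defined on $[\alpha_{\mathrm{lbd}},\alpha_{\mathrm{ubd}}]$: for every $\alpha$ in this interval the sequence $\mu^\alpha_\ell$ converges weakly to $\mu_\alpha$, $\mathbf R^\alpha\mu_\alpha=\mu_\alpha$, and, for $\mu=\mu_\alpha$, the quantities $\Pi^++\Pi^--\Pi^+\Pi^-$ and $1-\prod_{j=1}^k\eta_j$ are almost surely positive and the random variable inside the expectation is integrable. (ii) $\Phi$ is strictly decreasing on $[\alpha_{\mathrm{lbd}},\alpha_{\mathrm{ubd}}]$. (iii) $\Phi$ has a unique zero $\alpha_\star(k)$ in $[\alpha_{\mathrm{lbd}},\alpha_{\mathrm{ubd}}]$. (iv) For all $\alpha_{\mathrm{lbd}}\le\alpha'\le\alpha''\le\alpha_{\mathrm{ubd}}$, $$\big|\Phi(\alpha'')-\Phi(\alpha')+(\alpha''-\alpha')2^{-k}\big|\le C\,2^{-k/4}\,(\alpha''-\alpha')\,2^{-k}.$$ -/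

import Mathlib

open MeasureTheory ProbabilityTheory Filter Topology

noncomputable section

namespace KSat

/-- The lower end `2^k log 2 - 2` of the range of clause densities. -/
def lbd (k : ℕ) : ℝ := 2 ^ k * Real.log 2 - 2

/-- The upper end `2^k log 2` of the range of clause densities. -/
def ubd (k : ℕ) : ℝ := 2 ^ k * Real.log 2

/-- Index set of the array `[(η_j), (η⁺_{ij}, η⁻_{ij})]`: `Sum.inl j` is the index of `η_j`,
`Sum.inr (true, i, j)` that of `η⁺_{ij}` and `Sum.inr (false, i, j)` that of `η⁻_{ij}`.
Indices start at `0`. -/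
abbrev Idx : Type := ℕ ⊕ (Bool × ℕ × ℕ)

/-- Arrays `η` with entries in `[0,1]`. -/
abbrev Arr : Type := Idx → unitInterval

/-- Sample space of the pair of degrees `d = (d⁺, d⁻)` and of the array `η`. -/
abbrev Sample : Type := (ℕ × ℕ) × Arr

/-- The law of `(d, η)`: `d⁺, d⁻` are `Pois(α k / 2)`, the entries of `η` have law `μ`, and all
these random variables are independent. -/
def law (k : ℕ) (α : ℝ) (μ : ProbabilityMeasure unitInterval) : Measure Sample :=
  ((poissonMeasure (α * k / 2).toNNReal).prod (poissonMeasure (α * k / 2).toNNReal)).prod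
    (Measure.infinitePi fun _ : Idx => (μ : Measure unitInterval))

instance (k : ℕ) (α : ℝ) (μ : ProbabilityMeasure unitInterval) :
    IsProbabilityMeasure (law k α μ) := by
  unfold law; infer_instance

/-- `∏_{i=1}^{n} (1 - ∏_{j=1}^{k-1} η^s_{ij})`, with `s = true` for `+`, `s = false` for `-`. -/
def signProd (k : ℕ) (s : Bool) (n : ℕ) (η : Arr) : ℝ :=
  ∏ i ∈ Finset.range n, (1 - ∏ j ∈ Finset.range (k - 1), (η (Sum.inr (s, i, j)) : ℝ))

/-- `Π⁺(d, η)`. -/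
def PiPlus (k : ℕ) (ω : Sample) : ℝ := signProd k true ω.1.1 ω.2

/-- `Π⁻(d, η)`. -/
def PiMinus (k : ℕ) (ω : Sample) : ℝ := signProd k false ω.1.2 ω.2

/-- `Π⁺ + Π⁻ - Π⁺ Π⁻`. -/
def siteWeight (k : ℕ) (ω : Sample) : ℝ :=
  PiPlus k ω + PiMinus k ω - PiPlus k ω * PiMinus k ω

/-- `1 - ∏_{j=1}^k η_j`. -/
def clauseWeight (k : ℕ) (ω : Sample) : ℝ :=
  1 - ∏ j ∈ Finset.range k, (ω.2 (Sum.inl j) : ℝ)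

/-- `(1 - Π⁻) Π⁺ / (Π⁺ + Π⁻ - Π⁺ Π⁻)`, as a real number. -/
def ratio (k : ℕ) (ω : Sample) : ℝ :=
  (1 - PiMinus k ω) * PiPlus k ω / siteWeight k ω

theorem prod_mem_Icc {ι : Type} (s : Finset ι) (f : ι → ℝ) (h : ∀ i ∈ s, f i ∈ Set.Icc (0 : ℝ) 1) :
    ∏ i ∈ s, f i ∈ Set.Icc (0 : ℝ) 1 :=
  ⟨Finset.prod_nonneg fun i hi => (h i hi).1,
    Finset.prod_le_one (fun i hi => (h i hi).1) fun i hi => (h i hi).2⟩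

theorem signProd_mem (k : ℕ) (s : Bool) (n : ℕ) (η : Arr) :
    signProd k s n η ∈ Set.Icc (0 : ℝ) 1 := by
  refine prod_mem_Icc _ _ fun i _ => ?_
  have h := prod_mem_Icc (Finset.range (k - 1)) (fun j => (η (Sum.inr (s, i, j)) : ℝ))
    fun j _ => (η (Sum.inr (s, i, j))).2
  exact ⟨by linarith [h.2], by linarith [h.1]⟩

theorem ratio_mem (k : ℕ) (ω : Sample) : ratio k ω ∈ Set.Icc (0 : ℝ) 1 := by
  obtain ⟨hp0, hp1⟩ : PiPlus k ω ∈ Set.Icc (0 : ℝ) 1 := signProd_mem _ _ _ _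
  obtain ⟨hm0, hm1⟩ : PiMinus k ω ∈ Set.Icc (0 : ℝ) 1 := signProd_mem _ _ _ _
  have hD : (1 - PiMinus k ω) * PiPlus k ω ≤ siteWeight k ω := by
    unfold siteWeight; nlinarith
  have hN : 0 ≤ (1 - PiMinus k ω) * PiPlus k ω := mul_nonneg (by linarith) hp0
  exact ⟨div_nonneg hN (hN.trans hD), div_le_one_of_le₀ hD (hN.trans hD)⟩

/-- The map `R(d, η)`, with values in `[0,1]`. It is `0` in the degenerate case `Π⁺ = Π⁻ = 0`. -/
def recMap (k : ℕ) (ω : Sample) : unitInterval := ⟨ratio k ω, ratio_mem k ω⟩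

theorem measurable_recMap (k : ℕ) : Measurable (recMap k) := by
  have hs : ∀ (s : Bool) (n : ℕ), Measurable (signProd k s n) := by
    intro s n
    unfold signProd
    fun_prop
  refine Measurable.subtype_mk ?_
  refine measurable_from_prod_countable_right fun d => ?_
  have h1 := hs true d.1
  have h2 := hs false d.2
  simp only [ratio, siteWeight, PiPlus, PiMinus]
  fun_prop

/-- The distributional recursion `𝐑^α`: the image `𝐑^α μ` of `μ` is the law of `R(d, η)`. -/
def recursion (k : ℕ) (α : ℝ) (μ : ProbabilityMeasure unitInterval) :
    ProbabilityMeasure unitInterval :=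
  ⟨(law k α μ).map (recMap k),
    Measure.isProbabilityMeasure_map (measurable_recMap k).aemeasurable⟩

/-- The point `1/2` of `[0,1]`. -/
def half : unitInterval := ⟨1 / 2, by norm_num, by norm_num⟩

/-- The sequence `μ_0 = δ_{1/2}`, `μ_{ℓ+1} = 𝐑^α μ_ℓ`. -/
def iter (k : ℕ) (α : ℝ) : ℕ → ProbabilityMeasure unitInterval
  | 0 => ⟨Measure.dirac half, Measure.dirac.isProbabilityMeasure⟩
  | ℓ + 1 => recursion k α (iter k α ℓ)

/-- The weak limit `μ_α` of `μ_ℓ` as `ℓ → ∞` (meaningful when that limit exists). -/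
def fixedPt (k : ℕ) (α : ℝ) : ProbabilityMeasure unitInterval :=
  @limUnder _ _ _ ⟨iter k α 0⟩ atTop (iter k α)

/-- The random variable whose expectation is the free energy. -/
def logWeight (k : ℕ) (α : ℝ) (ω : Sample) : ℝ :=
  Real.log (siteWeight k ω / clauseWeight k ω ^ (α * ((k : ℝ) - 1)))

/-- The 1-RSB free energy `Φ(α)`. -/
def Phi (k : ℕ) (α : ℝ) : ℝ := ∫ ω, logWeight k α ω ∂(law k α (fixedPt k α))

end KSat

end

/-! The pair (-log Π⁺, -log Π⁻) is a compound Poisson variable: for each sign there are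
Poisson(αk/2) independent increments -log(1-u), where u is a product of k-1 messages. Expectations
of bounded continuous functions g of this pair are therefore values at 0 of exp(L)g with a bounded
generator L (`integral_comp_logPair`). Expanding in powers of u, the pair (α, μ) enters only through
the intensities λ_j = (αk/2) m_j^{k-1}, where m_j are the moments of μ. All generators commute, so
two of them are compared by differentiating along the segment that joins them
(`abs_exp_sub_exp_sub_le`).

Contraction. One clause moves η by a Möbius map in u that is bounded by 1 on the unit disc. The
Taylor coefficients of η^m are thus bounded uniformly in m, and the first order effects of the two
signs cancel up to Π⁻ (`exists_coeff_etaF_pow`), whose mean is of order 2^{-k}. The λ_j with j ≥ 2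
have sum O(k 2^{-k}). On the class `Good`, which the recursion preserves (`good_recursion`), the sup
distance between moment sequences hence contracts by O(k² 2^{-k}). With compactness and determinacy
by moments this gives μ_α, and its moments are Lipschitz in α with constant O(k 4^{-k}).

Stationarity. Φ(α) is the value at μ_α of a functional of (α, μ). To first order its site part
varies by -2 Σ_j δλ_j m_j(𝐑μ)/j, and its clause part is α(k-1) Σ_j m_j^k/j. At a fixed point the
first variation in μ cancels (`abs_freeEnergy_sub_le`). What remains is -(α''-α') Σ_j m_j^k/j, which
is -(α''-α') 2^{-k} up to a small relative error, together with quadratic errors. This yields (iv),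
and with it continuity and strict monotonicity.

Zero. Also by stationarity, Φ differs by at most 2^{-k}/10 from the functional at δ_{1/2}. There
only the degrees are random, and Poisson generating functions give log 2 - α 2^{-k} - α 4^{-k}/2
with an error between -1.02·2^{-k} and 0.01·2^{-k} (`freeEnergy_iter_zero_bounds`). This is precise
enough to fix the signs of Φ at the two ends of the interval. -/

noncomputable section

namespace KSat

open scoped NNReal BoundedContinuousFunction

/-! ### Taylor coefficients of powers of Möbius maps -/

/-- Taylor coefficients of a power of a Möbius map that preserves the unit disc. -/
theorem exists_coeff_mobius_pow (p q s : ℝ) (hs0 : 0 ≤ s) (hs1 : s < 1)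
    (hb : ∀ u : ℂ, ‖u‖ ≤ 1 → ‖(p + q * u : ℂ)‖ ≤ ‖(1 - s * u : ℂ)‖) (m : ℕ) :
    ∃ c : ℕ → ℝ, c 0 = p ^ m ∧ c 1 = m * p ^ (m - 1) * (q + p * s) ∧ (∀ j, |c j| ≤ 1) ∧
      ∀ u ∈ Set.Ico (0 : ℝ) 1, HasSum (fun j => c j * u ^ j) (((p + q * u) / (1 - s * u)) ^ m) := by
  set F : ℂ → ℂ := fun u => ((p + q * u) / (1 - s * u)) ^ m with hF
  have hne : ∀ u : ℂ, ‖u‖ ≤ 1 → (1 - s * u : ℂ) ≠ 0 := by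
    intro u hu h
    have h1 : (s : ℂ) * u = 1 := by linear_combination -h
    have h2 : ‖(s : ℂ) * u‖ = 1 := by rw [h1]; simp
    rw [norm_mul, Complex.norm_real, Real.norm_of_nonneg hs0] at h2
    nlinarith [norm_nonneg u]
  have hd : ∀ u : ℂ, ‖u‖ ≤ 1 → DifferentiableAt ℂ F u := by
    intro u hu
    have := hne u hu
    simp only [hF]
    fun_prop (disch := assumption)
  have hdc : DiffContOnCl ℂ F (Metric.ball 0 1) := by
    refine DifferentiableOn.diffContOnCl fun u hu => (hd u ?_).differentiableWithinAt
    rw [closure_ball _ one_ne_zero] at hu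
    simpa using hu
  -- Cauchy's estimate on the unit circle: by `hb` the power is bounded by 1 there for every `m`,
  -- and `s < 1` keeps the pole outside the closed disc.
  have hbd : ∀ j, ‖iteratedDeriv j F 0‖ ≤ j.factorial * 1 / 1 ^ j := by
    intro j
    refine Complex.norm_iteratedDeriv_le_of_forall_mem_sphere_norm_le j one_pos hdc fun z hz => ?_
    have hz1 : ‖z‖ = 1 := by simpa using hz
    simp only [hF, norm_pow, norm_div]
    refine pow_le_one₀ (by positivity) (div_le_one_of_le₀ (hb z hz1.le) (norm_nonneg _))
  refine ⟨fun j => ((j.factorial : ℂ)⁻¹ * iteratedDeriv j F 0).re, ?_, ?_, ?_, ?_⟩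
  · simp only [iteratedDeriv_zero, Nat.factorial_zero, hF]
    simp [← Complex.ofReal_pow]
  · have : HasDerivAt F (((m * p ^ (m - 1) * (q + p * s) : ℝ) : ℂ)) 0 := by
      have h1 : HasDerivAt (fun u : ℂ => (p + q * u : ℂ)) q 0 := by
        simpa using ((hasDerivAt_id (0 : ℂ)).const_mul (q : ℂ)).const_add (p : ℂ)
      have h2 : HasDerivAt (fun u : ℂ => (1 - s * u : ℂ)) (-s) 0 := by
        simpa using ((hasDerivAt_id (0 : ℂ)).const_mul (s : ℂ)).const_sub 1
      have h3 := (h1.div h2 (hne 0 (by simp))).pow m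
      refine h3.congr_deriv ?_
      simp
    simp [iteratedDeriv_one, this.deriv, -Complex.ofReal_mul]
  · intro j
    refine (Complex.abs_re_le_norm _).trans ?_
    rw [norm_mul, norm_inv, Complex.norm_natCast]
    have := hbd j
    have hj : (0 : ℝ) < j.factorial := by positivity
    rw [inv_mul_le_iff₀ hj]
    simpa using this
  · intro u hu
    have h := Complex.hasSum_taylorSeries_on_ball (f := F) (c := 0) (r := 1) (z := (u : ℂ))
      hdc.differentiableOn (by simp [abs_of_nonneg hu.1, hu.2])
    have h' := Complex.hasSum_re h
    convert h' using 1
    · ext j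
      simp only [sub_zero, smul_eq_mul]
      rw [← Complex.re_mul_ofReal]
      push_cast
      congr 1; ring
    · simp only [hF]
      norm_cast

/-! ### Observables of the pair (-log Π⁺, -log Π⁻) -/

/-- Pairs `(-log Π⁺, -log Π⁻)`. -/
abbrev LogPair : Type := ℝ≥0 × ℝ≥0

/-- Bounded continuous functions of `(-log Π⁺, -log Π⁻)`. -/
def Obs : Type := LogPair →ᵇ ℝ

namespace Obs

instance : NormedAddCommGroup Obs :=
  inferInstanceAs (NormedAddCommGroup (LogPair →ᵇ ℝ))

instance : NormedSpace ℝ Obs := inferInstanceAs (NormedSpace ℝ (LogPair →ᵇ ℝ))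

instance : CompleteSpace Obs := inferInstanceAs (CompleteSpace (LogPair →ᵇ ℝ))

instance : FunLike Obs LogPair ℝ := inferInstanceAs (FunLike (LogPair →ᵇ ℝ) LogPair ℝ)

@[ext]
theorem ext {f g : Obs} (h : ∀ z, f z = g z) : f = g := BoundedContinuousFunction.ext h

theorem continuous (g : Obs) : Continuous g := BoundedContinuousFunction.continuous g

theorem norm_coe_le_norm (g : Obs) (z : LogPair) : ‖g z‖ ≤ ‖g‖ :=
  BoundedContinuousFunction.norm_coe_le_norm g z

@[simp] theorem add_apply (f g : Obs) (z : LogPair) : (f + g) z = f z + g z := rfl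

@[simp] theorem sub_apply (f g : Obs) (z : LogPair) : (f - g) z = f z - g z := rfl

@[simp] theorem smul_apply (c : ℝ) (g : Obs) (z : LogPair) : (c • g) z = c * g z := rfl

/-- The bounded continuous function given by a continuous function bounded by `C`. -/
def mk (f : LogPair → ℝ) (hf : Continuous f) (C : ℝ) (hC : ∀ z, |f z| ≤ C) : Obs :=
  BoundedContinuousFunction.ofNormedAddCommGroup f hf C hC

@[simp] theorem mk_apply (f : LogPair → ℝ) (hf : Continuous f) (C : ℝ) (hC : ∀ z, |f z| ≤ C)
    (z : LogPair) : mk f hf C hC z = f z := rfl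

theorem norm_mk_le (f : LogPair → ℝ) (hf : Continuous f) {C : ℝ} (hC : ∀ z, |f z| ≤ C) :
    ‖mk f hf C hC‖ ≤ C :=
  BoundedContinuousFunction.norm_ofNormedAddCommGroup_le _ ((abs_nonneg _).trans (hC 0)) _

/-- Evaluation at a point. -/
def eval (z : LogPair) : Obs →L[ℝ] ℝ :=
  BoundedContinuousFunction.evalCLM (β := ℝ) ℝ z

@[simp] theorem eval_apply (z : LogPair) (g : Obs) : eval z g = g z := rfl

end Obs

instance : NormedAlgebra ℚ (Obs →L[ℝ] Obs) := .restrictScalars ℚ ℝ _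

/-! ### Clause averaging operators and compound Poisson generators -/

/-- The increment of `(-log Π⁺, -log Π⁻)` caused by one clause of weight `1 - u`. -/
def inc (s : Bool) (u : ℝ) : LogPair :=
  -- At `u = 1` the true increment is infinite, while `Real.log 0 = 0` makes it `0` here. This is
  -- harmless, since the clause laws in use give no mass to `1`.
  if s then ((-Real.log (1 - u)).toNNReal, 0) else (0, (-Real.log (1 - u)).toNNReal)

@[fun_prop]
theorem measurable_inc (s : Bool) : Measurable (inc s) := by
  unfold inc
  cases s <;> simp only [if_true, if_false, Bool.false_eq_true] <;> fun_prop

theorem integrable_comp_inc (ρ : Measure ℝ) [IsProbabilityMeasure ρ] (s : Bool)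
    (g : Obs) (z : LogPair) : Integrable (fun u => g (z + inc s u)) ρ := by
  refine Integrable.of_bound (C := ‖g‖) ?_ (ae_of_all _ fun u => g.norm_coe_le_norm _)
  exact (g.continuous.measurable.comp (by fun_prop)).aestronglyMeasurable

/-- Averaging over the addition of one clause of sign `s` whose weight has law `ρ`. -/
def shiftOp (ρ : Measure ℝ) [IsProbabilityMeasure ρ] (s : Bool) :
    Obs →L[ℝ] Obs :=
  LinearMap.mkContinuous
    { toFun := fun g => Obs.mk
        (fun z => ∫ u, g (z + inc s u) ∂ρ)
        (continuous_of_dominated (bound := fun _ => ‖g‖)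
          (fun z => (integrable_comp_inc ρ s g z).aestronglyMeasurable)
          (fun z => ae_of_all _ fun u => g.norm_coe_le_norm _)
          (integrable_const _)
          (ae_of_all _ fun u => g.continuous.comp (by fun_prop)))
        ‖g‖
        (fun z => by
          have := norm_integral_le_of_norm_le_const (μ := ρ) (f := fun u => g (z + inc s u))
            (C := ‖g‖) (ae_of_all _ fun u => g.norm_coe_le_norm _)
          simpa using this)
      map_add' := fun f g => by
        ext z
        exact integral_add (integrable_comp_inc ρ s f z) (integrable_comp_inc ρ s g z)
      map_smul' := fun c g => by
        ext z
        exact integral_const_mul c fun u => g (z + inc s u) }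
    1 fun g => by
      rw [one_mul]
      refine Obs.norm_mk_le _ _ fun z => ?_
      have := norm_integral_le_of_norm_le_const (μ := ρ) (f := fun u => g (z + inc s u))
        (C := ‖g‖) (ae_of_all _ fun u => g.norm_coe_le_norm _)
      simpa using this

theorem shiftOp_apply (ρ : Measure ℝ) [IsProbabilityMeasure ρ] (s : Bool) (g : Obs)
    (z : LogPair) : shiftOp ρ s g z = ∫ u, g (z + inc s u) ∂ρ := rfl

/-- Increments are added in a commutative group of shifts, and Fubini exchanges the two averages. -/
theorem commute_shiftOp (ρ σ : Measure ℝ) [IsProbabilityMeasure ρ] [IsProbabilityMeasure σ]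
    (s t : Bool) : Commute (shiftOp ρ s) (shiftOp σ t) := by
  ext g z
  simp only [mul_apply_eq_comp, shiftOp_apply]
  rw [integral_integral_swap]
  · simp only [add_assoc, add_comm (inc s _)]
  · refine Integrable.of_bound (C := ‖g‖) ?_ (ae_of_all _ fun u => g.norm_coe_le_norm _)
    refine (g.continuous.measurable.comp (g := g) ?_).aestronglyMeasurable
    fun_prop

/-- Sum of the averaging operators of both signs. -/
def pairOp (ρ : Measure ℝ) [IsProbabilityMeasure ρ] : Obs →L[ℝ] Obs :=
  shiftOp ρ true + shiftOp ρ false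

theorem pairOp_apply (ρ : Measure ℝ) [IsProbabilityMeasure ρ] (g : Obs) (z : LogPair) :
    pairOp ρ g z = ∫ u, (g (z + inc true u) + g (z + inc false u)) ∂ρ :=
  (integral_add (integrable_comp_inc ρ true g z) (integrable_comp_inc ρ false g z)).symm

theorem commute_pairOp (ρ σ : Measure ℝ) [IsProbabilityMeasure ρ] [IsProbabilityMeasure σ] :
    Commute (pairOp ρ) (pairOp σ) :=
  ((commute_shiftOp _ _ _ _).add_right (commute_shiftOp _ _ _ _)).add_left
    ((commute_shiftOp _ _ _ _).add_right (commute_shiftOp _ _ _ _))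

/-- Generator of the compound Poisson semigroup with clause rate `r` for each sign. -/
def gen (ρ : Measure ℝ) [IsProbabilityMeasure ρ] (r : ℝ) :
    Obs →L[ℝ] Obs := r • pairOp ρ - (2 * r) • 1

theorem gen_apply (ρ : Measure ℝ) [IsProbabilityMeasure ρ] (r : ℝ) (g : Obs)
    (z : LogPair) :
    gen ρ r g z = r * ∫ u, (g (z + inc true u) + g (z + inc false u) - 2 * g z) ∂ρ := by
  have h := integral_sub ((integrable_comp_inc ρ true g z).add (integrable_comp_inc ρ false g z))
    (integrable_const (2 * g z))
  simp only [Pi.add_apply] at h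
  rw [h, ← pairOp_apply]
  simp [gen]
  ring

theorem commute_gen (ρ σ : Measure ℝ) [IsProbabilityMeasure ρ] [IsProbabilityMeasure σ]
    (r s : ℝ) : Commute (gen ρ r) (gen σ s) := by
  unfold gen
  refine Commute.sub_left (Commute.sub_right ?_ ?_) (Commute.sub_right ?_ ?_)
  · exact ((commute_pairOp ρ σ).smul_right _).smul_left _
  · exact (Commute.one_right _).smul_right _
  · exact (Commute.one_left _).smul_left _
  · exact (Commute.one_left _).smul_left _

/-! ### Exponentials of generators: weighted bounds and the mean value inequality -/

theorem hasSum_exp_apply (K : Obs →L[ℝ] Obs) (h : Obs)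
    (z : LogPair) :
    HasSum (fun n : ℕ => ((n.factorial : ℝ)⁻¹) * ((K ^ n) h) z) (NormedSpace.exp K h z) := by
  have h1 := NormedSpace.exp_series_hasSum_exp' (𝕂 := ℝ) K
  exact h1.mapL ((Obs.eval z).comp (ContinuousLinearMap.apply ℝ _ h))

/-- The n-th term of the exponential series costs at most c^n. The weight `φ` need not be bounded,
which admits the weight 1/Π⁻. -/
theorem abs_exp_apply_le (K : Obs →L[ℝ] Obs) (φ : LogPair → ℝ) (c : ℝ)
    (hK : ∀ (h : Obs) (C : ℝ), (∀ z, |h z| ≤ C * φ z) → ∀ z, |K h z| ≤ c * C * φ z)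
    (h : Obs) (C : ℝ) (hC : ∀ z, |h z| ≤ C * φ z) (z : LogPair) :
    |NormedSpace.exp K h z| ≤ Real.exp c * C * φ z := by
  have hn : ∀ n z, |(K ^ n) h z| ≤ c ^ n * C * φ z := by
    intro n
    induction n with
    | zero => simpa using hC
    | succ n ih =>
      intro z
      rw [pow_succ', mul_apply_eq_comp]
      refine (hK _ _ ih z).trans (le_of_eq (by ring))
  have h2 : HasSum (fun n : ℕ => (n.factorial : ℝ)⁻¹ * (c ^ n * C * φ z))
      (Real.exp c * C * φ z) := by
    have := NormedSpace.exp_series_hasSum_exp' (𝕂 := ℝ) c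
    rw [← Real.exp_eq_exp_ℝ] at this
    simpa [mul_assoc] using this.mul_right (C * φ z)
  rw [← (hasSum_exp_apply K h z).tsum_eq, ← Real.norm_eq_abs]
  refine tsum_of_norm_bounded h2 fun n => ?_
  rw [norm_mul, Real.norm_eq_abs, Real.norm_eq_abs, abs_of_nonneg (by positivity)]
  exact mul_le_mul_of_nonneg_left (hn n z) (by positivity)

theorem exp_apply_eigen (K : Obs →L[ℝ] Obs) (h : Obs) (c : ℝ)
    (hK : K h = c • h) (z : LogPair) : NormedSpace.exp K h z = Real.exp c * h z := by
  have hn : ∀ n, (K ^ n) h = c ^ n • h := by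
    intro n
    induction n with
    | zero => simp
    | succ n ih =>
      rw [pow_succ, mul_apply_eq_comp, hK, map_smul, ih, smul_smul, pow_succ']
  have h2 : HasSum (fun n : ℕ => (n.factorial : ℝ)⁻¹ * ((K ^ n) h) z) (Real.exp c * h z) := by
    have := NormedSpace.exp_series_hasSum_exp' (𝕂 := ℝ) c
    rw [← Real.exp_eq_exp_ℝ] at this
    simpa [hn, mul_assoc] using this.mul_right (h z)
  exact (hasSum_exp_apply K h z).unique h2

theorem exp_sub_smul_one (K : Obs →L[ℝ] Obs) (a : ℝ) :
    NormedSpace.exp (K - a • 1) = Real.exp (-a) • NormedSpace.exp K := by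
  rw [sub_eq_add_neg, ← neg_smul, NormedSpace.exp_add_of_commute
    ((Commute.one_right _).smul_right _)]
  have : NormedSpace.exp ((-a) • (1 : Obs →L[ℝ] Obs))
      = Real.exp (-a) • 1 := by
    rw [← Algebra.algebraMap_eq_smul_one, ← NormedSpace.algebraMap_exp_comm,
      Algebra.algebraMap_eq_smul_one, Real.exp_eq_exp_ℝ]
  rw [this]
  simp

/-- Mean value inequality along the segment between two commuting generators. -/
theorem abs_exp_sub_exp_sub_le (A B : Obs →L[ℝ] Obs) (hAB : Commute A B)
    (g : Obs) (z : LogPair) (m R : ℝ)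
    (hR : ∀ t ∈ Set.Icc (0 : ℝ) 1,
      |NormedSpace.exp (A + t • (B - A)) ((B - A) g) z - m| ≤ R) :
    ∀ t ∈ Set.Icc (0 : ℝ) 1,
    |NormedSpace.exp (A + t • (B - A)) g z - NormedSpace.exp A g z - t * m| ≤ R * t := by
  have hcomm : Commute A (B - A) := hAB.sub_right (Commute.refl A)
  have hder : ∀ t : ℝ, HasDerivAt
      (fun t : ℝ => NormedSpace.exp (A + t • (B - A)) g z - t * m)
      (NormedSpace.exp (A + t • (B - A)) ((B - A) g) z - m) t := by
    intro t
    have h1 := (hasDerivAt_exp_smul_const (𝕂 := ℝ) (B - A) t).const_mul (NormedSpace.exp A)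
    have h2 := ((Obs.eval z).comp
      (ContinuousLinearMap.apply ℝ Obs g)).hasFDerivAt.comp_hasDerivAt t h1
    have h3 := h2.sub ((hasDerivAt_id t).mul_const m)
    -- Commutation factors the exponential, so its derivative in `t` is the exponential composed
    -- with `B - A`.
    have he : ∀ t : ℝ, NormedSpace.exp (A + t • (B - A)) =
        NormedSpace.exp A * NormedSpace.exp (t • (B - A)) := fun t =>
      NormedSpace.exp_add_of_commute (hcomm.smul_right t)
    refine (h3.congr_of_eventuallyEq (Eventually.of_forall fun t => ?_)).congr_deriv ?_
    · rw [he]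
      rfl
    · rw [he]
      simp
  intro t ht
  have := norm_image_sub_le_of_norm_deriv_le_segment'
    (f := fun t : ℝ => NormedSpace.exp (A + t • (B - A)) g z - t * m) (a := 0) (b := 1)
    (fun x _ => (hder x).hasDerivWithinAt) (C := R)
    (fun x hx => hR x (Set.Ico_subset_Icc_self hx)) t ht
  simp only [zero_smul, add_zero, zero_mul, sub_zero, Real.norm_eq_abs] at this
  convert this using 2
  ring

/-- `φ` is multiplied by at most `c` when it is averaged over one clause of either sign. -/
def SubEigen (ρ : Measure ℝ) (φ : LogPair → ℝ) (c : ℝ) : Prop :=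
  ∀ z, Integrable (fun u => φ (z + inc true u)) ρ ∧ Integrable (fun u => φ (z + inc false u)) ρ ∧
    ∫ u, (φ (z + inc true u) + φ (z + inc false u)) ∂ρ ≤ c * φ z

theorem abs_pairOp_le {ρ : Measure ℝ} [IsProbabilityMeasure ρ] {φ : LogPair → ℝ} {c : ℝ}
    (hφ : SubEigen ρ φ c) (h : Obs) (C : ℝ) (hC0 : 0 ≤ C) (hC : ∀ z, |h z| ≤ C * φ z)
    (z : LogPair) : |pairOp ρ h z| ≤ c * C * φ z := by
  obtain ⟨h1, h2, h3⟩ := hφ z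
  rw [pairOp_apply]
  calc |∫ u, (h (z + inc true u) + h (z + inc false u)) ∂ρ|
      ≤ ∫ u, C * (φ (z + inc true u) + φ (z + inc false u)) ∂ρ := by
        rw [← Real.norm_eq_abs]
        refine norm_integral_le_of_norm_le ((h1.add h2).const_mul C) (ae_of_all _ fun u => ?_)
        rw [Real.norm_eq_abs, mul_add]
        exact (abs_add_le _ _).trans (add_le_add (hC _) (hC _))
    _ = C * ∫ u, (φ (z + inc true u) + φ (z + inc false u)) ∂ρ := integral_const_mul _ _
    _ ≤ C * (c * φ z) := mul_le_mul_of_nonneg_left h3 hC0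
    _ = c * C * φ z := by ring

/-- For nonnegative rates and `t ∈ [0, 1]` this is a nonnegative combination of averages minus a
multiple of the identity. Its exponential is then a positive operator, and weighted bounds hold
along the whole segment. -/
theorem segment_gen (ρ σ : Measure ℝ) [IsProbabilityMeasure ρ] [IsProbabilityMeasure σ]
    (r s t : ℝ) : gen ρ r + t • (gen σ s - gen ρ r) =
      (((1 - t) * r) • pairOp ρ + (t * s) • pairOp σ) -
        (2 * ((1 - t) * r + t * s)) • 1 := by
  unfold gen
  module

/-- The subtracted multiple of the identity turns the multipliers `c`, `d` into the growth rates `c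
- 2`, `d - 2`, which are interpolated along the segment. -/
theorem abs_exp_segment_le {ρ σ : Measure ℝ} [IsProbabilityMeasure ρ] [IsProbabilityMeasure σ]
    {φ : LogPair → ℝ} {c d r s t : ℝ} (hφ0 : ∀ z, 0 < φ z) (hr : 0 ≤ r) (hs : 0 ≤ s)
    (ht : t ∈ Set.Icc (0 : ℝ) 1) (hρ : SubEigen ρ φ c) (hσ : SubEigen σ φ d)
    (h : Obs) (C : ℝ) (hC : ∀ z, |h z| ≤ C * φ z) (z : LogPair) :
    |NormedSpace.exp (gen ρ r + t • (gen σ s - gen ρ r)) h z| ≤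
      Real.exp ((1 - t) * (r * (c - 2)) + t * (s * (d - 2))) * C * φ z := by
  rw [segment_gen, exp_sub_smul_one]
  have hK := abs_exp_apply_le (((1 - t) * r) • pairOp ρ + (t * s) • pairOp σ) φ
    ((1 - t) * r * c + t * s * d) (fun h C hC z => by
      have hC0 : 0 ≤ C := nonneg_of_mul_nonneg_left ((abs_nonneg _).trans (hC z)) (hφ0 z)
      have e1 := abs_pairOp_le hρ h C hC0 hC z
      have e2 := abs_pairOp_le hσ h C hC0 hC z
      have p1 : 0 ≤ (1 - t) * r := mul_nonneg (by linarith [ht.2]) hr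
      have p2 : 0 ≤ t * s := mul_nonneg ht.1 hs
      calc |((((1 - t) * r) • pairOp ρ + (t * s) • pairOp σ) h) z|
          = |((1 - t) * r) * pairOp ρ h z + (t * s) * pairOp σ h z| := by simp
        _ ≤ ((1 - t) * r) * |pairOp ρ h z| + (t * s) * |pairOp σ h z| := by
            refine (abs_add_le _ _).trans (le_of_eq ?_)
            rw [abs_mul _ (pairOp ρ h z), abs_mul _ (pairOp σ h z), abs_of_nonneg p1,
              abs_of_nonneg p2]
        _ ≤ ((1 - t) * r) * (c * C * φ z) + (t * s) * (d * C * φ z) := by gcongr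
        _ = _ := by ring) h C hC z
  rw [smul_apply, Obs.smul_apply, abs_mul,
    abs_of_pos (Real.exp_pos _)]
  refine (mul_le_mul_of_nonneg_left hK (Real.exp_pos _).le).trans (le_of_eq ?_)
  rw [← mul_assoc, ← mul_assoc, ← Real.exp_add]
  congr 3
  ring

/-! ### Moments and the law of a clause product -/

/-- The `m`-th moment of `μ`. -/
def mom (μ : ProbabilityMeasure unitInterval) (m : ℕ) : ℝ :=
  ∫ x, (x : ℝ) ^ m ∂(μ : Measure unitInterval)

theorem integral_prod_range_infinitePi {X : Type*} [MeasurableSpace X] (ν : Measure X)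
    [IsProbabilityMeasure ν] (f : X → ℝ) (hf : Measurable f) (n : ℕ) :
    ∫ x, ∏ j ∈ Finset.range n, f (x j) ∂(Measure.infinitePi fun _ : ℕ => ν) =
      (∫ x, f x ∂ν) ^ n := by
  have h1 := integral_restrict_infinitePi (μ := fun _ : ℕ => ν) (s := Finset.range n)
    (f := fun y => ∏ i, f (y i))
    (Measurable.aestronglyMeasurable (by fun_prop))
  rw [integral_fintype_prod_eq_pow f] at h1
  simp only [Fintype.card_coe, Finset.card_range] at h1
  rw [← h1]
  refine integral_congr_ae (ae_of_all _ fun x => ?_)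
  exact (Finset.prod_coe_sort (Finset.range n) (fun j => f (x j))).symm

/-- The law of `∏_{j=1}^{k-1} η_j` for independent `η_j` of law `μ`. -/
def clauseLaw (k : ℕ) (μ : ProbabilityMeasure unitInterval) : Measure ℝ :=
  (Measure.infinitePi fun _ : ℕ => (μ : Measure unitInterval)).map
    fun x => ∏ j ∈ Finset.range (k - 1), (x j : ℝ)

theorem measurable_prod_range (n : ℕ) :
    Measurable fun x : ℕ → unitInterval => ∏ j ∈ Finset.range n, (x j : ℝ) := by fun_prop

instance (k : ℕ) (μ : ProbabilityMeasure unitInterval) : IsProbabilityMeasure (clauseLaw k μ) :=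
  Measure.isProbabilityMeasure_map (measurable_prod_range _).aemeasurable

theorem integral_pow_clauseLaw (k : ℕ) (μ : ProbabilityMeasure unitInterval) (m : ℕ) :
    ∫ u, u ^ m ∂(clauseLaw k μ) = mom μ m ^ (k - 1) := by
  rw [clauseLaw, integral_map (measurable_prod_range _).aemeasurable
    (by fun_prop : Measurable fun u : ℝ => u ^ m).aestronglyMeasurable]
  simp only [← Finset.prod_pow]
  exact integral_prod_range_infinitePi _ (fun x : unitInterval => (x : ℝ) ^ m) (by fun_prop) _

theorem prod_range_mem_Icc (n : ℕ) (x : ℕ → unitInterval) :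
    ∏ j ∈ Finset.range n, (x j : ℝ) ∈ Set.Icc (0 : ℝ) 1 :=
  prod_mem_Icc _ _ fun j _ => (x j).2

theorem prod_range_lt_one {n : ℕ} (hn : n ≠ 0) (x : ℕ → unitInterval) (h : (x 0 : ℝ) < 1) :
    ∏ j ∈ Finset.range n, (x j : ℝ) < 1 := by
  obtain ⟨n, rfl⟩ := Nat.exists_eq_succ_of_ne_zero hn
  rw [Nat.succ_eq_add_one, Finset.prod_range_succ']
  have h1 := prod_range_mem_Icc n (fun j => x (j + 1))
  have h0 := (x 0).2
  nlinarith [h1.1, h1.2, h0.1]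

theorem ae_clauseLaw_mem {k : ℕ} (hk : 2 ≤ k) {μ : ProbabilityMeasure unitInterval}
    (hμ : ∀ᵐ x : unitInterval ∂(μ : Measure unitInterval), (x : ℝ) < 1) :
    ∀ᵐ u ∂(clauseLaw k μ), u ∈ Set.Ico (0 : ℝ) 1 := by
  rw [clauseLaw, ae_map_iff (p := fun u => u ∈ Set.Ico (0 : ℝ) 1)
    (measurable_prod_range _).aemeasurable measurableSet_Ico]
  filter_upwards [(measurePreserving_eval_infinitePi
    (fun _ : ℕ => (μ : Measure unitInterval)) 0).quasiMeasurePreserving.ae hμ] with x hx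
  exact ⟨(prod_range_mem_Icc _ _).1, prod_range_lt_one (by omega) x hx⟩

/-- `∏_{j=1}^{k-1} η_{ij}` for the row `p = (sign, i)`. -/
def rowProd (k : ℕ) (η : Arr) (p : Bool × ℕ) : ℝ :=
  ∏ j ∈ Finset.range (k - 1), (η (Sum.inr (p.1, p.2, j)) : ℝ)

@[fun_prop]
theorem measurable_rowProd (k : ℕ) (p : Bool × ℕ) : Measurable fun η => rowProd k η p := by
  unfold rowProd; fun_prop

/-- Distinct rows use disjoint sets of indices, so the row products are independent copies of the
clause product. The array is restricted to its row indices, curried, and mapped row by row. -/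
theorem map_rowProd (k : ℕ) (μ : ProbabilityMeasure unitInterval) :
    (Measure.infinitePi fun _ : Idx => (μ : Measure unitInterval)).map (rowProd k) =
      Measure.infinitePi fun _ : Bool × ℕ => clauseLaw k μ := by
  have hinj : Function.Injective fun q : (Bool × ℕ) × ℕ => (Sum.inr (q.1.1, q.1.2, q.2) : Idx) := by
    rintro ⟨⟨a, b⟩, c⟩ ⟨⟨a', b'⟩, c'⟩ h
    simp only [Sum.inr.injEq, Prod.mk.injEq] at h
    simp [h]
  have h1 := Measure.map_infinitePi_infinitePi_of_inj
    (P := fun _ : Idx => (μ : Measure unitInterval)) hinj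
  have h2 := Measure.infinitePi_map_curry
    (fun (_ : Bool × ℕ) (_ : ℕ) => (μ : Measure unitInterval))
  have h3 := Measure.infinitePi_map_pi
    (μ := fun _ : Bool × ℕ => Measure.infinitePi fun _ : ℕ => (μ : Measure unitInterval))
    (f := fun _ x => ∏ j ∈ Finset.range (k - 1), (x j : ℝ))
    (fun _ => measurable_prod_range _)
  change _ = Measure.infinitePi fun _ : Bool × ℕ => Measure.map _ _
  rw [← h3, ← h2, ← h1, Measure.map_map (by fun_prop) (by fun_prop),
    Measure.map_map (by fun_prop) (by fun_prop)]
  rfl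

/-! ### The compound Poisson law and its generator -/

/-- `(-log Π⁺, -log Π⁻)`. -/
def logPair (k : ℕ) (ω : Sample) : LogPair :=
  ∑ i ∈ Finset.range ω.1.1, inc true (rowProd k ω.2 (true, i)) +
    ∑ i ∈ Finset.range ω.1.2, inc false (rowProd k ω.2 (false, i))

@[fun_prop]
theorem measurable_logPair (k : ℕ) : Measurable (logPair k) := by
  unfold logPair
  refine measurable_from_prod_countable_right fun d => ?_
  have : ∀ s i, Measurable fun η => inc s (rowProd k η (s, i)) := fun s i =>
    (measurable_inc s).comp (measurable_rowProd k _)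
  exact (Finset.measurable_fun_sum (Finset.range d.1) fun i _ => this true i).add
    (Finset.measurable_fun_sum (Finset.range d.2) fun i _ => this false i)

section CompoundPoisson

variable (ρ : Measure ℝ) [IsProbabilityMeasure ρ]

/-- The increment of row `p` is independent of those in `F`, so it can be integrated out first; this
replaces `g` by its average. -/
theorem integral_sum_insert (g : Obs) (z : LogPair) (F : Finset (Bool × ℕ)) (p : Bool × ℕ)
    (hp : p ∉ F) :
    ∫ w, g (z + ∑ q ∈ insert p F, inc q.1 (w q)) ∂(Measure.infinitePi fun _ : Bool × ℕ => ρ) =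
      ∫ w, shiftOp ρ p.1 g (z + ∑ q ∈ F, inc q.1 (w q))
        ∂(Measure.infinitePi fun _ : Bool × ℕ => ρ) := by
  set ν := Measure.infinitePi fun _ : Bool × ℕ => ρ with hν
  have hind : iIndepFun (fun (q : Bool × ℕ) (w : Bool × ℕ → ℝ) => inc q.1 (w q)) ν :=
    iIndepFun_infinitePi (X := fun q : Bool × ℕ => inc q.1) (fun q => measurable_inc _)
  have hm : ∀ q : Bool × ℕ, Measurable fun w : Bool × ℕ → ℝ => inc q.1 (w q) := fun q =>
    (measurable_inc _).comp (measurable_pi_apply q)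
  have hi := hind.indepFun_finsetSum_of_notMem hm hp
  have hmF : Measurable (∑ q ∈ F, fun w : Bool × ℕ → ℝ => inc q.1 (w q)) :=
    by
      have := Finset.measurable_fun_sum
        (f := fun (q : Bool × ℕ) (w : Bool × ℕ → ℝ) => inc q.1 (w q)) F fun q _ => hm q
      convert this using 1
      ext w <;> simp
  have hprod := hi.map_prod_eq_prod_map_map hmF.aemeasurable (hm p).aemeasurable
  have hgm : Measurable g := g.continuous.measurable
  have hG : Measurable fun y : LogPair × LogPair => g (z + y.1 + y.2) := by fun_prop
  calc ∫ w, g (z + ∑ q ∈ insert p F, inc q.1 (w q)) ∂ν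
      = ∫ y, g (z + y.1 + y.2) ∂(ν.map fun w =>
          ((∑ q ∈ F, fun w : Bool × ℕ → ℝ => inc q.1 (w q)) w, inc p.1 (w p))) := by
        rw [integral_map (hmF.prodMk (hm p)).aemeasurable hG.aestronglyMeasurable]
        refine integral_congr_ae (ae_of_all _ fun w => ?_)
        simp only [Finset.sum_insert hp, Finset.sum_apply]
        congr 1
        abel
    _ = ∫ a, ∫ b, g (z + a + b) ∂(ν.map fun w => inc p.1 (w p))
          ∂(ν.map (∑ q ∈ F, fun w : Bool × ℕ → ℝ => inc q.1 (w q))) := by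
        rw [hprod]
        have := Measure.isProbabilityMeasure_map (μ := ν) hmF.aemeasurable
        have := Measure.isProbabilityMeasure_map (μ := ν) (hm p).aemeasurable
        exact integral_prod (fun y : LogPair × LogPair => g (z + y.1 + y.2))
          (Integrable.of_bound (C := ‖g‖) hG.aestronglyMeasurable
          (ae_of_all _ fun y => g.norm_coe_le_norm _))
    _ = ∫ a, shiftOp ρ p.1 g (z + a)
          ∂(ν.map (∑ q ∈ F, fun w : Bool × ℕ → ℝ => inc q.1 (w q))) := by
        refine integral_congr_ae (ae_of_all _ fun a => ?_)
        simp only [shiftOp_apply]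
        rw [integral_map (hm p).aemeasurable
          (by fun_prop : Measurable fun b => g (z + a + b)).aestronglyMeasurable]
        have he := Measure.infinitePi_map_eval (fun _ : Bool × ℕ => ρ) p
        conv_rhs => rw [← he]
        rw [integral_map (measurable_pi_apply p).aemeasurable
          (Measurable.aestronglyMeasurable (by fun_prop))]
    _ = _ := by
        have hc : Continuous fun a => shiftOp ρ p.1 g (z + a) :=
          (shiftOp ρ p.1 g).continuous.comp (by fun_prop)
        rw [integral_map hmF.aemeasurable hc.measurable.aestronglyMeasurable]
        simp only [Finset.sum_apply]

theorem integral_sum_inc (g : Obs) (z : LogPair) (n m : ℕ) :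
    ∫ w, g (z + (∑ i ∈ Finset.range n, inc true (w (true, i)) +
        ∑ i ∈ Finset.range m, inc false (w (false, i))))
        ∂(Measure.infinitePi fun _ : Bool × ℕ => ρ) =
      ((shiftOp ρ true) ^ n) (((shiftOp ρ false) ^ m) g) z := by
  have key : ∀ (n m : ℕ) (g : Obs), ∫ w, g (z + ∑ q ∈ (Finset.range n).image (Prod.mk true) ∪
        (Finset.range m).image (Prod.mk false), inc q.1 (w q))
        ∂(Measure.infinitePi fun _ : Bool × ℕ => ρ) =
      ((shiftOp ρ true) ^ n) (((shiftOp ρ false) ^ m) g) z := by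
    intro n
    induction n with
    | zero =>
      intro m
      induction m with
      | zero => intro g; simp
      | succ m ih =>
        intro g
        rw [Finset.range_add_one (n := m), Finset.image_insert, Finset.union_insert,
          integral_sum_insert _ _ _ _ _ (by simp), ih, pow_succ (shiftOp ρ false)]
        rfl
    | succ n ih =>
      intro m g
      rw [Finset.range_add_one (n := n), Finset.image_insert, Finset.insert_union,
        integral_sum_insert _ _ _ _ _ (by simp), ih]
      change ((shiftOp ρ true ^ n) * ((shiftOp ρ false ^ m) * shiftOp ρ true)) g z =
        ((shiftOp ρ true ^ (n + 1)) * (shiftOp ρ false ^ m)) g z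
      -- The new positive row acts on `g` first; commutation brings its operator next to those of
      -- the other positive rows.
      rw [((commute_shiftOp ρ ρ false true).pow_left m).eq, ← mul_assoc, ← pow_succ]
  rw [← key]
  refine integral_congr_ae (ae_of_all _ fun w => ?_)
  simp only
  rw [Finset.sum_union, Finset.sum_image (by simp), Finset.sum_image (by simp)]
  rw [Finset.disjoint_left]
  simp

/-- The exponential series carries Poisson(r) weights. Only the positive sign is expanded here and
the negative one in `hasSum_exp_shiftOp`, matching the iterated integral over the two degrees. -/
theorem hasSum_exp_gen (g : Obs) (z : LogPair) (r : ℝ) :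
    HasSum (fun n : ℕ => Real.exp (-r) * r ^ n / n.factorial *
      ((shiftOp ρ true ^ n) (NormedSpace.exp (r • shiftOp ρ false - r • 1) g)) z)
      (NormedSpace.exp (gen ρ r) g z) := by
  have hc : Commute (r • shiftOp ρ true) (r • shiftOp ρ false - r • 1) :=
    (((commute_shiftOp ρ ρ true false).smul_right r).sub_right
      ((Commute.one_right _).smul_right r)).smul_left r
  have he : gen ρ r = (r • shiftOp ρ true + (r • shiftOp ρ false - r • 1)) - r • 1 := by
    unfold gen pairOp
    module
  rw [he, exp_sub_smul_one (r • shiftOp ρ true + (r • shiftOp ρ false - r • 1)), NormedSpace.exp_add_of_commute hc]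
  have := (hasSum_exp_apply (r • shiftOp ρ true)
    (NormedSpace.exp (r • shiftOp ρ false - r • 1) g) z).mul_left (Real.exp (-r))
  rw [smul_apply, Obs.smul_apply, mul_apply_eq_comp]
  refine this.congr_fun fun n => ?_
  rw [smul_pow, smul_apply, Obs.smul_apply]
  ring

theorem hasSum_exp_shiftOp (g : Obs) (z : LogPair) (r : ℝ) (n : ℕ) :
    HasSum (fun m : ℕ => Real.exp (-r) * r ^ m / m.factorial *
      ((shiftOp ρ true ^ n) ((shiftOp ρ false ^ m) g)) z)
      (((shiftOp ρ true ^ n) (NormedSpace.exp (r • shiftOp ρ false - r • 1) g)) z) := by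
  rw [exp_sub_smul_one]
  have h1 := NormedSpace.exp_series_hasSum_exp' (𝕂 := ℝ) (r • shiftOp ρ false)
  have h2 := h1.mapL (((Obs.eval z).comp (shiftOp ρ true ^ n)).comp
    (ContinuousLinearMap.apply ℝ _ g))
  have h3 := h2.mul_left (Real.exp (-r))
  rw [smul_apply, map_smul, Obs.smul_apply]
  refine h3.congr_fun fun m => ?_
  change _ = Real.exp (-r) * ((shiftOp ρ true ^ n)
    (((m.factorial : ℝ)⁻¹ • (r • shiftOp ρ false) ^ m) g)) z
  rw [smul_pow, smul_smul, smul_apply, map_smul, Obs.smul_apply]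
  ring

end CompoundPoisson

/-- The compound Poisson law of `(-log Π⁺, -log Π⁻)`, expressed through its generator. -/
theorem integral_comp_logPair (k : ℕ) {α : ℝ} (hα : 0 ≤ α) (μ : ProbabilityMeasure unitInterval)
    (g : Obs) : ∫ ω, g (logPair k ω) ∂(law k α μ) =
      NormedSpace.exp (gen (clauseLaw k μ) (α * k / 2)) g 0 := by
  have hr : ((α * k / 2).toNNReal : ℝ) = α * k / 2 := Real.coe_toNNReal _ (by positivity)
  have hgm : Measurable g := g.continuous.measurable
  have hint : ∀ {X : Type} [MeasurableSpace X] (ν : Measure X) [IsProbabilityMeasure ν]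
      (f : X → LogPair), Measurable f → Integrable (fun x => g (f x)) ν := fun ν _ f hf =>
    Integrable.of_bound (C := ‖g‖) (hgm.comp hf).aestronglyMeasurable
      (ae_of_all _ fun y => g.norm_coe_le_norm _)
  have hinner : ∀ d : ℕ × ℕ, ∫ η, g (logPair k (d, η))
      ∂(Measure.infinitePi fun _ : Idx => (μ : Measure unitInterval)) =
      ((shiftOp (clauseLaw k μ) true) ^ d.1) (((shiftOp (clauseLaw k μ) false) ^ d.2) g) 0 := by
    intro d
    rw [← integral_sum_inc, ← map_rowProd, integral_map]
    · simp only [zero_add, logPair]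
    · exact (measurable_pi_iff.2 fun p => measurable_rowProd k p).aemeasurable
    · refine (hgm.comp ?_).aestronglyMeasurable
      have : ∀ s i, Measurable fun w : Bool × ℕ → ℝ => inc s (w (s, i)) := fun s i =>
        (measurable_inc s).comp (measurable_pi_apply _)
      fun_prop
  unfold law
  rw [integral_prod _ (hint _ _ (measurable_logPair k))]
  simp only [hinner]
  have hint2 : ∀ d : ℕ × ℕ, ‖((shiftOp (clauseLaw k μ) true) ^ d.1)
      (((shiftOp (clauseLaw k μ) false) ^ d.2) g) 0‖ ≤ ‖g‖ := by
    intro d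
    rw [← hinner]
    have := norm_integral_le_of_norm_le_const
      (μ := Measure.infinitePi fun _ : Idx => (μ : Measure unitInterval))
      (f := fun η => g (logPair k (d, η)))
      (C := ‖g‖) (ae_of_all _ fun u => g.norm_coe_le_norm _)
    simpa using this
  rw [integral_prod _ (Integrable.of_bound (C := ‖g‖)
    (Measurable.of_discrete).aestronglyMeasurable (ae_of_all _ hint2))]
  simp only [integral_poissonMeasure, hr, smul_eq_mul]
  rw [← (hasSum_exp_gen (clauseLaw k μ) g 0 (α * k / 2)).tsum_eq]
  congr 1
  ext n
  rw [← (hasSum_exp_shiftOp (clauseLaw k μ) g 0 (α * k / 2) n).tsum_eq]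

/-! ### Positivity of the semigroup -/

section Order

theorem abs_exp_apply_le_exp_apply (K : Obs →L[ℝ] Obs)
    (hK : ∀ h G : Obs, (∀ z, |h z| ≤ G z) → ∀ z, |K h z| ≤ K G z)
    (h G : Obs) (hG : ∀ z, |h z| ≤ G z) (z : LogPair) :
    |NormedSpace.exp K h z| ≤ NormedSpace.exp K G z := by
  have hn : ∀ n z, |(K ^ n) h z| ≤ (K ^ n) G z := by
    intro n
    induction n with
    | zero => simpa using hG
    | succ n ih =>
      intro z
      rw [pow_succ', mul_apply_eq_comp, mul_apply_eq_comp]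
      exact hK _ _ ih z
  rw [← (hasSum_exp_apply K h z).tsum_eq, ← Real.norm_eq_abs]
  refine tsum_of_norm_bounded (hasSum_exp_apply K G z) fun n => ?_
  rw [norm_mul, Real.norm_eq_abs, Real.norm_eq_abs, abs_of_nonneg (by positivity)]
  exact mul_le_mul_of_nonneg_left (hn n z) (by positivity)

theorem abs_pairOp_le_pairOp (ρ : Measure ℝ) [IsProbabilityMeasure ρ] (h G : Obs)
    (hG : ∀ z, |h z| ≤ G z) (z : LogPair) : |pairOp ρ h z| ≤ pairOp ρ G z := by
  rw [pairOp_apply, pairOp_apply, ← Real.norm_eq_abs]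
  refine norm_integral_le_of_norm_le
    ((integrable_comp_inc ρ true G z).add (integrable_comp_inc ρ false G z))
    (ae_of_all _ fun u => ?_)
  exact (abs_add_le _ _).trans (add_le_add (hG _) (hG _))

/-- In contrast to `abs_exp_segment_le`, the majorant may mix weights with different growth rates,
such as Π⁻ and a constant. -/
theorem abs_exp_segment_le_exp_segment {ρ σ : Measure ℝ} [IsProbabilityMeasure ρ]
    [IsProbabilityMeasure σ] {r s t : ℝ} (hr : 0 ≤ r) (hs : 0 ≤ s)
    (ht : t ∈ Set.Icc (0 : ℝ) 1) (h G : Obs) (hG : ∀ z, |h z| ≤ G z) (z : LogPair) :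
    |NormedSpace.exp (gen ρ r + t • (gen σ s - gen ρ r)) h z| ≤
      NormedSpace.exp (gen ρ r + t • (gen σ s - gen ρ r)) G z := by
  rw [segment_gen, exp_sub_smul_one]
  have p1 : 0 ≤ (1 - t) * r := mul_nonneg (by linarith [ht.2]) hr
  have p2 : 0 ≤ t * s := mul_nonneg ht.1 hs
  have he : ∀ (c : ℝ) (T : Obs →L[ℝ] Obs) (f : Obs), (c • T) f z = c * T f z := fun _ _ _ => rfl
  rw [he, he, abs_mul, abs_of_pos (Real.exp_pos _)]
  refine mul_le_mul_of_nonneg_left (abs_exp_apply_le_exp_apply _ (fun h G hG z => ?_) h G hG z)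
    (Real.exp_pos _).le
  have e1 := abs_pairOp_le_pairOp ρ h G hG z
  have e2 := abs_pairOp_le_pairOp σ h G hG z
  calc |((((1 - t) * r) • pairOp ρ + (t * s) • pairOp σ) h) z|
      = |((1 - t) * r) * pairOp ρ h z + (t * s) * pairOp σ h z| := by simp
    _ ≤ ((1 - t) * r) * |pairOp ρ h z| + (t * s) * |pairOp σ h z| := by
        refine (abs_add_le _ _).trans (le_of_eq ?_)
        rw [abs_mul _ (pairOp ρ h z), abs_mul _ (pairOp σ h z), abs_of_nonneg p1,
          abs_of_nonneg p2]
    _ ≤ ((1 - t) * r) * pairOp ρ G z + (t * s) * pairOp σ G z := by gcongr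
    _ = _ := by simp

end Order

/-! ### Symmetry between the two signs -/

section Swap

/-- Exchange of the two signs. -/
def swapOp : Obs →L[ℝ] Obs :=
  LinearMap.mkContinuous
    { toFun := fun g => Obs.mk (fun z => g z.swap) (g.continuous.comp continuous_swap) ‖g‖
        fun z => g.norm_coe_le_norm _
      map_add' := fun f g => rfl
      map_smul' := fun c g => rfl }
    1 fun g => by
      rw [one_mul]
      exact Obs.norm_mk_le _ _ fun z => g.norm_coe_le_norm _

@[simp] theorem swapOp_apply (g : Obs) (z : LogPair) : swapOp g z = g z.swap := rfl

theorem swap_add_inc (z : LogPair) (s : Bool) (u : ℝ) :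
    (z + inc s u).swap = z.swap + inc (!s) u := by
  cases s <;> simp [inc]

/-- Both signs have the same rate and the same clause law. -/
theorem commute_swapOp_gen (ρ : Measure ℝ) [IsProbabilityMeasure ρ] (r : ℝ) :
    Commute swapOp (gen ρ r) := by
  ext g z
  simp only [mul_apply_eq_comp, swapOp_apply, gen_apply, swap_add_inc, Bool.not_true,
    Bool.not_false]
  simp only [add_comm (g (z.swap + inc true _))]

theorem exp_segment_swapOp (ρ σ : Measure ℝ) [IsProbabilityMeasure ρ] [IsProbabilityMeasure σ]
    (r s t : ℝ) (g : Obs) :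
    NormedSpace.exp (gen ρ r + t • (gen σ s - gen ρ r)) (swapOp g) 0 =
      NormedSpace.exp (gen ρ r + t • (gen σ s - gen ρ r)) g 0 := by
  have h : Commute swapOp (gen ρ r + t • (gen σ s - gen ρ r)) :=
    (commute_swapOp_gen ρ r).add_right
      (((commute_swapOp_gen σ s).sub_right (commute_swapOp_gen ρ r)).smul_right t)
  have h2 := congrArg (fun T : Obs →L[ℝ] Obs => T g 0) h.exp_right.eq
  simp only [mul_apply_eq_comp, swapOp_apply] at h2
  exact h2.symm

theorem exp_gen_swapOp (ρ : Measure ℝ) [IsProbabilityMeasure ρ] (r : ℝ) (g : Obs) :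
    NormedSpace.exp (gen ρ r) (swapOp g) 0 = NormedSpace.exp (gen ρ r) g 0 := by
  simpa using exp_segment_swapOp ρ ρ r r 0 g

end Swap

/-! ### Site functions and the effect of one clause on them -/

section Site

/-- `Π⁺` as a function of `(-log Π⁺, -log Π⁻)`. -/
def aF (z : LogPair) : ℝ := Real.exp (-(z.1 : ℝ))

/-- `Π⁻` as a function of `(-log Π⁺, -log Π⁻)`. -/
def bF (z : LogPair) : ℝ := Real.exp (-(z.2 : ℝ))

/-- `Π⁺ + Π⁻ - Π⁺ Π⁻` as a function of `(-log Π⁺, -log Π⁻)`. -/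
def sF (z : LogPair) : ℝ := aF z + bF z - aF z * bF z

/-- `(1 - Π⁻) Π⁺ / (Π⁺ + Π⁻ - Π⁺ Π⁻)` as a function of `(-log Π⁺, -log Π⁻)`. -/
def etaF (z : LogPair) : ℝ := (1 - bF z) * aF z / sF z

/-- `(1 - Π⁺) Π⁻ / (Π⁺ + Π⁻ - Π⁺ Π⁻)` as a function of `(-log Π⁺, -log Π⁻)`. -/
def qF (z : LogPair) : ℝ := (1 - aF z) * bF z / sF z

/-- `Π⁺ Π⁻ / (Π⁺ + Π⁻ - Π⁺ Π⁻)` as a function of `(-log Π⁺, -log Π⁻)`. -/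
def rF (z : LogPair) : ℝ := aF z * bF z / sF z

variable (z : LogPair)

theorem aF_pos : 0 < aF z := Real.exp_pos _

theorem bF_pos : 0 < bF z := Real.exp_pos _

theorem aF_le_one : aF z ≤ 1 := Real.exp_le_one_iff.2 (by simp)

theorem bF_le_one : bF z ≤ 1 := Real.exp_le_one_iff.2 (by simp)

theorem aF_le_sF : aF z ≤ sF z := by
  have := aF_le_one z; have := bF_pos z; unfold sF; nlinarith

theorem bF_le_sF : bF z ≤ sF z := by
  have := bF_le_one z; have := aF_pos z; unfold sF; nlinarith

theorem sF_pos : 0 < sF z := (aF_pos z).trans_le (aF_le_sF z)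

theorem sF_le_one : sF z ≤ 1 := by
  have := aF_le_one z; have := bF_le_one z; unfold sF; nlinarith

theorem etaF_nonneg : 0 ≤ etaF z :=
  div_nonneg (mul_nonneg (by linarith [bF_le_one z]) (aF_pos z).le) (sF_pos z).le

theorem qF_nonneg : 0 ≤ qF z :=
  div_nonneg (mul_nonneg (by linarith [aF_le_one z]) (bF_pos z).le) (sF_pos z).le

theorem rF_pos : 0 < rF z := div_pos (mul_pos (aF_pos z) (bF_pos z)) (sF_pos z)

theorem etaF_add_qF_add_rF : etaF z + qF z + rF z = 1 := by
  unfold etaF qF rF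
  rw [← add_div, ← add_div, div_eq_one_iff_eq (sF_pos z).ne']
  unfold sF; ring

theorem rF_le_bF : rF z ≤ bF z := by
  unfold rF
  rw [div_le_iff₀ (sF_pos z)]
  nlinarith [aF_le_sF z, bF_pos z]

theorem etaF_lt_one : etaF z < 1 := by
  linarith [etaF_add_qF_add_rF z, qF_nonneg z, rF_pos z]

theorem qF_lt_one : qF z < 1 := by
  linarith [etaF_add_qF_add_rF z, etaF_nonneg z, rF_pos z]

/-- Indeed 1 - η = Π⁻/(Π⁺ + Π⁻ - Π⁺Π⁻) with denominator at most 1. In this way inverse moments of Π⁻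
control the sum of all moments of η. -/
theorem bF_le_one_sub_etaF : bF z ≤ 1 - etaF z := by
  have h : 1 - etaF z = bF z / sF z := by
    unfold etaF
    rw [eq_div_iff (sF_pos z).ne', sub_mul, div_mul_cancel₀ _ (sF_pos z).ne']
    unfold sF; ring
  rw [h, le_div_iff₀ (sF_pos z)]
  nlinarith [bF_pos z, sF_le_one z]

@[fun_prop] theorem continuous_aF : Continuous aF := by unfold aF; fun_prop

@[fun_prop] theorem continuous_bF : Continuous bF := by unfold bF; fun_prop

@[fun_prop] theorem continuous_sF : Continuous sF := by unfold sF; fun_prop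

@[fun_prop] theorem continuous_etaF : Continuous etaF := by
  unfold etaF
  exact Continuous.div (by fun_prop) (by fun_prop) fun z => (sF_pos z).ne'

@[fun_prop] theorem continuous_qF : Continuous qF := by
  unfold qF
  exact Continuous.div (by fun_prop) (by fun_prop) fun z => (sF_pos z).ne'

@[fun_prop] theorem continuous_rF : Continuous rF := by
  unfold rF
  exact Continuous.div (by fun_prop) (by fun_prop) fun z => (sF_pos z).ne'

variable {u : ℝ}

theorem exp_neg_toNNReal_neg_log (hu : u ∈ Set.Ico (0 : ℝ) 1) :
    Real.exp (-((-Real.log (1 - u)).toNNReal : ℝ)) = 1 - u := by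
  have h0 : 0 < 1 - u := by linarith [hu.2]
  rw [Real.coe_toNNReal, neg_neg, Real.exp_log h0]
  linarith [Real.log_nonpos h0.le (by linarith [hu.1])]

variable {z}

theorem aF_inc_true (hu : u ∈ Set.Ico (0 : ℝ) 1) : aF (z + inc true u) = aF z * (1 - u) := by
  rw [← exp_neg_toNNReal_neg_log hu]
  simp only [aF, inc, if_true, Prod.fst_add, NNReal.coe_add, neg_add, Real.exp_add]

theorem bF_inc_false (hu : u ∈ Set.Ico (0 : ℝ) 1) : bF (z + inc false u) = bF z * (1 - u) := by
  rw [← exp_neg_toNNReal_neg_log hu]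
  simp [bF, inc, Real.exp_add, mul_comm]

theorem bF_inc_true : bF (z + inc true u) = bF z := by simp [bF, inc]

theorem aF_inc_false : aF (z + inc false u) = aF z := by simp [aF, inc]

theorem sF_inc_true (hu : u ∈ Set.Ico (0 : ℝ) 1) :
    sF (z + inc true u) = sF z - u * ((1 - bF z) * aF z) := by
  unfold sF; rw [aF_inc_true hu, bF_inc_true]; ring

theorem sF_inc_false (hu : u ∈ Set.Ico (0 : ℝ) 1) :
    sF (z + inc false u) = sF z - u * ((1 - aF z) * bF z) := by
  unfold sF; rw [bF_inc_false hu, aF_inc_false]; ring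

/-- The right side has the form (p + qu)/(1 - su) required by `exists_coeff_mobius_pow`. -/
theorem etaF_inc_true (hu : u ∈ Set.Ico (0 : ℝ) 1) :
    etaF (z + inc true u) = (etaF z + -etaF z * u) / (1 - etaF z * u) := by
  have h := sF_pos (z + inc true u)
  rw [sF_inc_true hu] at h
  have h0 := (sF_pos z).ne'
  have e : 1 - etaF z * u = (sF z - u * ((1 - bF z) * aF z)) / sF z := by
    unfold etaF; field_simp
  rw [e]
  unfold etaF
  rw [sF_inc_true hu, aF_inc_true hu, bF_inc_true]
  field_simp
  ring

theorem etaF_inc_false (hu : u ∈ Set.Ico (0 : ℝ) 1) :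
    etaF (z + inc false u) = (etaF z + rF z * u) / (1 - qF z * u) := by
  have h := sF_pos (z + inc false u)
  rw [sF_inc_false hu] at h
  have h0 := (sF_pos z).ne'
  have e : 1 - qF z * u = (sF z - u * ((1 - aF z) * bF z)) / sF z := by
    unfold qF; field_simp
  rw [e]
  unfold etaF rF
  rw [sF_inc_false hu, bF_inc_false hu, aF_inc_false]
  field_simp
  ring

/-- The difference of the squared moduli is (1-η)(1+η-2η Re u). -/
theorem norm_mobius_true_le {η : ℝ} (h0 : 0 ≤ η) (h1 : η ≤ 1) (u : ℂ) (hu : ‖u‖ ≤ 1) :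
    ‖(η + (-η : ℝ) * u : ℂ)‖ ≤ ‖(1 - η * u : ℂ)‖ := by
  rw [← sq_le_sq₀ (norm_nonneg _) (norm_nonneg _), Complex.sq_norm, Complex.sq_norm,
    Complex.normSq_apply, Complex.normSq_apply]
  have h2 : u.re * u.re + u.im * u.im ≤ 1 := by
    rw [← Complex.normSq_apply, ← Complex.sq_norm]
    exact pow_le_one₀ (norm_nonneg _) hu
  have h3 : u.re ≤ 1 := (Complex.re_le_norm u).trans hu
  simp only [Complex.add_re, Complex.add_im, Complex.sub_re, Complex.sub_im, Complex.mul_re,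
    Complex.mul_im, Complex.ofReal_re, Complex.ofReal_im, Complex.one_re, Complex.one_im]
  have : 0 ≤ (1 - η) * (1 + η - 2 * η * u.re) := by
    apply mul_nonneg (by linarith); nlinarith
  nlinarith

theorem norm_mobius_false_le {η q r : ℝ} (h0 : 0 ≤ η) (h1 : 0 ≤ q) (h2 : 0 ≤ r)
    (h : η + q + r = 1) (u : ℂ) (hu : ‖u‖ ≤ 1) :
    ‖(η + r * u : ℂ)‖ ≤ ‖(1 - q * u : ℂ)‖ := by
  have e1 : ‖(η + r * u : ℂ)‖ ≤ η + r := by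
    refine (norm_add_le _ _).trans ?_
    rw [norm_mul, Complex.norm_real, Complex.norm_real, Real.norm_of_nonneg h0,
      Real.norm_of_nonneg h2]
    nlinarith
  have e2 : 1 - q ≤ ‖(1 - q * u : ℂ)‖ := by
    have := norm_sub_norm_le (1 : ℂ) (q * u)
    rw [norm_mul, Complex.norm_real, Real.norm_of_nonneg h1, norm_one] at this
    nlinarith
  linarith

/-- The power x^{m-1} is the smallest term of the geometric sum 1 + … + x^{m-1}, which multiplied by
1-x gives 1-x^m. The bound is uniform in `m`. -/
theorem nat_mul_pow_mul_one_sub_le_one {x : ℝ} (h0 : 0 ≤ x) (h1 : x ≤ 1) (m : ℕ) :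
    m * x ^ (m - 1) * (1 - x) ≤ 1 := by
  have h : (m : ℝ) * x ^ (m - 1) ≤ ∑ i ∈ Finset.range m, x ^ i := by
    calc (m : ℝ) * x ^ (m - 1) = ∑ i ∈ Finset.range m, x ^ (m - 1) := by simp
      _ ≤ _ := Finset.sum_le_sum fun i hi =>
        pow_le_pow_of_le_one h0 h1 (by have := Finset.mem_range.1 hi; omega)
  calc m * x ^ (m - 1) * (1 - x) ≤ (∑ i ∈ Finset.range m, x ^ i) * (1 - x) :=
        mul_le_mul_of_nonneg_right h (by linarith)
    _ = 1 - x ^ m := by linarith [geom_sum_mul x m]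
    _ ≤ 1 := by linarith [pow_nonneg h0 m]

/-- Expansion in `u` of the effect on `η^m` of one clause of either sign. The first order terms
nearly cancel. -/
theorem exists_coeff_etaF_pow (z : LogPair) {m : ℕ} :
    ∃ c : ℕ → ℝ, c 0 = 0 ∧ |c 1| ≤ bF z ∧ (∀ j, |c j| ≤ 2) ∧
      ∀ u ∈ Set.Ico (0 : ℝ) 1, HasSum (fun j => c j * u ^ j)
        (etaF (z + inc true u) ^ m + etaF (z + inc false u) ^ m - 2 * etaF z ^ m) := by
  have h0 := etaF_nonneg z
  have h1 := etaF_lt_one z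
  have hs := etaF_add_qF_add_rF z
  obtain ⟨c, c0, c1, cb, cs⟩ := exists_coeff_mobius_pow (etaF z) (-etaF z) (etaF z) h0 h1
    (norm_mobius_true_le h0 h1.le) m
  obtain ⟨d, d0, d1, db, ds⟩ := exists_coeff_mobius_pow (etaF z) (rF z) (qF z) (qF_nonneg z)
    (qF_lt_one z) (norm_mobius_false_le h0 (qF_nonneg z) (rF_pos z).le hs) m
  -- The constant terms, η^m for each sign, cancel against `2 * etaF z ^ m`.
  refine ⟨fun j => if j = 0 then 0 else c j + d j, by simp, ?_, ?_, ?_⟩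
  · have e : c 1 + d 1 = m * etaF z ^ (m - 1) * (1 - etaF z) * rF z := by
      rw [c1, d1]
      have : rF z + etaF z * qF z + (-etaF z + etaF z * etaF z) = (1 - etaF z) * rF z := by
        have : qF z = 1 - etaF z - rF z := by linarith
        rw [this]; ring
      rw [← mul_add, mul_assoc _ (1 - etaF z), ← this]
      ring
    have hn : 0 ≤ m * etaF z ^ (m - 1) * (1 - etaF z) :=
      mul_nonneg (mul_nonneg (by positivity) (pow_nonneg h0 _)) (by linarith)
    simp only [one_ne_zero, if_false]
    rw [e, abs_of_nonneg (mul_nonneg hn (rF_pos z).le)]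
    calc _ ≤ 1 * rF z := mul_le_mul_of_nonneg_right
          (nat_mul_pow_mul_one_sub_le_one h0 h1.le m) (rF_pos z).le
      _ ≤ bF z := by rw [one_mul]; exact rF_le_bF z
  · intro j
    dsimp only
    split_ifs
    · simp
    · exact (abs_add_le _ _).trans (by linarith [cb j, db j])
  · intro u hu
    rw [etaF_inc_true hu, etaF_inc_false hu]
    have h3 := ((cs u hu).add (ds u hu)).sub (hasSum_ite_eq (α := ℝ) 0 (2 * etaF z ^ m))
    refine h3.congr_fun fun j => ?_
    rcases eq_or_ne j 0 with rfl | hj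
    · simp [c0, d0]; ring
    · simp [hj]; ring

end Site

/-! ### Moments, clause intensities and weights with explicit growth rates -/

section Moments

variable (μ : ProbabilityMeasure unitInterval)

theorem integrable_unitInterval_pow (m : ℕ) :
    Integrable (fun x : unitInterval => (x : ℝ) ^ m) (μ : Measure unitInterval) := by
  refine Integrable.of_bound (C := 1) (Measurable.aestronglyMeasurable (by fun_prop))
    (ae_of_all _ fun x => ?_)
  rw [Real.norm_of_nonneg (pow_nonneg x.2.1 m)]
  exact pow_le_one₀ x.2.1 x.2.2

theorem mom_nonneg (m : ℕ) : 0 ≤ mom μ m := integral_nonneg fun x => pow_nonneg x.2.1 m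

theorem mom_anti : Antitone (mom μ) := fun _ _ h =>
  integral_mono (integrable_unitInterval_pow μ _) (integrable_unitInterval_pow μ _)
    fun x => pow_le_pow_of_le_one x.2.1 x.2.2 h

@[simp] theorem mom_zero : mom μ 0 = 1 := by simp [mom]

theorem mom_le_one (m : ℕ) : mom μ m ≤ 1 := by
  rw [← mom_zero μ]; exact mom_anti μ (Nat.zero_le m)

variable {μ}

/-- An atom at 1 would contribute its mass to every moment. Summability thus ensures that no factor
of Π⁺ or Π⁻ vanishes, almost surely. -/
theorem ae_lt_one_of_summable_mom (h : Summable (mom μ)) :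
    ∀ᵐ x : unitInterval ∂(μ : Measure unitInterval), (x : ℝ) < 1 := by
  have h1 : ∀ m, (μ : Measure unitInterval).real {1} ≤ mom μ m := by
    intro m
    rw [← integral_indicator_one (measurableSet_singleton _)]
    refine integral_mono_of_nonneg (ae_of_all _ fun x => ?_) (integrable_unitInterval_pow μ m)
      (ae_of_all _ fun x => ?_)
    · exact Set.indicator_nonneg (fun _ _ => zero_le_one) x
    · refine Set.indicator_apply_le' (fun hx => ?_) fun _ => pow_nonneg x.2.1 m
      rw [Set.mem_singleton_iff.1 hx]
      simp
  have h2 : (μ : Measure unitInterval).real {1} ≤ 0 :=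
    ge_of_tendsto' h.tendsto_atTop_zero h1
  have h3 : (μ : Measure unitInterval) {1} = 0 :=
    (measureReal_eq_zero_iff).1 (le_antisymm h2 measureReal_nonneg)
  rw [ae_iff]
  convert h3 using 2
  ext x
  simp only [Set.mem_ofPred_eq, not_lt, Set.mem_singleton_iff]
  exact ⟨fun hx => le_antisymm x.2.2 hx, fun hx => by simp [hx]⟩

theorem summable_mom_pow (h : Summable (mom μ)) {n : ℕ} (hn : n ≠ 0) :
    Summable fun j => mom μ j ^ n :=
  h.of_nonneg_of_le (fun j => pow_nonneg (mom_nonneg μ j) n)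
    fun j => pow_le_of_le_one (mom_nonneg μ j) (mom_le_one μ j) hn

end Moments

/-- The moments of the clause intensity: `(α k / 2) (∫ x ^ j dμ) ^ (k-1)`. -/
def intens (k : ℕ) (α : ℝ) (μ : ProbabilityMeasure unitInterval) (j : ℕ) : ℝ :=
  α * k / 2 * mom μ j ^ (k - 1)

section ClauseLaw

variable {k : ℕ} {μ : ProbabilityMeasure unitInterval}

theorem integrable_pow_clauseLaw (hk : 2 ≤ k) (h : Summable (mom μ)) (j : ℕ) :
    Integrable (fun u => u ^ j) (clauseLaw k μ) := by
  refine Integrable.of_bound (C := 1) (Measurable.aestronglyMeasurable (by fun_prop)) ?_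
  filter_upwards [ae_clauseLaw_mem hk (ae_lt_one_of_summable_mom h)] with u hu
  rw [Real.norm_of_nonneg (pow_nonneg hu.1 j)]
  exact pow_le_one₀ hu.1 hu.2.le

/-- The moments of a clause product are m_j^{k-1}, and their summability against bounded
coefficients permits termwise integration. This is how averages over clauses become functions of the
moments alone. -/
theorem hasSum_integral_clauseLaw (hk : 2 ≤ k) (h : Summable (mom μ)) {c : ℕ → ℝ} {C : ℝ}
    (hc : ∀ j, |c j| ≤ C) {f : ℝ → ℝ}
    (hf : ∀ u ∈ Set.Ico (0 : ℝ) 1, HasSum (fun j => c j * u ^ j) (f u)) :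
    HasSum (fun j => c j * mom μ j ^ (k - 1)) (∫ u, f u ∂(clauseLaw k μ)) := by
  have hae := ae_clauseLaw_mem hk (ae_lt_one_of_summable_mom h)
  have h1 := hasSum_integral_of_summable_integral_norm (μ := clauseLaw k μ)
    (F := fun j u => c j * u ^ j) (fun j => (integrable_pow_clauseLaw hk h j).const_mul (c j)) ?_
  · have h2 : ∫ u, ∑' j, c j * u ^ j ∂(clauseLaw k μ) = ∫ u, f u ∂(clauseLaw k μ) := by
      refine integral_congr_ae ?_
      filter_upwards [hae] with u hu
      exact (hf u hu).tsum_eq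
    rw [h2] at h1
    refine h1.congr_fun fun j => ?_
    rw [integral_const_mul, integral_pow_clauseLaw]
  · have h3 : ∀ j, ∫ u, ‖c j * u ^ j‖ ∂(clauseLaw k μ) = |c j| * mom μ j ^ (k - 1) := by
      intro j
      rw [← integral_pow_clauseLaw, ← integral_const_mul]
      refine integral_congr_ae ?_
      filter_upwards [hae] with u hu
      rw [norm_mul, Real.norm_eq_abs, Real.norm_of_nonneg (pow_nonneg hu.1 j)]
    simp only [h3]
    refine ((summable_mom_pow h (n := k - 1) (by omega)).mul_left C).of_nonneg_of_le
      (fun j => mul_nonneg (abs_nonneg _) (pow_nonneg (mom_nonneg μ j) _))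
      fun j => mul_le_mul_of_nonneg_right (hc j) (pow_nonneg (mom_nonneg μ j) _)

theorem hasSum_gen (hk : 2 ≤ k) (h : Summable (mom μ)) (α : ℝ) {c : ℕ → ℝ} {C : ℝ}
    (hc : ∀ j, |c j| ≤ C) {g : Obs} {z : LogPair}
    (hf : ∀ u ∈ Set.Ico (0 : ℝ) 1, HasSum (fun j => c j * u ^ j)
      (g (z + inc true u) + g (z + inc false u) - 2 * g z)) :
    HasSum (fun j => c j * intens k α μ j) (gen (clauseLaw k μ) (α * k / 2) g z) := by
  rw [gen_apply]
  refine ((hasSum_integral_clauseLaw hk h hc hf).mul_left _).congr_fun fun j => ?_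
  unfold intens; ring

theorem summable_intens (hk : 2 ≤ k) (h : Summable (mom μ)) (α : ℝ) :
    Summable (intens k α μ) := (summable_mom_pow h (by omega)).mul_left _

theorem subEigen_one (ρ : Measure ℝ) [IsProbabilityMeasure ρ] : SubEigen ρ (fun _ => 1) 2 := by
  intro z
  refine ⟨integrable_const _, integrable_const _, ?_⟩
  rw [integral_const]
  norm_num

/-- A negative clause multiplies Π⁻ by 1-u and a positive one leaves it unchanged. At clause rate
αk/2 the growth rate is -λ_1. -/
theorem subEigen_bF (hk : 2 ≤ k) (h : Summable (mom μ)) :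
    SubEigen (clauseLaw k μ) bF (2 - mom μ 1 ^ (k - 1)) := by
  have hae := ae_clauseLaw_mem hk (ae_lt_one_of_summable_mom h)
  intro z
  have hi := integrable_pow_clauseLaw hk h 1
  have e : (fun u => bF (z + inc false u)) =ᵐ[clauseLaw k μ] fun u => bF z * (1 - u ^ 1) := by
    filter_upwards [hae] with u hu
    rw [bF_inc_false hu, pow_one]
  have hi2 : Integrable (fun u => bF (z + inc false u)) (clauseLaw k μ) :=
    (((integrable_const 1).sub hi).const_mul (bF z)).congr e.symm
  refine ⟨?_, hi2, ?_⟩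
  · simp only [bF_inc_true]; exact integrable_const _
  · simp only [bF_inc_true]
    rw [integral_add (integrable_const _) hi2, integral_congr_ae e, integral_const_mul,
      integral_sub (integrable_const _) hi, integral_pow_clauseLaw]
    simp
    linarith

theorem integrable_inv_one_sub_clauseLaw (hk : 2 ≤ k) (h : Summable (mom μ)) :
    Integrable (fun u => (1 - u)⁻¹) (clauseLaw k μ) := by
  have hae := ae_clauseLaw_mem hk (ae_lt_one_of_summable_mom h)
  refine ⟨Measurable.aestronglyMeasurable (by fun_prop), ?_⟩
  rw [hasFiniteIntegral_iff_enorm]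
  have h1 : ∫⁻ u, ‖(1 - u)⁻¹‖ₑ ∂(clauseLaw k μ) =
      ∫⁻ u, ∑' j : ℕ, ENNReal.ofReal (u ^ j) ∂(clauseLaw k μ) := by
    refine lintegral_congr_ae ?_
    filter_upwards [hae] with u hu
    rw [Real.enorm_eq_ofReal (inv_nonneg.2 (by linarith [hu.2])),
      ← tsum_geometric_of_lt_one hu.1 hu.2,
      ENNReal.ofReal_tsum_of_nonneg (fun j => pow_nonneg hu.1 j)
        (summable_geometric_of_lt_one hu.1 hu.2)]
  rw [h1, lintegral_tsum fun j => (by fun_prop)]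
  have h2 : ∀ j : ℕ, ∫⁻ u, ENNReal.ofReal (u ^ j) ∂(clauseLaw k μ) =
      ENNReal.ofReal (mom μ j ^ (k - 1)) := by
    intro j
    rw [← integral_pow_clauseLaw, ofReal_integral_eq_lintegral_ofReal
      (integrable_pow_clauseLaw hk h j)]
    filter_upwards [hae] with u hu
    exact pow_nonneg hu.1 j
  simp only [h2]
  rw [← ENNReal.ofReal_tsum_of_nonneg (fun j => pow_nonneg (mom_nonneg μ j) _)
    (summable_mom_pow h (by omega))]
  exact ENNReal.ofReal_lt_top

theorem integral_inv_one_sub_clauseLaw (hk : 2 ≤ k) (h : Summable (mom μ)) :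
    ∫ u, (1 - u)⁻¹ ∂(clauseLaw k μ) = ∑' j, mom μ j ^ (k - 1) := by
  have := hasSum_integral_clauseLaw (c := fun _ => 1) (C := 1) hk h (fun j => by simp)
    (f := fun u => (1 - u)⁻¹)
    (fun u hu => by simpa using hasSum_geometric_of_lt_one hu.1 hu.2)
  simpa using this.tsum_eq.symm

/-- A negative clause multiplies 1/Π⁻ by 1/(1-u) = Σ_j u^j. At clause rate αk/2 the growth rate is
Σ_{j≥1} λ_j. -/
theorem subEigen_inv_bF (hk : 2 ≤ k) (h : Summable (mom μ)) :
    SubEigen (clauseLaw k μ) (fun z => (bF z)⁻¹) (2 + ∑' j, mom μ (j + 1) ^ (k - 1)) := by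
  have hae := ae_clauseLaw_mem hk (ae_lt_one_of_summable_mom h)
  intro z
  have hi := integrable_inv_one_sub_clauseLaw hk h
  have e : (fun u => (bF (z + inc false u))⁻¹) =ᵐ[clauseLaw k μ]
      fun u => (bF z)⁻¹ * (1 - u)⁻¹ := by
    filter_upwards [hae] with u hu
    rw [bF_inc_false hu, mul_inv]
  have hi2 : Integrable (fun u => (bF (z + inc false u))⁻¹) (clauseLaw k μ) :=
    (hi.const_mul _).congr e.symm
  refine ⟨?_, hi2, ?_⟩
  · simp only [bF_inc_true]; exact integrable_const _
  · simp only [bF_inc_true]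
    rw [integral_add (integrable_const _) hi2, integral_congr_ae e, integral_const_mul,
      integral_inv_one_sub_clauseLaw hk h,
      (summable_mom_pow h (n := k - 1) (by omega)).tsum_eq_zero_add]
    simp
    linarith

end ClauseLaw

/-! ### Moments after one step of the recursion -/

section Law

variable {k : ℕ} {μ : ProbabilityMeasure unitInterval}

theorem aF_add (z w : LogPair) : aF (z + w) = aF z * aF w := by
  simp [aF, Real.exp_add, mul_comm]

theorem bF_add (z w : LogPair) : bF (z + w) = bF z * bF w := by
  simp [bF, Real.exp_add, mul_comm]

@[simp] theorem aF_zero : aF 0 = 1 := by simp [aF]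

@[simp] theorem bF_zero : bF 0 = 1 := by simp [bF]

theorem aF_sum {ι : Type*} (s : Finset ι) (f : ι → LogPair) :
    aF (∑ i ∈ s, f i) = ∏ i ∈ s, aF (f i) := by
  classical
  induction s using Finset.induction_on with
  | empty => simp
  | insert i s hi ih => rw [Finset.sum_insert hi, Finset.prod_insert hi, aF_add, ih]

theorem bF_sum {ι : Type*} (s : Finset ι) (f : ι → LogPair) :
    bF (∑ i ∈ s, f i) = ∏ i ∈ s, bF (f i) := by
  classical
  induction s using Finset.induction_on with
  | empty => simp
  | insert i s hi ih => rw [Finset.sum_insert hi, Finset.prod_insert hi, bF_add, ih]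

theorem aF_inc {u : ℝ} (hu : u ∈ Set.Ico (0 : ℝ) 1) (s : Bool) :
    aF (inc s u) = if s then 1 - u else 1 := by
  cases s
  · simpa using aF_inc_false (z := 0) (u := u)
  · simpa using aF_inc_true (z := 0) hu

theorem bF_inc {u : ℝ} (hu : u ∈ Set.Ico (0 : ℝ) 1) (s : Bool) :
    bF (inc s u) = if s then 1 else 1 - u := by
  cases s
  · simpa using bF_inc_false (z := 0) hu
  · simpa using bF_inc_true (z := 0) (u := u)

theorem ae_law_lt_one (α : ℝ)
    (hμ : ∀ᵐ x : unitInterval ∂(μ : Measure unitInterval), (x : ℝ) < 1) :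
    ∀ᵐ ω ∂(law k α μ), ∀ i : Idx, (ω.2 i : ℝ) < 1 := by
  unfold law
  refine Measure.quasiMeasurePreserving_snd.ae (p := fun η : Arr => ∀ i : Idx, (η i : ℝ) < 1) ?_
  rw [ae_all_iff]
  intro i
  exact (measurePreserving_eval_infinitePi
    (fun _ : Idx => (μ : Measure unitInterval)) i).quasiMeasurePreserving.ae hμ

theorem ae_law_site (hk : 2 ≤ k) (α : ℝ)
    (hμ : ∀ᵐ x : unitInterval ∂(μ : Measure unitInterval), (x : ℝ) < 1) :
    ∀ᵐ ω ∂(law k α μ), PiPlus k ω = aF (logPair k ω) ∧ PiMinus k ω = bF (logPair k ω) := by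
  filter_upwards [ae_law_lt_one α hμ] with ω hω
  have hu : ∀ p, rowProd k ω.2 p ∈ Set.Ico (0 : ℝ) 1 := fun p =>
    ⟨(prod_range_mem_Icc (k - 1) fun j => ω.2 (Sum.inr (p.1, p.2, j))).1,
      prod_range_lt_one (by omega) (fun j => ω.2 (Sum.inr (p.1, p.2, j))) (hω _)⟩
  unfold logPair PiPlus PiMinus signProd
  rw [aF_add, bF_add, aF_sum, aF_sum, bF_sum, bF_sum]
  simp only [aF_inc (hu _), bF_inc (hu _)]
  simp [rowProd]

theorem ae_law_siteWeight (hk : 2 ≤ k) (α : ℝ)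
    (hμ : ∀ᵐ x : unitInterval ∂(μ : Measure unitInterval), (x : ℝ) < 1) :
    ∀ᵐ ω ∂(law k α μ), siteWeight k ω = sF (logPair k ω) ∧ ratio k ω = etaF (logPair k ω) := by
  filter_upwards [ae_law_site hk α hμ] with ω hω
  simp only [ratio, siteWeight, sF, etaF, hω.1, hω.2, and_self]

/-- `η ^ m` as an observable. -/
def momObs (m : ℕ) : Obs := Obs.mk (fun z => etaF z ^ m) (by fun_prop) 1 fun z => by
  rw [abs_of_nonneg (pow_nonneg (etaF_nonneg z) m)]
  exact pow_le_one₀ (etaF_nonneg z) (etaF_lt_one z).le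

@[simp] theorem momObs_apply (m : ℕ) (z : LogPair) : momObs m z = etaF z ^ m := rfl

theorem mom_recursion_eq_integral (hk : 2 ≤ k) (α : ℝ)
    (hμ : ∀ᵐ x : unitInterval ∂(μ : Measure unitInterval), (x : ℝ) < 1) (m : ℕ) :
    mom (recursion k α μ) m = ∫ ω, etaF (logPair k ω) ^ m ∂(law k α μ) := by
  unfold mom recursion
  change ∫ x : unitInterval, (x : ℝ) ^ m ∂((law k α μ).map (recMap k)) = _
  rw [integral_map (measurable_recMap k).aemeasurable
    (Measurable.aestronglyMeasurable (by fun_prop))]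
  refine integral_congr_ae ?_
  filter_upwards [ae_law_siteWeight hk α hμ] with ω hω
  simp only [recMap, hω.2]

theorem mom_recursion (hk : 2 ≤ k) {α : ℝ} (hα : 0 ≤ α)
    (hμ : ∀ᵐ x : unitInterval ∂(μ : Measure unitInterval), (x : ℝ) < 1) (m : ℕ) :
    mom (recursion k α μ) m =
      NormedSpace.exp (gen (clauseLaw k μ) (α * k / 2)) (momObs m) 0 := by
  rw [mom_recursion_eq_integral hk α hμ, ← integral_comp_logPair k hα]
  rfl

end Law

theorem abs_exp_gen_le {ρ : Measure ℝ} [IsProbabilityMeasure ρ] {φ : LogPair → ℝ} {c r : ℝ}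
    (hφ0 : ∀ z, 0 < φ z) (hr : 0 ≤ r) (hρ : SubEigen ρ φ c) (h : Obs) (C : ℝ)
    (hC : ∀ z, |h z| ≤ C * φ z) (z : LogPair) :
    |NormedSpace.exp (gen ρ r) h z| ≤ Real.exp (r * (c - 2)) * C * φ z := by
  have := abs_exp_segment_le (ρ := ρ) (σ := ρ) (t := 0) (s := r) hφ0 hr hr (by simp) hρ hρ h C hC z
  simpa using this

/-- `Π⁻` as an observable. -/
def bObs : Obs := Obs.mk bF (by fun_prop) 1 fun z => by
  rw [abs_of_pos (bF_pos z)]; exact bF_le_one z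

@[simp] theorem bObs_apply (z : LogPair) : bObs z = bF z := rfl

/-- The constant observable `1`. -/
def oneObs : Obs := Obs.mk (fun _ => 1) continuous_const 1 fun _ => by simp

@[simp] theorem oneObs_apply (z : LogPair) : oneObs z = 1 := rfl

theorem convex_comb_le {x y c t : ℝ} (ht : t ∈ Set.Icc (0 : ℝ) 1) (hx : x ≤ c) (hy : y ≤ c) :
    (1 - t) * x + t * y ≤ c := by nlinarith [ht.1, ht.2]

/-! ### Comparison of two recursion steps -/

section Segment

variable {k : ℕ} {μ₀ μ₁ : ProbabilityMeasure unitInterval} {α₀ α₁ : ℝ}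

/-- Distance between two clause intensities that controls the moments after one recursion step. -/
def gap (k : ℕ) (ℓ α₀ : ℝ) (μ₀ : ProbabilityMeasure unitInterval) (α₁ : ℝ)
    (μ₁ : ProbabilityMeasure unitInterval) : ℝ :=
  -- When `ℓ` is a common lower bound for λ_1 at both ends, `exp (-ℓ)` bounds the mean of Π⁻ along
  -- the segment. The factor 2 in the second term bounds the higher Taylor coefficients.
  |intens k α₁ μ₁ 1 - intens k α₀ μ₀ 1| * Real.exp (-ℓ) +
    2 * ∑' j, |intens k α₁ μ₁ (j + 2) - intens k α₀ μ₀ (j + 2)|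

theorem gap_nonneg (k : ℕ) (ℓ α₀ : ℝ) (μ₀ : ProbabilityMeasure unitInterval) (α₁ : ℝ)
    (μ₁ : ProbabilityMeasure unitInterval) : 0 ≤ gap k ℓ α₀ μ₀ α₁ μ₁ := by
  unfold gap
  have : 0 ≤ ∑' j, |intens k α₁ μ₁ (j + 2) - intens k α₀ μ₀ (j + 2)| :=
    tsum_nonneg fun j => abs_nonneg _
  positivity

theorem summable_abs_intens_sub (hk : 2 ≤ k) (h₀ : Summable (mom μ₀)) (h₁ : Summable (mom μ₁)) :
    Summable fun j => |intens k α₁ μ₁ j - intens k α₀ μ₀ j| :=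
  ((summable_intens hk h₁ α₁).sub (summable_intens hk h₀ α₀)).abs

theorem hasSum_gen_sub_gen (hk : 2 ≤ k) (h₀ : Summable (mom μ₀)) (h₁ : Summable (mom μ₁))
    (α₀ α₁ : ℝ) {c : ℕ → ℝ} {C : ℝ} (hc : ∀ j, |c j| ≤ C) {g : Obs} {z : LogPair}
    (hf : ∀ u ∈ Set.Ico (0 : ℝ) 1, HasSum (fun j => c j * u ^ j)
      (g (z + inc true u) + g (z + inc false u) - 2 * g z)) :
    HasSum (fun j => c j * (intens k α₁ μ₁ j - intens k α₀ μ₀ j))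
      ((gen (clauseLaw k μ₁) (α₁ * k / 2) - gen (clauseLaw k μ₀) (α₀ * k / 2)) g z) := by
  refine ((hasSum_gen hk h₁ α₁ hc hf).sub (hasSum_gen hk h₀ α₀ hc hf)).congr_fun fun j => ?_
  ring

/-- In the expansion of η^m the index 0 drops out, the index 1 carries a factor at most Π⁻, and each
further coefficient is at most 2. -/
theorem abs_gen_sub_gen_momObs_le (hk : 2 ≤ k) (h₀ : Summable (mom μ₀)) (h₁ : Summable (mom μ₁))
    (m : ℕ) (z : LogPair) :
    |(gen (clauseLaw k μ₁) (α₁ * k / 2) - gen (clauseLaw k μ₀) (α₀ * k / 2)) (momObs m) z| ≤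
      |intens k α₁ μ₁ 1 - intens k α₀ μ₀ 1| * bF z +
        2 * ∑' j, |intens k α₁ μ₁ (j + 2) - intens k α₀ μ₀ (j + 2)| := by
  obtain ⟨c, c0, c1, cb, cs⟩ := exists_coeff_etaF_pow z (m := m)
  have hs := hasSum_gen_sub_gen hk h₀ h₁ α₀ α₁ cb (g := momObs m) cs
  set d := fun j => intens k α₁ μ₁ j - intens k α₀ μ₀ j with hd
  have hsum : Summable fun j => |d (j + 2)| :=
    (summable_nat_add_iff 2).2 (summable_abs_intens_sub hk h₀ h₁)
  have h2 := (hasSum_nat_add_iff' 2).2 hs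
  simp only [Finset.sum_range_succ, Finset.sum_range_zero, c0, zero_mul, zero_add] at h2
  have h3 : |∑' j, c (j + 2) * d (j + 2)| ≤ 2 * ∑' j, |d (j + 2)| := by
    rw [← Real.norm_eq_abs]
    refine tsum_of_norm_bounded (hsum.hasSum.mul_left 2) fun j => ?_
    rw [Real.norm_eq_abs, abs_mul]
    exact mul_le_mul_of_nonneg_right (cb _) (abs_nonneg _)
  rw [h2.tsum_eq] at h3
  have h4 : |c 1 * d 1| ≤ |d 1| * bF z := by
    rw [abs_mul, mul_comm]
    exact mul_le_mul_of_nonneg_left c1 (abs_nonneg _)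
  rw [abs_le] at h3 h4 ⊢
  constructor <;> linarith [h3.1, h3.2, h4.1, h4.2]

/-- The derivative along the segment is dominated by a multiple of Π⁻, which the semigroup shrinks
to `exp (-ℓ)`, plus a constant, which it preserves. -/
theorem abs_exp_segment_momObs_sub_le (hk : 2 ≤ k) (hα₀ : 0 ≤ α₀) (hα₁ : 0 ≤ α₁)
    (h₀ : Summable (mom μ₀)) (h₁ : Summable (mom μ₁)) {ℓ : ℝ} (hℓ₀ : ℓ ≤ intens k α₀ μ₀ 1)
    (hℓ₁ : ℓ ≤ intens k α₁ μ₁ 1) (m : ℕ) {t : ℝ} (ht : t ∈ Set.Icc (0 : ℝ) 1) :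
    |NormedSpace.exp (gen (clauseLaw k μ₀) (α₀ * k / 2) + t •
        (gen (clauseLaw k μ₁) (α₁ * k / 2) - gen (clauseLaw k μ₀) (α₀ * k / 2))) (momObs m) 0 -
      NormedSpace.exp (gen (clauseLaw k μ₀) (α₀ * k / 2)) (momObs m) 0| ≤
      gap k ℓ α₀ μ₀ α₁ μ₁ := by
  have hr₀ : 0 ≤ α₀ * k / 2 := by positivity
  have hr₁ : 0 ≤ α₁ * k / 2 := by positivity
  have hR : ∀ t ∈ Set.Icc (0 : ℝ) 1,
      |NormedSpace.exp (gen (clauseLaw k μ₀) (α₀ * k / 2) + t •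
        (gen (clauseLaw k μ₁) (α₁ * k / 2) - gen (clauseLaw k μ₀) (α₀ * k / 2)))
        ((gen (clauseLaw k μ₁) (α₁ * k / 2) - gen (clauseLaw k μ₀) (α₀ * k / 2)) (momObs m)) 0
        - 0| ≤ gap k ℓ α₀ μ₀ α₁ μ₁ := by
    intro t ht
    rw [sub_zero]
    have h1 := abs_exp_segment_le_exp_segment (ρ := clauseLaw k μ₀) (σ := clauseLaw k μ₁)
      hr₀ hr₁ ht
      ((gen (clauseLaw k μ₁) (α₁ * k / 2) - gen (clauseLaw k μ₀) (α₀ * k / 2)) (momObs m))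
      (|intens k α₁ μ₁ 1 - intens k α₀ μ₀ 1| • bObs +
        (2 * ∑' j, |intens k α₁ μ₁ (j + 2) - intens k α₀ μ₀ (j + 2)|) • oneObs)
      (fun z => by simpa using abs_gen_sub_gen_momObs_le hk h₀ h₁ m z) 0
    refine h1.trans ?_
    rw [map_add, map_smul, map_smul, Obs.add_apply, Obs.smul_apply, Obs.smul_apply]
    have h2 := abs_exp_segment_le (ρ := clauseLaw k μ₀) (σ := clauseLaw k μ₁) bF_pos hr₀ hr₁ ht
      (subEigen_bF hk h₀) (subEigen_bF hk h₁) bObs 1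
      (fun z => by simp [abs_of_pos (bF_pos z)]) 0
    have h3 := abs_exp_segment_le (ρ := clauseLaw k μ₀) (σ := clauseLaw k μ₁)
      (φ := fun _ => 1) (fun _ => one_pos) hr₀ hr₁ ht
      (subEigen_one _) (subEigen_one _) oneObs 1
      (fun z => by simp) 0
    have h4 : Real.exp ((1 - t) * (α₀ * k / 2 * (2 - mom μ₀ 1 ^ (k - 1) - 2)) +
        t * (α₁ * k / 2 * (2 - mom μ₁ 1 ^ (k - 1) - 2))) ≤ Real.exp (-ℓ) := by
      rw [Real.exp_le_exp]
      refine convex_comb_le ht ?_ ?_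
      · unfold intens at hℓ₀; linarith
      · unfold intens at hℓ₁; linarith
    simp only [bF_zero, mul_one, sub_self, mul_zero, add_zero, Real.exp_zero] at h2 h3
    unfold gap
    refine add_le_add (mul_le_mul_of_nonneg_left ((le_abs_self _).trans (h2.trans h4))
      (abs_nonneg _)) ?_
    calc _ ≤ (2 * ∑' j, |intens k α₁ μ₁ (j + 2) - intens k α₀ μ₀ (j + 2)|) * 1 :=
          mul_le_mul_of_nonneg_left ((le_abs_self _).trans h3)
            (mul_nonneg zero_le_two (tsum_nonneg fun j => abs_nonneg _))
      _ = _ := mul_one _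
  have := abs_exp_sub_exp_sub_le _ _ (commute_gen (clauseLaw k μ₀) (clauseLaw k μ₁)
    (α₀ * k / 2) (α₁ * k / 2)) (momObs m) 0 0 _ hR t ht
  rw [mul_zero, sub_zero] at this
  exact this.trans (mul_le_of_le_one_right (gap_nonneg _ _ _ _ _ _) ht.2)

theorem abs_mom_recursion_sub_le (hk : 2 ≤ k) (hα₀ : 0 ≤ α₀) (hα₁ : 0 ≤ α₁)
    (h₀ : Summable (mom μ₀)) (h₁ : Summable (mom μ₁)) {ℓ : ℝ} (hℓ₀ : ℓ ≤ intens k α₀ μ₀ 1)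
    (hℓ₁ : ℓ ≤ intens k α₁ μ₁ 1) (m : ℕ) :
    |mom (recursion k α₁ μ₁) m - mom (recursion k α₀ μ₀) m| ≤ gap k ℓ α₀ μ₀ α₁ μ₁ := by
  have := abs_exp_segment_momObs_sub_le hk hα₀ hα₁ h₀ h₁ hℓ₀ hℓ₁ m (t := 1) (by simp)
  rw [one_smul, add_sub_cancel] at this
  rwa [mom_recursion hk hα₀ (ae_lt_one_of_summable_mom h₀),
    mom_recursion hk hα₁ (ae_lt_one_of_summable_mom h₁)]

end Segment

/-! ### The inverse moment of Π⁻ -/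

section InverseMoment

variable {k : ℕ} {μ : ProbabilityMeasure unitInterval} {α : ℝ}

/-- The function 1/Π⁻ is unbounded and so is not an observable. Its truncations are observables,
they obey the weighted bound with a constant independent of the level, and monotone convergence
applies. -/
theorem lintegral_inv_bF_le (hk : 2 ≤ k) (hα : 0 ≤ α) (h : Summable (mom μ)) :
    ∫⁻ ω, ENNReal.ofReal (bF (logPair k ω))⁻¹ ∂(law k α μ) ≤
      ENNReal.ofReal (Real.exp (∑' j, intens k α μ (j + 1))) := by
  have hb : Measurable bF := continuous_bF.measurable
  have hmono : ∀ z : LogPair, Monotone fun n : ℕ => ENNReal.ofReal (min (bF z)⁻¹ n) := by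
    intro z a b hab
    exact ENNReal.ofReal_le_ofReal (min_le_min_left _ (by exact_mod_cast hab))
  have hlim := lintegral_tendsto_of_tendsto_of_monotone (μ := law k α μ)
    (f := fun (n : ℕ) ω => ENNReal.ofReal (min (bF (logPair k ω))⁻¹ n))
    (F := fun ω => ENNReal.ofReal (bF (logPair k ω))⁻¹)
    (fun n => Measurable.aemeasurable (by fun_prop)) (ae_of_all _ fun ω => hmono _)
    (ae_of_all _ fun ω => ?_)
  · refine le_of_tendsto' hlim fun n => ?_
    set g : Obs := Obs.mk (fun z => min (bF z)⁻¹ n)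
      ((continuous_bF.inv₀ fun z => (bF_pos z).ne').min continuous_const) n (fun z => by
        rw [abs_of_nonneg (le_min (inv_nonneg.2 (bF_pos z).le) (Nat.cast_nonneg n))]
        exact min_le_right _ _) with hg
    have h1 := abs_exp_gen_le (ρ := clauseLaw k μ) (r := α * k / 2)
      (φ := fun z => (bF z)⁻¹) (fun z => inv_pos.2 (bF_pos z)) (by positivity)
      (subEigen_inv_bF hk h) g 1 (fun z => by
        rw [one_mul, hg, Obs.mk_apply,
          abs_of_nonneg (le_min (inv_nonneg.2 (bF_pos z).le) (Nat.cast_nonneg n))]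
        exact min_le_left _ _) 0
    rw [← integral_comp_logPair k hα] at h1
    have h2 : α * k / 2 * (2 + ∑' j, mom μ (j + 1) ^ (k - 1) - 2) =
        ∑' j, intens k α μ (j + 1) := by
      unfold intens
      rw [tsum_mul_left]
      ring
    rw [h2] at h1
    simp only [bF_zero, inv_one, mul_one] at h1
    rw [← ofReal_integral_eq_lintegral_ofReal]
    · exact ENNReal.ofReal_le_ofReal ((le_abs_self _).trans h1)
    · refine Integrable.of_bound (C := ‖g‖) ?_ (ae_of_all _ fun ω => g.norm_coe_le_norm _)
      exact (Measurable.aestronglyMeasurable (by fun_prop))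
    · exact ae_of_all _ fun ω => le_min (inv_nonneg.2 (bF_pos _).le) (Nat.cast_nonneg n)
  · refine tendsto_const_nhds.congr' ?_
    obtain ⟨N, hN⟩ := exists_nat_ge (bF (logPair k ω))⁻¹
    filter_upwards [eventually_ge_atTop N] with n hn
    rw [min_eq_left (hN.trans (by exact_mod_cast hn))]

theorem integrable_inv_bF (hk : 2 ≤ k) (hα : 0 ≤ α) (h : Summable (mom μ)) :
    Integrable (fun ω => (bF (logPair k ω))⁻¹) (law k α μ) := by
  have hb : Measurable bF := continuous_bF.measurable
  refine ⟨Measurable.aestronglyMeasurable (by fun_prop), ?_⟩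
  rw [hasFiniteIntegral_iff_ofReal (ae_of_all _ fun ω => inv_nonneg.2 (bF_pos _).le)]
  exact (lintegral_inv_bF_le hk hα h).trans_lt ENNReal.ofReal_lt_top

theorem integral_inv_bF_le (hk : 2 ≤ k) (hα : 0 ≤ α) (h : Summable (mom μ)) :
    ∫ ω, (bF (logPair k ω))⁻¹ ∂(law k α μ) ≤ Real.exp (∑' j, intens k α μ (j + 1)) := by
  have h1 := lintegral_inv_bF_le hk hα h
  rw [← ofReal_integral_eq_lintegral_ofReal (integrable_inv_bF hk hα h)
    (ae_of_all _ fun ω => inv_nonneg.2 (bF_pos _).le)] at h1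
  exact (ENNReal.ofReal_le_ofReal_iff (Real.exp_pos _).le).1 h1

/-- The bound does not depend on `ε`: it provides the dominating function for removing the
regularization of the logarithm. -/
theorem abs_log_sF_add_le (z : LogPair) {ε : ℝ} (h0 : 0 ≤ ε) (h1 : ε ≤ 1) :
    |Real.log (sF z + ε)| ≤ (bF z)⁻¹ := by
  have hs := sF_pos z
  have hb := bF_pos z
  have h3 : (1 : ℝ) ≤ (bF z)⁻¹ := (one_le_inv₀ hb).2 (bF_le_one z)
  rw [abs_le]
  constructor
  · have h4 := Real.one_sub_inv_le_log_of_pos hs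
    have h5 : Real.log (sF z) ≤ Real.log (sF z + ε) := Real.log_le_log hs (by linarith)
    have h6 : (sF z)⁻¹ ≤ (bF z)⁻¹ := inv_anti₀ hb (bF_le_sF z)
    linarith
  · have := Real.log_le_sub_one_of_pos (by linarith : 0 < sF z + ε)
    linarith [sF_le_one z]

theorem integrable_log_sF (hk : 2 ≤ k) (hα : 0 ≤ α) (h : Summable (mom μ)) :
    Integrable (fun ω => Real.log (sF (logPair k ω))) (law k α μ) := by
  have hs : Measurable sF := continuous_sF.measurable
  refine (integrable_inv_bF hk hα h).mono' (Measurable.aestronglyMeasurable (by fun_prop))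
    (ae_of_all _ fun ω => ?_)
  simpa using abs_log_sF_add_le (logPair k ω) le_rfl zero_le_one

end InverseMoment

/-! ### First variation of the logarithmic site term -/

theorem etaF_swap (z : LogPair) : etaF z.swap = qF z := by
  have h1 : aF z.swap = bF z := rfl
  have h2 : bF z.swap = aF z := rfl
  unfold etaF qF sF
  rw [h1, h2]
  ring

/-- The observable `log (Π⁺ + Π⁻ - Π⁺ Π⁻ + ε)`. -/
def logObs (ε : ℝ) (h0 : 0 < ε) (h1 : ε ≤ 1) : Obs :=
  Obs.mk (fun z => Real.log (sF z + ε))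
    (Continuous.log (by fun_prop) fun z => by have := sF_pos z; positivity)
    (|Real.log ε| + Real.log 2) fun z => by
      have h2 := sF_pos z
      have h3 : Real.log ε ≤ Real.log (sF z + ε) := Real.log_le_log h0 (by linarith)
      have h4 : Real.log (sF z + ε) ≤ Real.log 2 :=
        Real.log_le_log (by linarith) (by linarith [sF_le_one z])
      have h5 : 0 ≤ Real.log 2 := Real.log_nonneg (by norm_num)
      rw [abs_le]
      constructor
      · linarith [neg_abs_le (Real.log ε)]
      · linarith [abs_nonneg (Real.log ε)]

@[simp] theorem logObs_apply (ε : ℝ) (h0 : 0 < ε) (h1 : ε ≤ 1) (z : LogPair) :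
    logObs ε h0 h1 z = Real.log (sF z + ε) := rfl

theorem hasSum_neg_pow_div (x : ℝ) (h0 : 0 ≤ x) (h1 : x < 1) :
    HasSum (fun j : ℕ => -(x ^ j / j)) (Real.log (1 - x)) := by
  have h := Real.hasSum_pow_div_log_of_abs_lt_one (x := x) (by rwa [abs_of_nonneg h0])
  rw [← hasSum_nat_add_iff' 1]
  simpa using h.neg

theorem pow_sub_pow_le_nat_mul {x y : ℝ} (hx0 : 0 ≤ x) (hxy : x ≤ y) (hy : y ≤ 1) (j : ℕ) :
    y ^ j - x ^ j ≤ j * (y - x) := by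
  induction j with
  | zero => simp
  | succ j ih =>
    have h1 : y ^ j ≤ 1 := pow_le_one₀ (hx0.trans hxy) hy
    have h2 : x ^ j ≤ y ^ j := pow_le_pow_left₀ hx0 hxy j
    have h3 : 0 ≤ x ^ j := pow_nonneg hx0 j
    rw [pow_succ, pow_succ]
    push_cast
    nlinarith

section LogFunctional

variable {k : ℕ} {μ₀ μ₁ : ProbabilityMeasure unitInterval} {α₀ α₁ : ℝ}

/-- A clause multiplies the regularized site weight by 1-xu or 1-yu, where x and y are η and q with
`ε` added to the denominator, and the logarithm is expanded in u. Replacing x^j, y^j by η^j, q^j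
costs at most j·ε/Π⁻ each, and the coefficient 1/j compensates the factor j. -/
theorem abs_gen_sub_gen_logObs_add_le (hk : 2 ≤ k) (h₀ : Summable (mom μ₀))
    (h₁ : Summable (mom μ₁)) {ε : ℝ} (hε0 : 0 < ε) (hε1 : ε ≤ 1) (z : LogPair) :
    |(gen (clauseLaw k μ₁) (α₁ * k / 2) - gen (clauseLaw k μ₀) (α₀ * k / 2))
        (logObs ε hε0 hε1) z +
      ∑' j : ℕ, (intens k α₁ μ₁ j - intens k α₀ μ₀ j) / j * (etaF z ^ j + qF z ^ j)| ≤
      2 * ε * (∑' j, |intens k α₁ μ₁ j - intens k α₀ μ₀ j|) * (bF z)⁻¹ := by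
  have hs := sF_pos z
  have hsε : 0 < sF z + ε := by linarith
  set x := (1 - bF z) * aF z / (sF z + ε) with hx
  set y := (1 - aF z) * bF z / (sF z + ε) with hy
  have hx0 : 0 ≤ x := div_nonneg (mul_nonneg (by linarith [bF_le_one z]) (aF_pos z).le) hsε.le
  have hy0 : 0 ≤ y := div_nonneg (mul_nonneg (by linarith [aF_le_one z]) (bF_pos z).le) hsε.le
  set σ := ε / (sF z + ε) with hσ
  have hσ0 : 0 ≤ σ := div_nonneg hε0.le hsε.le
  have hxη : x = etaF z - etaF z * σ := by
    rw [hx, hσ]; unfold etaF; field_simp; ring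
  have hyq : y = qF z - qF z * σ := by
    rw [hy, hσ]; unfold qF; field_simp; ring
  have hη0 := etaF_nonneg z
  have hη1 := (etaF_lt_one z)
  have hq0 := qF_nonneg z
  have hq1 := (qF_lt_one z)
  have hxle : x ≤ etaF z := by rw [hxη]; nlinarith
  have hyle : y ≤ qF z := by rw [hyq]; nlinarith
  have hσb : σ ≤ ε * (bF z)⁻¹ := by
    rw [hσ, div_eq_mul_inv]
    exact mul_le_mul_of_nonneg_left (inv_anti₀ (bF_pos z) (by linarith [bF_le_sF z])) hε0.le
  have hx1 : x < 1 := by linarith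
  have hy1 : y < 1 := by linarith
  have hdiv : ∀ (w : ℝ) (j : ℕ), 0 ≤ w → w ≤ 1 → 0 ≤ w / j ∧ w / j ≤ 1 := by
    intro w j h0 h1
    refine ⟨div_nonneg h0 (Nat.cast_nonneg j), ?_⟩
    rcases Nat.eq_zero_or_pos j with rfl | hj
    · simp
    · exact div_le_one_of_le₀ (h1.trans (by exact_mod_cast hj)) (Nat.cast_nonneg j)
  have hsum := hasSum_gen_sub_gen (μ₀ := μ₀) (μ₁ := μ₁) hk h₀ h₁ α₀ α₁
    (c := fun j : ℕ => -(x ^ j / j) + -(y ^ j / j)) (C := 2)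
    (g := logObs ε hε0 hε1) (z := z) (fun j => by
      have e1 := hdiv _ j (pow_nonneg hx0 j) (pow_le_one₀ hx0 hx1.le)
      have e2 := hdiv _ j (pow_nonneg hy0 j) (pow_le_one₀ hy0 hy1.le)
      rw [abs_le]; constructor <;> linarith [e1.1, e1.2, e2.1, e2.2]) (fun u hu => by
      have hxu1 : x * u < 1 := by nlinarith [hu.1, hu.2]
      have hyu1 : y * u < 1 := by nlinarith [hu.1, hu.2]
      have e1 := hasSum_neg_pow_div (x * u) (mul_nonneg hx0 hu.1) hxu1
      have e2 := hasSum_neg_pow_div (y * u) (mul_nonneg hy0 hu.1) hyu1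
      have e3 : Real.log (sF (z + inc true u) + ε) =
          Real.log (sF z + ε) + Real.log (1 - x * u) := by
        rw [← Real.log_mul hsε.ne' (by linarith), sF_inc_true hu]
        congr 1
        rw [hx]; field_simp; ring
      have e4 : Real.log (sF (z + inc false u) + ε) =
          Real.log (sF z + ε) + Real.log (1 - y * u) := by
        rw [← Real.log_mul hsε.ne' (by linarith), sF_inc_false hu]
        congr 1
        rw [hy]; field_simp; ring
      have e5 : logObs ε hε0 hε1 (z + inc true u) + logObs ε hε0 hε1 (z + inc false u) -
          2 * logObs ε hε0 hε1 z = Real.log (1 - x * u) + Real.log (1 - y * u) := by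
        rw [logObs_apply, logObs_apply, logObs_apply, e3, e4]; ring
      rw [e5]
      refine (e1.add e2).congr_fun fun j => ?_
      rw [mul_pow, mul_pow]; ring)
  set d := fun j => intens k α₁ μ₁ j - intens k α₀ μ₀ j with hd
  have hdabs : Summable fun j => |d j| := summable_abs_intens_sub hk h₀ h₁
  have hsumH : Summable fun j : ℕ => d j / j * (etaF z ^ j + qF z ^ j) := by
    refine (hdabs.mul_left 2).of_norm_bounded fun j => ?_
    have e1 := hdiv _ j (pow_nonneg hη0 j) (pow_le_one₀ hη0 hη1.le)
    have e2 := hdiv _ j (pow_nonneg hq0 j) (pow_le_one₀ hq0 hq1.le)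
    have e3 : d j / j * (etaF z ^ j + qF z ^ j) = d j * (etaF z ^ j / j + qF z ^ j / j) := by ring
    rw [e3, norm_mul, Real.norm_eq_abs, Real.norm_eq_abs, mul_comm,
      abs_of_nonneg (add_nonneg e1.1 e2.1)]
    exact mul_le_mul_of_nonneg_right (by linarith) (abs_nonneg _)
  have htot := hsum.add hsumH.hasSum
  rw [← htot.tsum_eq, ← Real.norm_eq_abs]
  have hrhs : HasSum (fun j => 2 * ε * |d j| * (bF z)⁻¹)
      (2 * ε * (∑' j, |d j|) * (bF z)⁻¹) := (hdabs.hasSum.mul_left _).mul_right _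
  refine tsum_of_norm_bounded hrhs fun j => ?_
  have e1 := pow_sub_pow_le_nat_mul hx0 hxle hη1.le j
  have e2 := pow_sub_pow_le_nat_mul hy0 hyle hq1.le j
  have e1' := pow_le_pow_left₀ hx0 hxle j
  have e2' := pow_le_pow_left₀ hy0 hyle j
  have e3 : (-(x ^ j / j) + -(y ^ j / j)) * d j + d j / j * (etaF z ^ j + qF z ^ j) =
      d j * ((etaF z ^ j - x ^ j + (qF z ^ j - y ^ j)) / j) := by ring
  have e4 : 0 ≤ (etaF z ^ j - x ^ j + (qF z ^ j - y ^ j)) / j :=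
    div_nonneg (by linarith) (Nat.cast_nonneg j)
  have e5 : (etaF z ^ j - x ^ j + (qF z ^ j - y ^ j)) / j ≤ 2 * σ := by
    rcases Nat.eq_zero_or_pos j with rfl | hj
    · simpa using hσ0
    · have hj' : (0 : ℝ) < j := by exact_mod_cast hj
      rw [div_le_iff₀ hj']
      have f1 : etaF z - x ≤ σ := by rw [hxη]; nlinarith
      have f2 : qF z - y ≤ σ := by rw [hyq]; nlinarith
      nlinarith
  rw [e3, norm_mul, Real.norm_eq_abs, Real.norm_eq_abs, abs_of_nonneg e4]
  calc |d j| * ((etaF z ^ j - x ^ j + (qF z ^ j - y ^ j)) / j) ≤ |d j| * (2 * (ε * (bF z)⁻¹)) :=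
        mul_le_mul_of_nonneg_left (e5.trans (by linarith)) (abs_nonneg _)
    _ = _ := by ring

theorem norm_momObs_le (j : ℕ) : ‖momObs j‖ ≤ 1 := Obs.norm_mk_le _ _ _

theorem norm_swapOp_le (g : Obs) : ‖swapOp g‖ ≤ ‖g‖ :=
  Obs.norm_mk_le _ _ fun _ => g.norm_coe_le_norm _

theorem abs_div_nat_le (x : ℝ) (j : ℕ) : |x / j| ≤ |x| := by
  rcases Nat.eq_zero_or_pos j with rfl | hj
  · simp
  · rw [abs_div, Nat.abs_cast]
    exact div_le_self (abs_nonneg _) (by exact_mod_cast hj)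

theorem summable_abs_intens_sub_div (hk : 2 ≤ k) (h₀ : Summable (mom μ₀))
    (h₁ : Summable (mom μ₁)) :
    Summable fun j : ℕ => |(intens k α₁ μ₁ j - intens k α₀ μ₀ j) / j| :=
  (summable_abs_intens_sub hk h₀ h₁).of_nonneg_of_le (fun _ => abs_nonneg _)
    fun j => abs_div_nat_le _ j

/-- Up to the `ε` error, the derivative along the segment is the mean of -Σ_j v_j (η^j + q^j). The
swap symmetry identifies the means of η^j and q^j, and `abs_exp_segment_momObs_sub_le` replaces them
by their values at the starting point at the cost of one `gap`. -/
theorem abs_exp_logObs_sub_le (hk : 2 ≤ k) (hα₀ : 0 ≤ α₀) (hα₁ : 0 ≤ α₁)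
    (h₀ : Summable (mom μ₀)) (h₁ : Summable (mom μ₁)) {ℓ : ℝ} (hℓ₀ : ℓ ≤ intens k α₀ μ₀ 1)
    (hℓ₁ : ℓ ≤ intens k α₁ μ₁ 1) {ε : ℝ} (hε0 : 0 < ε) (hε1 : ε ≤ 1) :
    |NormedSpace.exp (gen (clauseLaw k μ₁) (α₁ * k / 2)) (logObs ε hε0 hε1) 0 -
      NormedSpace.exp (gen (clauseLaw k μ₀) (α₀ * k / 2)) (logObs ε hε0 hε1) 0 +
      2 * ∑' j : ℕ, (intens k α₁ μ₁ j - intens k α₀ μ₀ j) / j * mom (recursion k α₀ μ₀) j| ≤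
      2 * (∑' j : ℕ, |(intens k α₁ μ₁ j - intens k α₀ μ₀ j) / j|) * gap k ℓ α₀ μ₀ α₁ μ₁ +
      ε * (2 * (∑' j, |intens k α₁ μ₁ j - intens k α₀ μ₀ j|) *
        Real.exp (∑' j, intens k α₀ μ₀ (j + 1) + ∑' j, intens k α₁ μ₁ (j + 1))) := by
  have hr₀ : 0 ≤ α₀ * k / 2 := by positivity
  have hr₁ : 0 ≤ α₁ * k / 2 := by positivity
  set A := gen (clauseLaw k μ₀) (α₀ * k / 2) with hA
  set B := gen (clauseLaw k μ₁) (α₁ * k / 2) with hB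
  -- Division by zero gives `v 0 = 0`, as needed: the logarithm has no term of order zero in u.
  set v := fun j : ℕ => (intens k α₁ μ₁ j - intens k α₀ μ₀ j) / j with hv
  have hvs : Summable fun j => |v j| := summable_abs_intens_sub_div hk h₀ h₁
  have hfs : Summable fun j => v j • (momObs j + swapOp (momObs j)) := by
    refine (hvs.mul_right 2).of_norm_bounded fun j => ?_
    rw [norm_smul, Real.norm_eq_abs]
    refine mul_le_mul_of_nonneg_left ?_ (abs_nonneg _)
    refine (norm_add_le _ _).trans ?_
    have := norm_momObs_le j
    have := norm_swapOp_le (momObs j)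
    linarith
  set H : Obs := ∑' j, v j • (momObs j + swapOp (momObs j)) with hH
  have hHz : ∀ z, H z = ∑' j, v j * (etaF z ^ j + qF z ^ j) := by
    intro z
    have := (hfs.hasSum.mapL (Obs.eval z)).tsum_eq
    rw [Obs.eval_apply] at this
    rw [hH, ← this]
    refine tsum_congr fun j => ?_
    simp [etaF_swap, mul_add]
  have hNb : ∀ j, |mom (recursion k α₀ μ₀) j| ≤ 1 := fun j => by
    rw [abs_of_nonneg (mom_nonneg _ j)]; exact mom_le_one _ j
  have hvN : Summable fun j => v j * mom (recursion k α₀ μ₀) j := by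
    refine hvs.of_norm_bounded fun j => ?_
    rw [norm_mul, Real.norm_eq_abs, Real.norm_eq_abs]
    exact mul_le_of_le_one_right (abs_nonneg _) (hNb j)
  set T := ∑' j, |intens k α₁ μ₁ j - intens k α₀ μ₀ j| with hT
  have hT0 : 0 ≤ T := tsum_nonneg fun j => abs_nonneg _
  have hi0 : ∀ {α : ℝ} {μ : ProbabilityMeasure unitInterval}, 0 ≤ α * k / 2 →
      0 ≤ ∑' j, intens k α μ (j + 1) := fun hr =>
    tsum_nonneg fun j => mul_nonneg hr (pow_nonneg (mom_nonneg _ _) _)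
  have hR : ∀ t ∈ Set.Icc (0 : ℝ) 1,
      |NormedSpace.exp (A + t • (B - A)) ((B - A) (logObs ε hε0 hε1)) 0 -
        -(2 * ∑' j, v j * mom (recursion k α₀ μ₀) j)| ≤
      2 * (∑' j : ℕ, |v j|) * gap k ℓ α₀ μ₀ α₁ μ₁ + ε * (2 * T *
        Real.exp (∑' j, intens k α₀ μ₀ (j + 1) + ∑' j, intens k α₁ μ₁ (j + 1))) := by
    intro t ht
    have h1 := abs_exp_segment_le (ρ := clauseLaw k μ₀) (σ := clauseLaw k μ₁)
      (φ := fun z => (bF z)⁻¹) (fun z => inv_pos.2 (bF_pos z)) hr₀ hr₁ ht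
      (subEigen_inv_bF hk h₀) (subEigen_inv_bF hk h₁) ((B - A) (logObs ε hε0 hε1) + H)
      (2 * ε * T) (fun z => by
        rw [Obs.add_apply, hHz]
        exact abs_gen_sub_gen_logObs_add_le hk h₀ h₁ hε0 hε1 z) 0
    have h2 : Real.exp ((1 - t) * (α₀ * k / 2 * (2 + ∑' j, mom μ₀ (j + 1) ^ (k - 1) - 2)) +
        t * (α₁ * k / 2 * (2 + ∑' j, mom μ₁ (j + 1) ^ (k - 1) - 2))) ≤
        Real.exp (∑' j, intens k α₀ μ₀ (j + 1) + ∑' j, intens k α₁ μ₁ (j + 1)) := by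
      have e : ∀ (α : ℝ) (μ : ProbabilityMeasure unitInterval),
          α * k / 2 * (2 + ∑' j, mom μ (j + 1) ^ (k - 1) - 2) = ∑' j, intens k α μ (j + 1) := by
        intro α μ
        unfold intens
        rw [tsum_mul_left]; ring
      rw [e, e, Real.exp_le_exp]
      exact convex_comb_le ht (by linarith [hi0 (μ := μ₁) hr₁]) (by linarith [hi0 (μ := μ₀) hr₀])
    simp only [bF_zero, inv_one, mul_one] at h1
    rw [← hA, ← hB, map_add, Obs.add_apply] at h1
    have h3 : |NormedSpace.exp (A + t • (B - A)) H 0 -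
        2 * ∑' j, v j * mom (recursion k α₀ μ₀) j| ≤
        2 * (∑' j : ℕ, |v j|) * gap k ℓ α₀ μ₀ α₁ μ₁ := by
      have e1 := hfs.hasSum.mapL ((Obs.eval 0).comp (NormedSpace.exp (A + t • (B - A))))
      have e2 := e1.sub (hvN.hasSum.mul_left 2)
      have e3 : HasSum (fun j => 2 * |v j| * gap k ℓ α₀ μ₀ α₁ μ₁)
        (2 * (∑' j : ℕ, |v j|) * gap k ℓ α₀ μ₀ α₁ μ₁) := (hvs.hasSum.mul_left 2).mul_right _
      change |((Obs.eval 0).comp (NormedSpace.exp (A + t • (B - A)))) H - _| ≤ _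
      rw [← e2.tsum_eq, ← Real.norm_eq_abs]
      refine tsum_of_norm_bounded e3 fun j => ?_
      have e4 : ((Obs.eval 0).comp (NormedSpace.exp (A + t • (B - A))))
          (v j • (momObs j + swapOp (momObs j))) - 2 * (v j * mom (recursion k α₀ μ₀) j) =
          2 * v j * (NormedSpace.exp (A + t • (B - A)) (momObs j) 0 -
            NormedSpace.exp A (momObs j) 0) := by
        rw [mom_recursion hk hα₀ (ae_lt_one_of_summable_mom h₀), ← hA]
        change NormedSpace.exp (A + t • (B - A)) (v j • (momObs j + swapOp (momObs j))) 0 - _ = _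
        rw [map_smul, map_add, Obs.smul_apply, Obs.add_apply, hA, hB, exp_segment_swapOp]
        ring
      rw [e4, norm_mul, norm_mul, Real.norm_eq_abs, Real.norm_eq_abs, Real.norm_eq_abs, abs_two]
      exact mul_le_mul_of_nonneg_left
        (abs_exp_segment_momObs_sub_le hk hα₀ hα₁ h₀ h₁ hℓ₀ hℓ₁ j ht) (by positivity)
    have h4 : |NormedSpace.exp (A + t • (B - A)) ((B - A) (logObs ε hε0 hε1)) 0 +
        NormedSpace.exp (A + t • (B - A)) H 0| ≤ ε * (2 * T *
        Real.exp (∑' j, intens k α₀ μ₀ (j + 1) + ∑' j, intens k α₁ μ₁ (j + 1))) := by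
      refine h1.trans ?_
      calc _ ≤ Real.exp (∑' j, intens k α₀ μ₀ (j + 1) + ∑' j, intens k α₁ μ₁ (j + 1)) *
            (2 * ε * T) := mul_le_mul_of_nonneg_right h2 (by positivity)
        _ = _ := by ring
    rw [abs_le] at h3 h4 ⊢
    constructor <;> linarith [h3.1, h3.2, h4.1, h4.2]
  have hfin := abs_exp_sub_exp_sub_le A B (commute_gen _ _ _ _) _ 0 _ _ hR 1 (by simp)
  rw [one_smul, add_sub_cancel, one_mul, mul_one, sub_neg_eq_add] at hfin
  exact hfin

theorem tendsto_exp_logObs (hk : 2 ≤ k) {α : ℝ} (hα : 0 ≤ α)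
    {μ : ProbabilityMeasure unitInterval} (h : Summable (mom μ)) {ε : ℕ → ℝ}
    (hε0 : ∀ n, 0 < ε n) (hε1 : ∀ n, ε n ≤ 1) (hε : Tendsto ε atTop (𝓝 0)) :
    Tendsto (fun n => NormedSpace.exp (gen (clauseLaw k μ) (α * k / 2))
      (logObs (ε n) (hε0 n) (hε1 n)) 0) atTop
      (𝓝 (∫ ω, Real.log (sF (logPair k ω)) ∂(law k α μ))) := by
  simp only [← integral_comp_logPair k hα, logObs_apply]
  have hs : Measurable sF := continuous_sF.measurable
  refine tendsto_integral_of_dominated_convergence (fun ω => (bF (logPair k ω))⁻¹)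
    (fun n => Measurable.aestronglyMeasurable (by fun_prop)) (integrable_inv_bF hk hα h)
    (fun n => ae_of_all _ fun ω => abs_log_sF_add_le _ (hε0 n).le (hε1 n))
    (ae_of_all _ fun ω => ?_)
  have h1 : Tendsto (fun n => sF (logPair k ω) + ε n) atTop (𝓝 (sF (logPair k ω))) := by
    simpa using tendsto_const_nhds.add hε
  exact (Real.continuousAt_log (sF_pos _).ne').tendsto.comp h1

/-- First order expansion of `𝔼 log (Π⁺ + Π⁻ - Π⁺ Π⁻)` in the clause intensity. -/
theorem abs_integral_log_sF_sub_le (hk : 2 ≤ k) (hα₀ : 0 ≤ α₀) (hα₁ : 0 ≤ α₁)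
    (h₀ : Summable (mom μ₀)) (h₁ : Summable (mom μ₁)) {ℓ : ℝ} (hℓ₀ : ℓ ≤ intens k α₀ μ₀ 1)
    (hℓ₁ : ℓ ≤ intens k α₁ μ₁ 1) :
    |∫ ω, Real.log (sF (logPair k ω)) ∂(law k α₁ μ₁) -
      ∫ ω, Real.log (sF (logPair k ω)) ∂(law k α₀ μ₀) +
      2 * ∑' j : ℕ, (intens k α₁ μ₁ j - intens k α₀ μ₀ j) / j * mom (recursion k α₀ μ₀) j| ≤
      2 * (∑' j : ℕ, |(intens k α₁ μ₁ j - intens k α₀ μ₀ j) / j|) * gap k ℓ α₀ μ₀ α₁ μ₁ := by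
  have hε0 : ∀ n : ℕ, (0 : ℝ) < 1 / (n + 1) := fun n => by positivity
  have hε1 : ∀ n : ℕ, (1 : ℝ) / (n + 1) ≤ 1 := fun n => by
    rw [div_le_one (by positivity)]; linarith [Nat.cast_nonneg (α := ℝ) n]
  have hε : Tendsto (fun n : ℕ => (1 : ℝ) / (n + 1)) atTop (𝓝 0) :=
    tendsto_one_div_add_atTop_nhds_zero_nat
  have t1 := (((tendsto_exp_logObs hk hα₁ h₁ hε0 hε1 hε).sub
    (tendsto_exp_logObs hk hα₀ h₀ hε0 hε1 hε)).add_const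
    (2 * ∑' j : ℕ, (intens k α₁ μ₁ j - intens k α₀ μ₀ j) / j * mom (recursion k α₀ μ₀) j)).abs
  have t2 := (hε.mul_const (2 * (∑' j, |intens k α₁ μ₁ j - intens k α₀ μ₀ j|) *
        Real.exp (∑' j, intens k α₀ μ₀ (j + 1) + ∑' j, intens k α₁ μ₁ (j + 1)))).const_add
    (2 * (∑' j : ℕ, |(intens k α₁ μ₁ j - intens k α₀ μ₀ j) / j|) * gap k ℓ α₀ μ₀ α₁ μ₁)
  rw [zero_mul, add_zero] at t2
  exact le_of_tendsto_of_tendsto' t1 t2 fun n =>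
    abs_exp_logObs_sub_le hk hα₀ hα₁ h₀ h₁ hℓ₀ hℓ₁ (hε0 n) (hε1 n)

end LogFunctional

/-! ### Size of k and the invariant class of laws -/

/-- `k` is large enough for all numerical estimates. -/
structure Large (k : ℕ) : Prop where
  thousand_le : 1000 ≤ k
  -- Calibrated to the error rate in (iv): since 2^{-k} is the fourth power of 2^{-k/4}, this leaves
  -- 10^9 k^8 2^{-k} ≤ 2^{-3k/4}.
  small : 10 ^ 9 * (k : ℝ) ^ 8 * (2 : ℝ) ^ (-(k : ℝ) / 4) ≤ 1

theorem eventually_large : ∀ᶠ k : ℕ in atTop, Large k := by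
  have h1 : Tendsto (fun k : ℕ => (k : ℝ) ^ 8 * ((2 : ℝ) ^ (-(1 : ℝ) / 4)) ^ k) atTop (𝓝 0) := by
    refine tendsto_pow_const_mul_const_pow_of_abs_lt_one 8 ?_
    rw [abs_of_pos (by positivity)]
    exact Real.rpow_lt_one_of_one_lt_of_neg (by norm_num) (by norm_num)
  have h2 := (h1.const_mul (10 ^ 9)).eventually_le_const (show (10 ^ 9 : ℝ) * 0 < 1 by norm_num)
  filter_upwards [h2, eventually_ge_atTop 1000] with k hk hk2
  refine ⟨hk2, ?_⟩
  rw [← Real.rpow_natCast ((2 : ℝ) ^ (-(1 : ℝ) / 4)), ← Real.rpow_mul (by norm_num),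
    ← mul_assoc, show -(1 : ℝ) / 4 * (k : ℝ) = -(k : ℝ) / 4 by ring] at hk
  exact hk

namespace Large

variable {k : ℕ} (hL : Large k)
include hL

theorem two_le : 2 ≤ k := by have := hL.thousand_le; omega

theorem one_le_cast : (1000 : ℝ) ≤ k := by exact_mod_cast hL.thousand_le

omit hL in
theorem half_pow_eq (k : ℕ) : (1 / 2 : ℝ) ^ k = ((2 : ℝ) ^ (-(k : ℝ) / 4)) ^ 4 := by
  rw [← Real.rpow_natCast ((2 : ℝ) ^ (-(k : ℝ) / 4)), ← Real.rpow_mul (by norm_num),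
    one_div, inv_pow, ← Real.rpow_natCast, ← Real.rpow_neg (by norm_num)]
  congr 1
  push_cast; ring

theorem quarter_le : 10 ^ 9 * (k : ℝ) ^ 8 * (1 / 2 : ℝ) ^ k ≤ ((2 : ℝ) ^ (-(k : ℝ) / 4)) ^ 3 := by
  rw [half_pow_eq, pow_succ _ 3, ← mul_assoc, mul_right_comm]
  exact mul_le_of_le_one_left (by positivity) hL.small

theorem mul_half_pow_le : 10 ^ 9 * (k : ℝ) ^ 8 * (1 / 2 : ℝ) ^ k ≤ 1 := by
  refine hL.quarter_le.trans (pow_le_one₀ (by positivity) ?_)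
  exact Real.rpow_le_one_of_one_le_of_nonpos (by norm_num)
    (by have := hL.one_le_cast; linarith)

theorem pow_mul_half_pow_le {i : ℕ} (hi : i ≤ 8) :
    10 ^ 9 * ((k : ℝ) ^ i * (1 / 2 : ℝ) ^ k) ≤ 1 := by
  refine le_trans ?_ hL.mul_half_pow_le
  rw [mul_assoc]
  have := hL.one_le_cast
  gcongr
  linarith

theorem half_pow_le : 10 ^ 9 * (1 / 2 : ℝ) ^ k ≤ 1 := by
  simpa using hL.pow_mul_half_pow_le (i := 0) (by norm_num)

theorem one_add_pow_le : (1 + 16 / (k : ℝ) ^ 4) ^ k ≤ 2 := by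
  have hk := hL.one_le_cast
  have h1 : 1 + 16 / (k : ℝ) ^ 4 ≤ Real.exp (16 / (k : ℝ) ^ 4) := by
    linarith [Real.add_one_le_exp (16 / (k : ℝ) ^ 4)]
  calc (1 + 16 / (k : ℝ) ^ 4) ^ k ≤ (Real.exp (16 / (k : ℝ) ^ 4)) ^ k := by gcongr
    _ = Real.exp (16 / (k : ℝ) ^ 3) := by
        rw [← Real.exp_nat_mul]; congr 1; field_simp
    _ ≤ Real.exp (Real.log 2) := by
        rw [Real.exp_le_exp]
        have : 16 / (k : ℝ) ^ 3 ≤ 1 / 2 := by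
          rw [div_le_iff₀ (by positivity)]
          have : (100 : ℝ) ^ 3 ≤ (k : ℝ) ^ 3 := by gcongr; linarith
          linarith
        linarith [Real.log_two_gt_d9]
    _ = 2 := Real.exp_log (by norm_num)

end Large

/-- Moment conditions that hold along the recursion started at `δ_{1/2}`. -/
structure Good (k : ℕ) (μ : ProbabilityMeasure unitInterval) : Prop where
  lo : 1 / 2 - (1 / 2) ^ k ≤ mom μ 1
  hi : mom μ 1 ≤ 1 / 2
  -- The left side is the mean of (η - 1/2)².
  var : mom μ 2 - mom μ 1 + 1 / 4 ≤ 1 / (k : ℝ) ^ 4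
  -- This says 𝔼[1/(1-η)] ≤ 2^{k+1}. In terms of partial sums it is closed under weak limits.
  inv : ∀ J, ∑ j ∈ Finset.range J, mom μ j ≤ 2 ^ (k + 1)

namespace Good

variable {k : ℕ} {μ : ProbabilityMeasure unitInterval} (hG : Good k μ)
include hG

theorem summable : Summable (mom μ) := summable_of_sum_range_le (mom_nonneg μ) hG.inv

theorem tsum_le : ∑' j, mom μ j ≤ 2 ^ (k + 1) :=
  hG.summable.tsum_le_of_sum_range_le hG.inv

theorem mom_two_le : mom μ 2 ≤ 1 / 4 + 1 / (k : ℝ) ^ 4 := by linarith [hG.var, hG.hi]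

theorem mom_three_le : mom μ 3 ≤ 1 / 8 + 2 / (k : ℝ) ^ 4 := by
  -- On [0,1] the quadratic 2x² - 5x/4 + 1/4 exceeds x³ by (x-1/2)²(1-x).
  have h : mom μ 3 ≤ 2 * mom μ 2 - 5 / 4 * mom μ 1 + 1 / 4 := by
    have h2 := (integrable_unitInterval_pow μ 2).const_mul 2
    have h1 := (integrable_unitInterval_pow μ 1).const_mul (5 / 4)
    have e : 2 * mom μ 2 - 5 / 4 * mom μ 1 + 1 / 4 =
        ∫ x, (2 * (x : ℝ) ^ 2 - 5 / 4 * (x : ℝ) ^ 1 + 1 / 4) ∂(μ : Measure unitInterval) := by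
      have e1 := integral_add (h2.sub h1) (integrable_const (1 / 4 : ℝ))
      have e2 := integral_sub h2 h1
      simp only [Pi.sub_apply] at e1
      rw [e1, e2, integral_const_mul, integral_const_mul]
      simp [mom]
    rw [e]
    refine integral_mono (integrable_unitInterval_pow μ 3)
      ((h2.sub h1).add (integrable_const _)) fun x => ?_
    have h0 := x.2.1
    have h1 := x.2.2
    have : 0 ≤ ((x : ℝ) - 1 / 2) ^ 2 * (1 - x) := mul_nonneg (sq_nonneg _) (by linarith)
    nlinarith
  have := hG.var
  have := hG.hi
  have e : 2 / (k : ℝ) ^ 4 = 2 * (1 / (k : ℝ) ^ 4) := by ring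
  rw [e]
  linarith

variable (hL : Large k)
include hL

/-- The second moment is at most 1/4 up to a relative error 16/k⁴, which costs a factor 2 in a k-th
power (`one_add_pow_le`). The remaining factor 16 comes from the exponent k-2. -/
theorem mom_two_pow_le {n : ℕ} (hn : k ≤ n + 2) : mom μ 2 ^ n ≤ 32 * ((1 / 2 : ℝ) ^ k) ^ 2 := by
  have hk := hL.one_le_cast
  have hk4 : (0 : ℝ) < (k : ℝ) ^ 4 := by positivity
  calc mom μ 2 ^ n ≤ mom μ 2 ^ (k - 2) :=
        pow_le_pow_of_le_one (mom_nonneg _ _) (mom_le_one _ _) (by omega)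
    _ ≤ (1 / 4 * (1 + 16 / (k : ℝ) ^ 4)) ^ (k - 2) := by
        refine pow_le_pow_left₀ (mom_nonneg _ _) (hG.mom_two_le.trans ?_) _
        have : 1 / 4 * (1 + 16 / (k : ℝ) ^ 4) = 1 / 4 + 4 / (k : ℝ) ^ 4 := by ring
        rw [this]
        gcongr
        norm_num
    _ = (1 / 4) ^ (k - 2) * (1 + 16 / (k : ℝ) ^ 4) ^ (k - 2) := mul_pow _ _ _
    _ ≤ (1 / 4) ^ (k - 2) * (1 + 16 / (k : ℝ) ^ 4) ^ k := by
        gcongr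
        · linarith [show 0 ≤ 16 / (k : ℝ) ^ 4 by positivity]
        · omega
    _ ≤ (1 / 4) ^ (k - 2) * 2 := by gcongr; exact hL.one_add_pow_le
    _ = 32 * ((1 / 2 : ℝ) ^ k) ^ 2 := by
        rw [← pow_mul, mul_comm k 2, pow_mul]
        obtain ⟨m, rfl⟩ := Nat.exists_eq_add_of_le hL.two_le
        rw [Nat.add_sub_cancel_left, pow_add]
        norm_num
        ring

theorem mom_three_pow_le {n : ℕ} (hn : k ≤ n + 3) :
    mom μ 3 ^ n ≤ 1024 * ((1 / 2 : ℝ) ^ k) ^ 3 := by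
  have hk := hL.one_le_cast
  have hk4 : (0 : ℝ) < (k : ℝ) ^ 4 := by positivity
  calc mom μ 3 ^ n ≤ mom μ 3 ^ (k - 3) :=
        pow_le_pow_of_le_one (mom_nonneg _ _) (mom_le_one _ _) (by omega)
    _ ≤ (1 / 8 * (1 + 16 / (k : ℝ) ^ 4)) ^ (k - 3) := by
        refine pow_le_pow_left₀ (mom_nonneg _ _) (hG.mom_three_le.trans (le_of_eq ?_)) _
        ring
    _ = (1 / 8) ^ (k - 3) * (1 + 16 / (k : ℝ) ^ 4) ^ (k - 3) := mul_pow _ _ _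
    _ ≤ (1 / 8) ^ (k - 3) * (1 + 16 / (k : ℝ) ^ 4) ^ k := by
        gcongr
        · linarith [show 0 ≤ 16 / (k : ℝ) ^ 4 by positivity]
        · omega
    _ ≤ (1 / 8) ^ (k - 3) * 2 := by gcongr; exact hL.one_add_pow_le
    _ = 1024 * ((1 / 2 : ℝ) ^ k) ^ 3 := by
        rw [← pow_mul, mul_comm k 3, pow_mul]
        obtain ⟨m, rfl⟩ := Nat.exists_eq_add_of_le (show 3 ≤ k by have := hL.thousand_le; omega)
        rw [Nat.add_sub_cancel_left, pow_add]
        norm_num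
        ring

/-- The term j = 2 is of order 4^{-k}. For j ≥ 3 one factor m_j is kept for summability, with total
at most 2^{k+1}, and the other n-1 factors, each at most m_3, give order 8^{-k}. -/
theorem tsum_mom_pow_le {n : ℕ} (hn : k ≤ n + 2) :
    ∑' j, mom μ (j + 2) ^ n ≤ 4096 * ((1 / 2 : ℝ) ^ k) ^ 2 := by
  have hn0 : n ≠ 0 := by have := hL.thousand_le; omega
  have hs := summable_mom_pow hG.summable hn0
  have hs2 : Summable fun j => mom μ (j + 2) ^ n :=
    (summable_nat_add_iff (f := fun j => mom μ j ^ n) 2).2 hs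
  rw [hs2.tsum_eq_zero_add]
  have h1 := hG.mom_two_pow_le hL hn
  have h2 : ∑' j, mom μ (j + 1 + 2) ^ n ≤ 2048 * ((1 / 2 : ℝ) ^ k) ^ 2 := by
    have hs3 : Summable fun j => mom μ (j + 3) := (summable_nat_add_iff 3).2 hG.summable
    have h3 : ∑' j, mom μ (j + 3) ≤ 2 ^ (k + 1) := by
      refine le_trans ?_ hG.tsum_le
      have := hG.summable.sum_add_tsum_nat_add 3
      have h0 : 0 ≤ ∑ j ∈ Finset.range 3, mom μ j := Finset.sum_nonneg fun j _ => mom_nonneg μ j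
      linarith
    have h4 : ∀ j, mom μ (j + 3) ^ n ≤ mom μ 3 ^ (n - 1) * mom μ (j + 3) := by
      intro j
      obtain ⟨m, rfl⟩ := Nat.exists_eq_succ_of_ne_zero hn0
      rw [Nat.succ_sub_one, pow_succ]
      exact mul_le_mul_of_nonneg_right
        (pow_le_pow_left₀ (mom_nonneg _ _) (mom_anti μ (by omega)) m) (mom_nonneg _ _)
    calc ∑' j, mom μ (j + 1 + 2) ^ n = ∑' j, mom μ (j + 3) ^ n := rfl
      _ ≤ ∑' j, mom μ 3 ^ (n - 1) * mom μ (j + 3) := by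
          refine Summable.tsum_le_tsum h4 ?_ (hs3.mul_left _)
          exact (summable_nat_add_iff (f := fun j => mom μ j ^ n) 3).2 hs
      _ = mom μ 3 ^ (n - 1) * ∑' j, mom μ (j + 3) := tsum_mul_left
      _ ≤ (1024 * ((1 / 2 : ℝ) ^ k) ^ 3) * 2 ^ (k + 1) :=
          mul_le_mul (hG.mom_three_pow_le hL (by omega)) h3
            (tsum_nonneg fun j => mom_nonneg _ _) (by positivity)
      _ = 2048 * ((1 / 2 : ℝ) ^ k) ^ 2 * ((1 / 2) ^ k * 2 ^ k) := by ring
      _ = 2048 * ((1 / 2 : ℝ) ^ k) ^ 2 := by rw [← mul_pow]; norm_num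
  have : 0 ≤ ((1 / 2 : ℝ) ^ k) ^ 2 := by positivity
  simp only [zero_add]
  linarith

end Good

/-! ### Intensities for densities in the interval -/

section Range

variable {k : ℕ} (hL : Large k) {α : ℝ} (hα : α ∈ Set.Icc (lbd k) (ubd k))
include hL hα

omit hL in
theorem mul_half_pow_ge : Real.log 2 - 2 * (1 / 2 : ℝ) ^ k ≤ α * (1 / 2) ^ k := by
  have h1 : (2 : ℝ) ^ k * (1 / 2) ^ k = 1 := by rw [← mul_pow]; norm_num
  have h2 : 0 < (1 / 2 : ℝ) ^ k := by positivity
  have h3 := mul_le_mul_of_nonneg_right hα.1 h2.le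
  rw [lbd, show (2 ^ k * Real.log 2 - 2) * (1 / 2 : ℝ) ^ k =
    Real.log 2 * (2 ^ k * (1 / 2) ^ k) - 2 * (1 / 2) ^ k by ring, h1, mul_one] at h3
  exact h3

omit hL in
theorem mul_half_pow_le_log : α * (1 / 2) ^ k ≤ Real.log 2 := by
  have h1 : (2 : ℝ) ^ k * (1 / 2) ^ k = 1 := by rw [← mul_pow]; norm_num
  have h2 : 0 < (1 / 2 : ℝ) ^ k := by positivity
  have h3 := mul_le_mul_of_nonneg_right hα.2 h2.le
  rw [ubd, show 2 ^ k * Real.log 2 * (1 / 2 : ℝ) ^ k =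
    Real.log 2 * (2 ^ k * (1 / 2) ^ k) by ring, h1, mul_one] at h3
  exact h3

theorem density_pos : 0 < α := by
  have h1 := mul_half_pow_ge hα
  have h2 := hL.half_pow_le
  have h3 := Real.log_two_gt_d9
  have h4 : 0 < α * (1 / 2) ^ k := by linarith
  exact pos_of_mul_pos_left h4 (by positivity)

variable {μ : ProbabilityMeasure unitInterval} (hG : Good k μ)
include hG

theorem intens_one_le : intens k α μ 1 ≤ k * Real.log 2 := by
  have h1 := mul_half_pow_le_log hα
  have h2 := (density_pos hL hα).le
  calc intens k α μ 1 ≤ α * k / 2 * (1 / 2) ^ (k - 1) := by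
        unfold intens
        gcongr
        · exact mom_nonneg _ _
        · exact hG.hi
    _ = k * (α * (1 / 2) ^ k) := by
        obtain ⟨m, rfl⟩ := Nat.exists_eq_add_of_le (show 1 ≤ k by have := hL.thousand_le; omega)
        rw [Nat.add_sub_cancel_left, pow_add]; ring
    _ ≤ _ := by gcongr

/-- The main term is k log 2. The corrections from the density and from `Good.lo` (through
Bernoulli's inequality) are O(k² 2^{-k}), well within the slack log 2. -/
theorem le_intens_one : ((k : ℝ) - 1) * Real.log 2 ≤ intens k α μ 1 := by
  have h1 := mul_half_pow_ge hα
  have h2 := (density_pos hL hα).le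
  have hk := hL.one_le_cast
  have hp : 0 < (1 / 2 : ℝ) ^ k := by positivity
  have hkp := hL.pow_mul_half_pow_le (i := 1) (by norm_num)
  have hkp2 := hL.pow_mul_half_pow_le (i := 2) (by norm_num)
  have hp9 := hL.half_pow_le
  rw [pow_one] at hkp
  have hlog1 := Real.log_two_gt_d9
  have hlog2 := Real.log_two_lt_d9
  have h3 : (1 / 2 : ℝ) ^ (k - 1) * (1 - 2 * (k * (1 / 2) ^ k)) ≤ mom μ 1 ^ (k - 1) := by
    calc (1 / 2 : ℝ) ^ (k - 1) * (1 - 2 * (k * (1 / 2) ^ k))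
        ≤ (1 / 2 : ℝ) ^ (k - 1) * (1 + (k - 1 : ℕ) * (-(2 * (1 / 2) ^ k))) := by
          gcongr
          rw [Nat.cast_sub (by have := hL.thousand_le; omega)]
          push_cast
          nlinarith
      _ ≤ (1 / 2 : ℝ) ^ (k - 1) * (1 + -(2 * (1 / 2) ^ k)) ^ (k - 1) := by
          gcongr
          exact one_add_mul_le_pow (by linarith) _
      _ = (1 / 2 - (1 / 2) ^ k) ^ (k - 1) := by rw [← mul_pow]; congr 1; ring
      _ ≤ mom μ 1 ^ (k - 1) := pow_le_pow_left₀ (by linarith) hG.lo _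
  calc ((k : ℝ) - 1) * Real.log 2
      ≤ k * ((Real.log 2 - 2 * (1 / 2) ^ k) * (1 - 2 * (k * (1 / 2) ^ k))) := by
        have e : k * ((Real.log 2 - 2 * (1 / 2 : ℝ) ^ k) * (1 - 2 * (k * (1 / 2) ^ k))) =
          k * Real.log 2 - 2 * (k * (1 / 2) ^ k) - 2 * Real.log 2 * (k ^ 2 * (1 / 2) ^ k) +
            4 * (k * (1 / 2) ^ k) ^ 2 := by ring
        rw [e]
        nlinarith [sq_nonneg (k * (1 / 2 : ℝ) ^ k)]
    _ ≤ k * ((α * (1 / 2) ^ k) * (1 - 2 * (k * (1 / 2) ^ k))) := by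
        gcongr
        linarith
    _ = α * k / 2 * ((1 / 2 : ℝ) ^ (k - 1) * (1 - 2 * (k * (1 / 2) ^ k))) := by
        obtain ⟨m, rfl⟩ := Nat.exists_eq_add_of_le (show 1 ≤ k by have := hL.thousand_le; omega)
        rw [Nat.add_sub_cancel_left]
        ring
    _ ≤ α * k / 2 * mom μ 1 ^ (k - 1) := by gcongr

omit hG in
theorem rate_mul_half_pow_le : α * k / 2 * (1 / 2) ^ k ≤ k / 2 := by
  have h1 := mul_half_pow_le_log hα
  have hlog2 := Real.log_two_lt_d9
  have hk := hL.one_le_cast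
  calc α * k / 2 * (1 / 2) ^ k = k / 2 * (α * (1 / 2) ^ k) := by ring
    _ ≤ k / 2 * 1 := by gcongr; linarith
    _ = k / 2 := mul_one _

theorem tsum_intens_le : ∑' j, intens k α μ (j + 2) ≤ 2048 * (k * (1 / 2) ^ k) := by
  have h1 := rate_mul_half_pow_le hL hα
  have h2 := (density_pos hL hα).le
  unfold intens
  rw [tsum_mul_left]
  calc α * k / 2 * ∑' j, mom μ (j + 2) ^ (k - 1)
      ≤ α * k / 2 * (4096 * ((1 / 2 : ℝ) ^ k) ^ 2) := by
        gcongr; exact hG.tsum_mom_pow_le hL (by omega)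
    _ = 4096 * (1 / 2 : ℝ) ^ k * (α * k / 2 * (1 / 2) ^ k) := by ring
    _ ≤ 4096 * (1 / 2 : ℝ) ^ k * (k / 2) := by gcongr
    _ = _ := by ring

end Range

/-! ### Exact moments of Π⁻ and concentration of η around 1/2 -/

section Observables

variable {k : ℕ} {μ : ProbabilityMeasure unitInterval} {α : ℝ}

theorem integrable_comp_logPair (k : ℕ) (α : ℝ) (μ : ProbabilityMeasure unitInterval)
    {f : LogPair → ℝ} (hf : Continuous f) {C : ℝ} (hC : ∀ z, |f z| ≤ C) :
    Integrable (fun ω => f (logPair k ω)) (law k α μ) :=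
  Integrable.of_bound (C := C) (hf.measurable.comp (measurable_logPair k)).aestronglyMeasurable
    (ae_of_all _ fun _ => hC _)

theorem integral_comp_logPair_swap (k : ℕ) (hα : 0 ≤ α) (μ : ProbabilityMeasure unitInterval)
    {f : LogPair → ℝ} (hf : Continuous f) {C : ℝ} (hC : ∀ z, |f z| ≤ C) :
    ∫ ω, f (logPair k ω).swap ∂(law k α μ) = ∫ ω, f (logPair k ω) ∂(law k α μ) := by
  have h1 := integral_comp_logPair k hα μ (Obs.mk f hf C hC)
  have h2 := integral_comp_logPair k hα μ (swapOp (Obs.mk f hf C hC))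
  rw [exp_gen_swapOp, ← h1] at h2
  exact h2

theorem abs_bF_pow_le (n : ℕ) (z : LogPair) : |bF z ^ n| ≤ 1 := by
  rw [abs_of_nonneg (pow_nonneg (bF_pos z).le n)]
  exact pow_le_one₀ (bF_pos z).le (bF_le_one z)

/-- Powers of `Π⁻` as observables. -/
def bPowObs (n : ℕ) : Obs := Obs.mk (fun z => bF z ^ n) (by fun_prop) 1 (abs_bF_pow_le n)

@[simp] theorem bPowObs_apply (n : ℕ) (z : LogPair) : bPowObs n z = bF z ^ n := rfl

/-- Powers of Π⁻ are multiplicative under increments, hence eigenvectors of the generator; their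
expectations are explicit exponentials. -/
theorem gen_bPowObs (hk : 2 ≤ k) (h : Summable (mom μ)) (α : ℝ) (n : ℕ) :
    gen (clauseLaw k μ) (α * k / 2) (bPowObs n) =
      (α * k / 2 * ∫ u, ((1 - u) ^ n - 1) ∂(clauseLaw k μ)) • bPowObs n := by
  have hae := ae_clauseLaw_mem hk (ae_lt_one_of_summable_mom h)
  ext z
  rw [gen_apply, Obs.smul_apply, bPowObs_apply, mul_assoc, ← integral_mul_const]
  congr 1
  refine integral_congr_ae ?_
  filter_upwards [hae] with u hu
  simp only [bPowObs_apply, bF_inc_true, bF_inc_false hu, mul_pow]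
  ring

theorem integral_bF_pow (hk : 2 ≤ k) (hα : 0 ≤ α) (h : Summable (mom μ)) (n : ℕ) :
    ∫ ω, bF (logPair k ω) ^ n ∂(law k α μ) =
      Real.exp (α * k / 2 * ∫ u, ((1 - u) ^ n - 1) ∂(clauseLaw k μ)) := by
  have h1 := integral_comp_logPair k hα μ (bPowObs n)
  rw [exp_apply_eigen _ _ _ (gen_bPowObs hk h α n)] at h1
  simpa using h1

theorem integral_bF (hk : 2 ≤ k) (hα : 0 ≤ α) (h : Summable (mom μ)) :
    ∫ ω, bF (logPair k ω) ∂(law k α μ) = Real.exp (-intens k α μ 1) := by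
  have h1 := integral_bF_pow (α := α) hk hα h 1
  simp only [pow_one] at h1
  rw [h1]
  congr 1
  have h2 : ∀ u : ℝ, 1 - u - 1 = -u ^ 1 := fun u => by ring
  simp only [h2]
  rw [integral_neg, integral_pow_clauseLaw, intens]
  ring

theorem integral_bF_sq (hk : 2 ≤ k) (hα : 0 ≤ α) (h : Summable (mom μ)) :
    ∫ ω, bF (logPair k ω) ^ 2 ∂(law k α μ) =
      Real.exp (-intens k α μ 1) ^ 2 * Real.exp (intens k α μ 2) := by
  rw [integral_bF_pow hk hα h 2, ← Real.exp_nat_mul, ← Real.exp_add]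
  congr 1
  have h2 : ∀ u : ℝ, (1 - u) ^ 2 - 1 = u ^ 2 - 2 * u ^ 1 := fun u => by ring
  simp only [h2]
  rw [integral_sub (integrable_pow_clauseLaw hk h 2)
    ((integrable_pow_clauseLaw hk h 1).const_mul 2), integral_const_mul,
    integral_pow_clauseLaw, integral_pow_clauseLaw, intens, intens]
  push_cast; ring

/-- The relative variance of Π⁻ is exp(λ_2) - 1, which is small because λ_2 is. -/
theorem integral_bF_sub_sq (hk : 2 ≤ k) (hα : 0 ≤ α) (h : Summable (mom μ)) :
    ∫ ω, (bF (logPair k ω) - Real.exp (-intens k α μ 1)) ^ 2 ∂(law k α μ) =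
      Real.exp (-intens k α μ 1) ^ 2 * (Real.exp (intens k α μ 2) - 1) := by
  set P := Real.exp (-intens k α μ 1) with hP
  have i1 : Integrable (fun ω => bF (logPair k ω) ^ 2) (law k α μ) :=
    integrable_comp_logPair k α μ (by fun_prop) (abs_bF_pow_le 2)
  have i2 : Integrable (fun ω => (2 * P) * bF (logPair k ω)) (law k α μ) := by
    have := integrable_comp_logPair k α μ (f := fun z => bF z ^ 1) (by fun_prop) (abs_bF_pow_le 1)
    simp only [pow_one] at this
    exact this.const_mul _
  have e := integral_add (i1.sub i2) (integrable_const (P ^ 2))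
  have e2 := integral_sub i1 i2
  simp only [Pi.sub_apply] at e
  rw [e2, integral_const_mul, integral_bF hk hα h, integral_bF_sq hk hα h] at e
  have e3 : ∀ ω : Sample, (bF (logPair k ω) - P) ^ 2 =
      bF (logPair k ω) ^ 2 - 2 * P * bF (logPair k ω) + P ^ 2 := fun ω => by ring
  simp only [e3]
  rw [e]
  simp
  ring

/-- Write η - 1/2 = ((a-b)/S - r)/2, where a = Π⁺, b = Π⁻ and S = a+b-ab. If S ≥ P/2 the quotient is
controlled by (a-b)/P. Otherwise a ≤ S < P/2 is itself a deviation from P of order P, and the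
quotient is at most 1 in modulus. -/
theorem etaF_sub_half_sq_le (z : LogPair) {P : ℝ} (hP : 0 < P) :
    (etaF z - 1 / 2) ^ 2 ≤ 4 / P ^ 2 * ((aF z - P) ^ 2 + (bF z - P) ^ 2) + bF z / 2 := by
  have hs := sF_pos z
  have ha := aF_pos z
  have hb := bF_pos z
  have hr0 := (rF_pos z).le
  have hrb := rF_le_bF z
  have hb1 := bF_le_one z
  have e : etaF z - 1 / 2 = ((aF z - bF z) / sF z - rF z) / 2 := by
    unfold etaF rF
    field_simp
    unfold sF; ring
  have h1 : ((aF z - bF z) / sF z) ^ 2 ≤ 8 / P ^ 2 * ((aF z - P) ^ 2 + (bF z - P) ^ 2) := by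
    rcases le_or_gt (P / 2) (sF z) with h | h
    · rw [div_pow, div_mul_eq_mul_div, div_le_div_iff₀ (by positivity) (by positivity)]
      have h2 : P ^ 2 ≤ 4 * sF z ^ 2 := by nlinarith
      calc (aF z - bF z) ^ 2 * P ^ 2 ≤ (aF z - bF z) ^ 2 * (4 * sF z ^ 2) := by gcongr
        _ = 4 * (aF z - bF z) ^ 2 * sF z ^ 2 := by ring
        _ ≤ 8 * ((aF z - P) ^ 2 + (bF z - P) ^ 2) * sF z ^ 2 := by
            refine mul_le_mul_of_nonneg_right ?_ (by positivity)
            nlinarith [sq_nonneg (aF z - P + (bF z - P))]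
    · have h2 : ((aF z - bF z) / sF z) ^ 2 ≤ 1 := by
        rw [div_pow, div_le_one (by positivity)]
        have := aF_le_sF z
        have := bF_le_sF z
        nlinarith
      have h3 := aF_le_sF z
      have h4 : P ^ 2 ≤ 8 * ((aF z - P) ^ 2 + (bF z - P) ^ 2) := by
        nlinarith [sq_nonneg (bF z - P)]
      refine h2.trans ?_
      rw [div_mul_eq_mul_div, le_div_iff₀ (by positivity)]
      linarith
  rw [e]
  have h5 : rF z ^ 2 ≤ bF z := by nlinarith
  have h6 : 4 / P ^ 2 * ((aF z - P) ^ 2 + (bF z - P) ^ 2) =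
    8 / P ^ 2 * ((aF z - P) ^ 2 + (bF z - P) ^ 2) / 2 := by ring
  rw [h6]
  nlinarith [sq_nonneg ((aF z - bF z) / sF z + rF z)]

theorem exp_sub_one_le {x : ℝ} (h0 : 0 ≤ x) (h1 : x ≤ 1 / 2) : Real.exp x - 1 ≤ 2 * x := by
  have h2 := Real.one_sub_le_exp_neg x
  have h3 : Real.exp x * Real.exp (-x) = 1 := by rw [← Real.exp_add]; simp
  have h4 := Real.exp_pos x
  have h5 : Real.exp x * (1 - x) ≤ 1 := (mul_le_mul_of_nonneg_left h2 h4.le).trans_eq h3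
  have h6 : Real.exp x ≤ 2 := by nlinarith
  nlinarith

/-- Take means in η + q + r = 1 and use that η and q have equal means by symmetry. -/
theorem half_mul_mom_recursion (hk : 2 ≤ k) (hα : 0 ≤ α) (h : Summable (mom μ)) :
    mom (recursion k α μ) 1 = 1 / 2 - (∫ ω, rF (logPair k ω) ∂(law k α μ)) / 2 := by
  have ce : ∀ z, |etaF z| ≤ 1 := fun z => by
    rw [abs_of_nonneg (etaF_nonneg z)]; exact (etaF_lt_one z).le
  have cq : ∀ z, |qF z| ≤ 1 := fun z => by
    rw [abs_of_nonneg (qF_nonneg z)]; exact (qF_lt_one z).le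
  have i1 := integrable_comp_logPair k α μ (f := etaF) (by fun_prop) ce
  have i2 := integrable_comp_logPair k α μ (f := qF) (by fun_prop) cq
  have e1 : mom (recursion k α μ) 1 = ∫ ω, etaF (logPair k ω) ∂(law k α μ) := by
    rw [mom_recursion_eq_integral hk α (ae_lt_one_of_summable_mom h)]
    simp only [pow_one]
  have e2 := integral_comp_logPair_swap k hα μ (f := etaF) (by fun_prop) ce
  simp only [etaF_swap] at e2
  have e3 : ∫ ω, rF (logPair k ω) ∂(law k α μ) =
      ∫ ω, (1 - (etaF (logPair k ω) + qF (logPair k ω))) ∂(law k α μ) :=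
    integral_congr_ae (ae_of_all _ fun ω => by
      have := etaF_add_qF_add_rF (logPair k ω)
      dsimp only
      linarith)
  have e4 := integral_sub (integrable_const (1 : ℝ)) (i1.add i2)
  simp only [Pi.add_apply] at e4
  rw [e3, e4, integral_add i1 i2, e2, e1]
  simp
  ring

end Observables

/-! ### Invariance of the moment conditions -/

section Invariance

variable {k : ℕ} (hL : Large k) {α : ℝ} (hα : α ∈ Set.Icc (lbd k) (ubd k))
  {μ : ProbabilityMeasure unitInterval} (hG : Good k μ)
include hL hα hG

theorem exp_neg_intens_one_le : Real.exp (-intens k α μ 1) ≤ 2 * (1 / 2 : ℝ) ^ k := by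
  have h1 := le_intens_one hL hα hG
  calc Real.exp (-intens k α μ 1) ≤ Real.exp (Real.log (2 * (1 / 2 : ℝ) ^ k)) := by
        rw [Real.exp_le_exp, Real.log_mul (by norm_num) (by positivity), Real.log_pow,
          one_div, Real.log_inv]
        linarith
    _ = _ := Real.exp_log (by positivity)

theorem intens_two_le : intens k α μ 2 ≤ 2048 * (k * (1 / 2 : ℝ) ^ k) := by
  refine le_trans ?_ (tsum_intens_le hL hα hG)
  have hs := (summable_nat_add_iff 2).2 (summable_intens hL.two_le hG.summable α)
  have h0 : ∀ j, 0 ≤ intens k α μ (j + 2) := fun j =>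
    mul_nonneg (by have := density_pos hL hα; positivity) (pow_nonneg (mom_nonneg _ _) _)
  exact hs.le_tsum 0 fun j _ => h0 j

/-- The mean of η is (1 - 𝔼 r)/2 with 0 ≤ r ≤ Π⁻ and 𝔼 Π⁻ ≤ 2·2^{-k}. The variance bound holds
because Π⁺ and Π⁻ concentrate around their common mean. Partial sums of η^j are at most 1/Π⁻, with
mean at most exp(Σ_{j≥1} λ_j), and that exponent is at most k log 2 plus a small error, hence at
most (k+1) log 2. -/
theorem good_recursion : Good k (recursion k α μ) := by
  have hk := hL.two_le
  have hα0 := (density_pos hL hα).le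
  have hs := hG.summable
  have hμ := ae_lt_one_of_summable_mom hs
  have hk1 := hL.one_le_cast
  have hp : 0 < (1 / 2 : ℝ) ^ k := by positivity
  have hP := exp_neg_intens_one_le hL hα hG
  have hkp := hL.pow_mul_half_pow_le (i := 1) (by norm_num)
  rw [pow_one] at hkp
  have ib : Integrable (fun ω => bF (logPair k ω)) (law k α μ) := by
    simpa using integrable_comp_logPair k α μ (f := fun z => bF z ^ 1) (by fun_prop)
      (abs_bF_pow_le 1)
  have ir : Integrable (fun ω => rF (logPair k ω)) (law k α μ) :=
    integrable_comp_logPair k α μ (f := rF) (C := 1) (by fun_prop) fun z => by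
      rw [abs_of_pos (rF_pos z)]; exact (rF_le_bF z).trans (bF_le_one z)
  have hr : ∫ ω, rF (logPair k ω) ∂(law k α μ) ≤ 2 * (1 / 2) ^ k := by
    refine le_trans ?_ hP
    rw [← integral_bF hk hα0 hs]
    exact integral_mono ir ib fun ω => rF_le_bF _
  have hr0 : 0 ≤ ∫ ω, rF (logPair k ω) ∂(law k α μ) :=
    integral_nonneg fun ω => (rF_pos _).le
  have hm1 := half_mul_mom_recursion hk hα0 hs
  have im : ∀ m, Integrable (fun ω => etaF (logPair k ω) ^ m) (law k α μ) := fun m =>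
    integrable_comp_logPair k α μ (f := fun z => etaF z ^ m) (by fun_prop) (C := 1) fun z => by
      rw [abs_of_nonneg (pow_nonneg (etaF_nonneg z) m)]
      exact pow_le_one₀ (etaF_nonneg z) (etaF_lt_one z).le
  refine ⟨by linarith, by linarith, ?_, ?_⟩
  · set P := Real.exp (-intens k α μ 1) with hPdef
    have hP0 : 0 < P := Real.exp_pos _
    have e1 : mom (recursion k α μ) 2 - mom (recursion k α μ) 1 + 1 / 4 =
        ∫ ω, (etaF (logPair k ω) - 1 / 2) ^ 2 ∂(law k α μ) := by
      rw [mom_recursion_eq_integral hk α hμ, mom_recursion_eq_integral hk α hμ]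
      have e2 := integral_add ((im 2).sub (im 1)) (integrable_const (1 / 4 : ℝ))
      have e3 := integral_sub (im 2) (im 1)
      simp only [Pi.sub_apply] at e2
      rw [e3] at e2
      have e4 : ∀ ω : Sample, (etaF (logPair k ω) - 1 / 2) ^ 2 =
        etaF (logPair k ω) ^ 2 - etaF (logPair k ω) ^ 1 + 1 / 4 := fun ω => by ring
      simp only [e4]
      rw [e2]
      simp
    have cb : ∀ z, |(bF z - P) ^ 2| ≤ (1 + P) ^ 2 := fun z => by
      rw [abs_of_nonneg (sq_nonneg _), ← sq_abs]
      have := bF_pos z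
      have := bF_le_one z
      gcongr
      rw [abs_le]; constructor <;> linarith
    have jb := integrable_comp_logPair k α μ (f := fun z => (bF z - P) ^ 2) (by fun_prop) cb
    have ja : Integrable (fun ω => (aF (logPair k ω) - P) ^ 2) (law k α μ) :=
      integrable_comp_logPair k α μ (f := fun z => (aF z - P) ^ 2) (by fun_prop)
        fun z => cb z.swap
    have hsw : ∫ ω, (aF (logPair k ω) - P) ^ 2 ∂(law k α μ) =
        ∫ ω, (bF (logPair k ω) - P) ^ 2 ∂(law k α μ) :=
      integral_comp_logPair_swap k hα0 μ (f := fun z => (bF z - P) ^ 2) (by fun_prop) cb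
    have hv := integral_bF_sub_sq hk hα0 hs
    rw [← hPdef] at hv
    have h3 : ∫ ω, (etaF (logPair k ω) - 1 / 2) ^ 2 ∂(law k α μ) ≤
        ∫ ω, (4 / P ^ 2 * ((aF (logPair k ω) - P) ^ 2 + (bF (logPair k ω) - P) ^ 2) +
          bF (logPair k ω) / 2) ∂(law k α μ) := by
      refine integral_mono_of_nonneg (ae_of_all _ fun ω => sq_nonneg _)
        (((ja.add jb).const_mul _).add (ib.div_const 2))
        (ae_of_all _ fun ω => etaF_sub_half_sq_le _ hP0)
    have h4 := integral_add ((ja.add jb).const_mul (4 / P ^ 2)) (ib.div_const 2)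
    simp only [Pi.add_apply] at h4
    rw [h4, integral_const_mul, integral_add ja jb, hsw, hv, integral_div,
      integral_bF hk hα0 hs, ← hPdef] at h3
    have h5 : 4 / P ^ 2 * (P ^ 2 * (Real.exp (intens k α μ 2) - 1) +
        P ^ 2 * (Real.exp (intens k α μ 2) - 1)) = 8 * (Real.exp (intens k α μ 2) - 1) := by
      field_simp; ring
    rw [h5] at h3
    have hi2 := intens_two_le hL hα hG
    have h6 := exp_sub_one_le (x := intens k α μ 2)
      (mul_nonneg (by positivity) (pow_nonneg (mom_nonneg _ _) _)) (by linarith)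
    have h7 := hL.pow_mul_half_pow_le (i := 5) (by norm_num)
    have h8 : 32769 * (k * (1 / 2 : ℝ) ^ k) ≤ 1 / (k : ℝ) ^ 4 := by
      rw [le_div_iff₀ (by positivity)]
      have : 32769 * (k * (1 / 2 : ℝ) ^ k) * (k : ℝ) ^ 4 = 32769 * ((k : ℝ) ^ 5 * (1 / 2) ^ k) := by
        ring
      rw [this]
      have : 0 ≤ (k : ℝ) ^ 5 * (1 / 2) ^ k := by positivity
      linarith
    have h9 : (1 / 2 : ℝ) ^ k ≤ k * (1 / 2 : ℝ) ^ k := by nlinarith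
    rw [e1]
    linarith
  · intro J
    have e1 : ∑ j ∈ Finset.range J, mom (recursion k α μ) j =
        ∫ ω, ∑ j ∈ Finset.range J, etaF (logPair k ω) ^ j ∂(law k α μ) := by
      rw [integral_finsetSum _ fun j _ => im j]
      exact Finset.sum_congr rfl fun j _ => mom_recursion_eq_integral hk α hμ j
    have h1 : ∫ ω, ∑ j ∈ Finset.range J, etaF (logPair k ω) ^ j ∂(law k α μ) ≤
        ∫ ω, (bF (logPair k ω))⁻¹ ∂(law k α μ) := by
      refine integral_mono (integrable_finsetSum _ fun j _ => im j)
        (integrable_inv_bF hk hα0 hs) fun ω => ?_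
      have h0 := etaF_nonneg (logPair k ω)
      have h1 := etaF_lt_one (logPair k ω)
      calc ∑ j ∈ Finset.range J, etaF (logPair k ω) ^ j ≤ ∑' j, etaF (logPair k ω) ^ j :=
            (summable_geometric_of_lt_one h0 h1).sum_le_tsum _ fun j _ => pow_nonneg h0 j
        _ = (1 - etaF (logPair k ω))⁻¹ := tsum_geometric_of_lt_one h0 h1
        _ ≤ (bF (logPair k ω))⁻¹ := inv_anti₀ (bF_pos _) (bF_le_one_sub_etaF _)
    have h2 := integral_inv_bF_le hk hα0 hs
    have h3 : ∑' j, intens k α μ (j + 1) ≤ ((k + 1 : ℕ) : ℝ) * Real.log 2 := by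
      have hsum := (summable_nat_add_iff 1).2 (summable_intens hk hs α)
      rw [hsum.tsum_eq_zero_add]
      have h4 := intens_one_le hL hα hG
      have h5 := tsum_intens_le hL hα hG
      have h6 := Real.log_two_gt_d9
      push_cast
      simp only [add_assoc, one_add_one_eq_two]
      linarith
    rw [e1]
    refine h1.trans (h2.trans ?_)
    calc _ ≤ Real.exp (((k + 1 : ℕ) : ℝ) * Real.log 2) := Real.exp_le_exp.2 h3
      _ = 2 ^ (k + 1) := by rw [Real.exp_nat_mul, Real.exp_log (by norm_num)]

end Invariance

theorem mom_iter_zero (k : ℕ) (α : ℝ) (m : ℕ) : mom (iter k α 0) m = (1 / 2) ^ m := by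
  change ∫ x : unitInterval, (x : ℝ) ^ m ∂(Measure.dirac half) = _
  rw [integral_dirac]
  rfl

theorem good_iter_zero (k : ℕ) (α : ℝ) : Good k (iter k α 0) := by
  refine ⟨?_, ?_, ?_, ?_⟩
  · rw [mom_iter_zero, pow_one]
    linarith [show 0 ≤ (1 / 2 : ℝ) ^ k by positivity]
  · rw [mom_iter_zero, pow_one]
  · rw [mom_iter_zero, mom_iter_zero]
    norm_num
  · intro J
    simp only [mom_iter_zero]
    calc ∑ j ∈ Finset.range J, (1 / 2 : ℝ) ^ j ≤ ∑' j, (1 / 2 : ℝ) ^ j :=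
          summable_geometric_two.sum_le_tsum _ fun j _ => by positivity
      _ = 2 := tsum_geometric_two
      _ = 2 ^ 1 := by norm_num
      _ ≤ 2 ^ (k + 1) := pow_le_pow_right₀ (by norm_num) (by omega)

theorem good_iter {k : ℕ} (hL : Large k) {α : ℝ} (hα : α ∈ Set.Icc (lbd k) (ubd k)) :
    ∀ ℓ, Good k (iter k α ℓ)
  | 0 => good_iter_zero k α
  | ℓ + 1 => good_recursion hL hα (good_iter hL hα ℓ)

theorem abs_pow_succ_sub_pow_succ_le {x y : ℝ} (hx : 0 ≤ x) (hy : 0 ≤ y) (n : ℕ) :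
    |x ^ (n + 1) - y ^ (n + 1)| ≤ (n + 1) * (x ^ n + y ^ n) * |x - y| := by
  have h := abs_pow_sub_pow_le (a := x) (b := y) (n + 1)
  rw [abs_of_nonneg hx, abs_of_nonneg hy, Nat.add_sub_cancel] at h
  have h2 : max x y ^ n ≤ x ^ n + y ^ n := by
    rcases max_choice x y with h | h <;> rw [h] <;>
      linarith [pow_nonneg hx n, pow_nonneg hy n]
  calc _ ≤ |x - y| * (n + 1 : ℕ) * max x y ^ n := h
    _ ≤ |x - y| * (n + 1 : ℕ) * (x ^ n + y ^ n) := by gcongr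
    _ = _ := by push_cast; ring

/-! ### Contraction of the moments -/

section Contraction

variable {k : ℕ} (hL : Large k) {α₀ α₁ : ℝ} (hα₀ : α₀ ∈ Set.Icc (lbd k) (ubd k))
  (hα₁ : α₁ ∈ Set.Icc (lbd k) (ubd k)) {μ₀ μ₁ : ProbabilityMeasure unitInterval}
  (hG₀ : Good k μ₀) (hG₁ : Good k μ₁)
include hL hα₀

theorem abs_intens_sub_le (μ₀ μ₁ : ProbabilityMeasure unitInterval) (j : ℕ) :
    |intens k α₁ μ₁ j - intens k α₀ μ₀ j| ≤
      k / 2 * |α₁ - α₀| * mom μ₁ j ^ (k - 1) +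
      α₀ * k / 2 * (k * (mom μ₁ j ^ (k - 2) + mom μ₀ j ^ (k - 2)) * |mom μ₁ j - mom μ₀ j|) := by
  have h0 := (density_pos hL hα₀).le
  have hk := hL.two_le
  have hm := abs_pow_succ_sub_pow_succ_le (mom_nonneg μ₁ j) (mom_nonneg μ₀ j) (k - 2)
  have e : k - 2 + 1 = k - 1 := by omega
  have e2 : ((k - 2 : ℕ) : ℝ) + 1 ≤ k := by rw [Nat.cast_sub hk]; push_cast; linarith
  rw [e] at hm
  have hs : 0 ≤ mom μ₁ j ^ (k - 2) + mom μ₀ j ^ (k - 2) :=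
    add_nonneg (pow_nonneg (mom_nonneg _ _) _) (pow_nonneg (mom_nonneg _ _) _)
  have e3 : intens k α₁ μ₁ j - intens k α₀ μ₀ j = k / 2 * (α₁ - α₀) * mom μ₁ j ^ (k - 1) +
      α₀ * k / 2 * (mom μ₁ j ^ (k - 1) - mom μ₀ j ^ (k - 1)) := by unfold intens; ring
  rw [e3]
  refine (abs_add_le _ _).trans (add_le_add ?_ ?_)
  · rw [abs_mul, abs_mul, abs_of_nonneg (by positivity : (0 : ℝ) ≤ k / 2),
      abs_of_nonneg (pow_nonneg (mom_nonneg μ₁ j) _)]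
  · rw [abs_mul, abs_of_nonneg (by positivity : (0 : ℝ) ≤ α₀ * k / 2)]
    refine mul_le_mul_of_nonneg_left (hm.trans ?_) (by positivity)
    gcongr

include hG₀ hG₁

theorem abs_intens_one_sub_le {D : ℝ} (hD : |mom μ₁ 1 - mom μ₀ 1| ≤ D) :
    |intens k α₁ μ₁ 1 - intens k α₀ μ₀ 1| ≤
      k * (1 / 2) ^ k * |α₁ - α₀| + 4 * (k : ℝ) ^ 2 * D := by
  have h0 := (density_pos hL hα₀).le
  have hk := hL.two_le
  have hr := rate_mul_half_pow_le hL hα₀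
  have e1 : (1 / 2 : ℝ) ^ (k - 1) = 2 * (1 / 2) ^ k := by
    obtain ⟨m, rfl⟩ := Nat.exists_eq_add_of_le hk
    rw [show 2 + m - 1 = m + 1 by omega, pow_add, pow_add]; ring
  have e2 : (1 / 2 : ℝ) ^ (k - 2) = 4 * (1 / 2) ^ k := by
    obtain ⟨m, rfl⟩ := Nat.exists_eq_add_of_le hk
    rw [Nat.add_sub_cancel_left, pow_add]; ring
  have m1 := pow_le_pow_left₀ (mom_nonneg μ₁ 1) hG₁.hi (k - 1)
  have m2 := pow_le_pow_left₀ (mom_nonneg μ₁ 1) hG₁.hi (k - 2)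
  have m3 := pow_le_pow_left₀ (mom_nonneg μ₀ 1) hG₀.hi (k - 2)
  rw [e1] at m1
  rw [e2] at m2 m3
  have hD0 := (abs_nonneg _).trans hD
  calc _ ≤ _ := abs_intens_sub_le hL hα₀ μ₀ μ₁ 1
    _ ≤ k / 2 * |α₁ - α₀| * (2 * (1 / 2) ^ k) +
        α₀ * k / 2 * (k * (4 * (1 / 2) ^ k + 4 * (1 / 2) ^ k) * D) := by
        gcongr
    _ = k * (1 / 2) ^ k * |α₁ - α₀| + 8 * k * D * (α₀ * k / 2 * (1 / 2) ^ k) := by ring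
    _ ≤ k * (1 / 2) ^ k * |α₁ - α₀| + 8 * k * D * (k / 2) := by gcongr
    _ = _ := by ring

theorem tsum_abs_intens_sub_le {D : ℝ} (hD : ∀ m, |mom μ₁ m - mom μ₀ m| ≤ D) :
    ∑' j, |intens k α₁ μ₁ (j + 2) - intens k α₀ μ₀ (j + 2)| ≤
      2048 * (k * ((1 / 2) ^ k) ^ 2) * |α₁ - α₀| + 4096 * ((k : ℝ) ^ 2 * (1 / 2) ^ k) * D := by
  have h0 := (density_pos hL hα₀).le
  have hk := hL.two_le
  have hk1000 := hL.thousand_le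
  have hr := rate_mul_half_pow_le hL hα₀
  have hD0 := (abs_nonneg _).trans (hD 0)
  have s1 : Summable fun j => mom μ₁ (j + 2) ^ (k - 1) :=
    (summable_nat_add_iff (f := fun j => mom μ₁ j ^ (k - 1)) 2).2
      (summable_mom_pow hG₁.summable (by omega))
  have s2 : Summable fun j => mom μ₁ (j + 2) ^ (k - 2) :=
    (summable_nat_add_iff (f := fun j => mom μ₁ j ^ (k - 2)) 2).2
      (summable_mom_pow hG₁.summable (by omega))
  have s3 : Summable fun j => mom μ₀ (j + 2) ^ (k - 2) :=
    (summable_nat_add_iff (f := fun j => mom μ₀ j ^ (k - 2)) 2).2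
      (summable_mom_pow hG₀.summable (by omega))
  have hs : Summable fun j => |intens k α₁ μ₁ (j + 2) - intens k α₀ μ₀ (j + 2)| :=
    (summable_nat_add_iff (f := fun j => |intens k α₁ μ₁ j - intens k α₀ μ₀ j|) 2).2
      (summable_abs_intens_sub hk hG₀.summable hG₁.summable)
  have sb := (s1.mul_left (k / 2 * |α₁ - α₀|)).add
    ((s2.add s3).mul_left (α₀ * k / 2 * k * D))
  have t1 := hG₁.tsum_mom_pow_le hL (n := k - 1) (by omega)
  have t2 := hG₁.tsum_mom_pow_le hL (n := k - 2) (by omega)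
  have t3 := hG₀.tsum_mom_pow_le hL (n := k - 2) (by omega)
  calc _ ≤ ∑' j, (k / 2 * |α₁ - α₀| * mom μ₁ (j + 2) ^ (k - 1) +
        α₀ * k / 2 * k * D * (mom μ₁ (j + 2) ^ (k - 2) + mom μ₀ (j + 2) ^ (k - 2))) := by
        refine Summable.tsum_le_tsum (fun j => ?_) hs sb
        refine (abs_intens_sub_le hL hα₀ μ₀ μ₁ (j + 2)).trans (add_le_add le_rfl ?_)
        have hp : 0 ≤ mom μ₁ (j + 2) ^ (k - 2) + mom μ₀ (j + 2) ^ (k - 2) :=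
          add_nonneg (pow_nonneg (mom_nonneg _ _) _) (pow_nonneg (mom_nonneg _ _) _)
        calc _ ≤ α₀ * k / 2 * (k * (mom μ₁ (j + 2) ^ (k - 2) + mom μ₀ (j + 2) ^ (k - 2)) * D) := by
              gcongr
              exact hD _
          _ = _ := by ring
    _ = k / 2 * |α₁ - α₀| * ∑' j, mom μ₁ (j + 2) ^ (k - 1) +
        α₀ * k / 2 * k * D * (∑' j, mom μ₁ (j + 2) ^ (k - 2) + ∑' j, mom μ₀ (j + 2) ^ (k - 2)) := by
        rw [Summable.tsum_add (s1.mul_left _) ((s2.add s3).mul_left _), tsum_mul_left,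
          tsum_mul_left, s2.tsum_add s3]
    _ ≤ k / 2 * |α₁ - α₀| * (4096 * ((1 / 2) ^ k) ^ 2) +
        α₀ * k / 2 * k * D * (4096 * ((1 / 2) ^ k) ^ 2 + 4096 * ((1 / 2) ^ k) ^ 2) := by gcongr
    _ = 2048 * (k * ((1 / 2) ^ k) ^ 2) * |α₁ - α₀| +
        8192 * k * D * (1 / 2) ^ k * (α₀ * k / 2 * (1 / 2) ^ k) := by ring
    _ ≤ 2048 * (k * ((1 / 2) ^ k) ^ 2) * |α₁ - α₀| + 8192 * k * D * (1 / 2) ^ k * (k / 2) := by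
        gcongr
    _ = _ := by ring

/-- The first moment has its own bound `D₁`, because the comparison of μ_α with δ_{1/2} has a much
sharper bound for it than for the others. For `ℓ` equal to (k-1) log 2 the factor exp(-ℓ) is
2·2^{-k}. -/
theorem gap_le {D₁ D : ℝ} (hD₁ : |mom μ₁ 1 - mom μ₀ 1| ≤ D₁)
    (hD : ∀ m, |mom μ₁ m - mom μ₀ m| ≤ D) :
    gap k (((k : ℝ) - 1) * Real.log 2) α₀ μ₀ α₁ μ₁ ≤
      4098 * (k * ((1 / 2) ^ k) ^ 2) * |α₁ - α₀| + 8 * ((k : ℝ) ^ 2 * (1 / 2) ^ k) * D₁ +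
        8192 * ((k : ℝ) ^ 2 * (1 / 2) ^ k) * D := by
  have h1 := abs_intens_one_sub_le hL hα₀ hG₀ hG₁ (α₁ := α₁) hD₁
  have h2 := tsum_abs_intens_sub_le hL hα₀ hG₀ hG₁ (α₁ := α₁) hD
  have e : Real.exp (-(((k : ℝ) - 1) * Real.log 2)) = 2 * (1 / 2) ^ k := by
    rw [show -(((k : ℝ) - 1) * Real.log 2) = Real.log (2 * (1 / 2 : ℝ) ^ k) by
      rw [Real.log_mul (by norm_num) (by positivity), Real.log_pow, one_div, Real.log_inv]; ring,
      Real.exp_log (by positivity)]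
  unfold gap
  rw [e]
  calc _ ≤ (k * (1 / 2) ^ k * |α₁ - α₀| + 4 * (k : ℝ) ^ 2 * D₁) * (2 * (1 / 2) ^ k) +
        2 * (2048 * (k * ((1 / 2) ^ k) ^ 2) * |α₁ - α₀| +
          4096 * ((k : ℝ) ^ 2 * (1 / 2) ^ k) * D) := by gcongr
    _ = _ := by ring

theorem tsum_abs_intens_sub_div_le {D₁ D : ℝ} (hD₁ : |mom μ₁ 1 - mom μ₀ 1| ≤ D₁)
    (hD : ∀ m, |mom μ₁ m - mom μ₀ m| ≤ D) :
    ∑' j : ℕ, |(intens k α₁ μ₁ j - intens k α₀ μ₀ j) / j| ≤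
      k * (1 / 2) ^ k * |α₁ - α₀| + 4 * (k : ℝ) ^ 2 * D₁ +
        (2048 * (k * ((1 / 2) ^ k) ^ 2) * |α₁ - α₀| + 4096 * ((k : ℝ) ^ 2 * (1 / 2) ^ k) * D) := by
  have hk := hL.two_le
  have h1 := abs_intens_one_sub_le hL hα₀ hG₀ hG₁ (α₁ := α₁) hD₁
  have h2 := tsum_abs_intens_sub_le hL hα₀ hG₀ hG₁ (α₁ := α₁) hD
  have hs : Summable fun j => |intens k α₁ μ₁ (j + 2) - intens k α₀ μ₀ (j + 2)| :=
    (summable_nat_add_iff (f := fun j => |intens k α₁ μ₁ j - intens k α₀ μ₀ j|) 2).2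
      (summable_abs_intens_sub hk hG₀.summable hG₁.summable)
  have hb : ∀ j : ℕ, |(intens k α₁ μ₁ j - intens k α₀ μ₀ j) / j| ≤
      |intens k α₁ μ₁ j - intens k α₀ μ₀ j| := fun j => abs_div_nat_le _ _
  have hsd : Summable fun j : ℕ => |(intens k α₁ μ₁ j - intens k α₀ μ₀ j) / j| :=
    (summable_abs_intens_sub hk hG₀.summable hG₁.summable).of_nonneg_of_le
      (fun j => abs_nonneg _) hb
  rw [← hsd.sum_add_tsum_nat_add 2]
  refine add_le_add ?_ (le_trans ?_ h2)
  · simpa [Finset.sum_range_succ] using h1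
  · exact Summable.tsum_le_tsum (fun j => hb _)
      ((summable_nat_add_iff (f := fun j : ℕ =>
        |(intens k α₁ μ₁ j - intens k α₀ μ₀ j) / j|) 2).2 hsd) hs

include hα₁

theorem abs_mom_recursion_sub_le_of_good {D : ℝ} (hD : ∀ m, |mom μ₁ m - mom μ₀ m| ≤ D) (m : ℕ) :
    |mom (recursion k α₁ μ₁) m - mom (recursion k α₀ μ₀) m| ≤
      4098 * (k * ((1 / 2) ^ k) ^ 2) * |α₁ - α₀| + 1 / 2 * D := by
  have hD0 := (abs_nonneg _).trans (hD 0)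
  have h := hL.pow_mul_half_pow_le (i := 2) (by norm_num)
  have h1 := abs_mom_recursion_sub_le hL.two_le (density_pos hL hα₀).le (density_pos hL hα₁).le
    hG₀.summable hG₁.summable (le_intens_one hL hα₀ hG₀) (le_intens_one hL hα₁ hG₁) m
  have h2 := gap_le hL hα₀ hG₀ hG₁ (α₁ := α₁) (hD 1) hD
  -- Here 8200 = 8 + 8192, from `gap_le` with `D₁ = D`.
  have h3 : 8200 * ((k : ℝ) ^ 2 * (1 / 2) ^ k) * D ≤ 1 / 2 * D := by
    gcongr
    linarith
  linarith

end Contraction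

/-! ### Convergence of the iteration and the fixed point -/

section Limit

theorem continuous_mom (m : ℕ) : Continuous fun μ => mom μ m :=
  ProbabilityMeasure.continuous_integral_continuousMap
    (⟨fun x : unitInterval => (x : ℝ) ^ m, by fun_prop⟩ : C(unitInterval, ℝ))

theorem integral_polynomial (μ : ProbabilityMeasure unitInterval) (p : Polynomial ℝ) :
    ∫ x : unitInterval, p.eval (x : ℝ) ∂(μ : Measure unitInterval) =
      ∑ i ∈ Finset.range (p.natDegree + 1), p.coeff i * mom μ i := by
  simp only [Polynomial.eval_eq_sum_range]
  rw [integral_finsetSum _ fun i _ => (integrable_unitInterval_pow μ i).const_mul _]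
  simp only [integral_const_mul, mom]

/-- Probability measures on `[0,1]` are determined by their moments. -/
theorem eq_of_forall_mom_eq {μ ν : ProbabilityMeasure unitInterval}
    (h : ∀ m, mom μ m = mom ν m) : μ = ν := by
  have hp : ∀ p : Polynomial ℝ, ∫ x : unitInterval, p.eval (x : ℝ) ∂(μ : Measure unitInterval) =
      ∫ x : unitInterval, p.eval (x : ℝ) ∂(ν : Measure unitInterval) := fun p => by
    rw [integral_polynomial, integral_polynomial]
    simp only [h]
  refine Subtype.ext (?_ : (μ : Measure unitInterval) = (ν : Measure unitInterval))
  refine ext_of_forall_integral_eq_of_IsFiniteMeasure fun f => ?_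
  have hcont : ∀ ρ : ProbabilityMeasure unitInterval, Continuous fun g : C(unitInterval, ℝ) =>
      ∫ x, g x ∂(ρ : Measure unitInterval) := by
    intro ρ
    have hi : ∀ g : C(unitInterval, ℝ), Integrable (fun x => g x) (ρ : Measure unitInterval) :=
      fun g => Integrable.of_bound g.continuous.measurable.aestronglyMeasurable ‖g‖
        (ae_of_all _ fun x => g.norm_coe_le_norm x)
    refine LipschitzWith.continuous (K := 1) (LipschitzWith.of_dist_le_mul fun g g' => ?_)
    rw [Real.dist_eq, ← integral_sub (hi g) (hi g'), NNReal.coe_one, one_mul, dist_eq_norm]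
    have := norm_integral_le_of_norm_le_const (μ := (ρ : Measure unitInterval))
      (f := fun x => g x - g' x) (C := ‖g - g'‖) (ae_of_all _ fun x =>
        (g - g').norm_coe_le_norm x)
    simpa using this
  have hd : f.toContinuousMap ∈ closure
      ((polynomialFunctions unitInterval : Subalgebra ℝ C(unitInterval, ℝ)) :
        Set C(unitInterval, ℝ)) := by
    rw [← Subalgebra.topologicalClosure_coe, polynomialFunctions_closure_eq_top']
    trivial
  have hcl := isClosed_eq (hcont μ) (hcont ν)
  refine closure_minimal ?_ hcl hd
  rintro _ ⟨p, -, rfl⟩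
  exact hp p

variable {k : ℕ} (hL : Large k) {α : ℝ} (hα : α ∈ Set.Icc (lbd k) (ubd k))

theorem isClosed_good (k : ℕ) : IsClosed {μ | Good k μ} := by
  have c1 := continuous_mom 1
  have c2 := continuous_mom 2
  have e : {μ | Good k μ} = {μ | 1 / 2 - (1 / 2) ^ k ≤ mom μ 1} ∩ {μ | mom μ 1 ≤ 1 / 2} ∩
      {μ | mom μ 2 - mom μ 1 + 1 / 4 ≤ 1 / (k : ℝ) ^ 4} ∩
      ⋂ J, {μ | ∑ j ∈ Finset.range J, mom μ j ≤ 2 ^ (k + 1)} := by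
    ext μ
    simp only [Set.mem_inter_iff, Set.mem_iInter, Set.mem_ofPred_eq]
    exact ⟨fun h => ⟨⟨⟨h.lo, h.hi⟩, h.var⟩, h.inv⟩, fun h => ⟨h.1.1.1, h.1.1.2, h.1.2, h.2⟩⟩
  rw [e]
  refine (((isClosed_le continuous_const c1).inter (isClosed_le c1 continuous_const)).inter
    (isClosed_le (by fun_prop) continuous_const)).inter (isClosed_iInter fun J => ?_)
  exact isClosed_le (continuous_finsetSum _ fun j _ => continuous_mom j) continuous_const

include hL hα

theorem abs_mom_iter_succ_sub_le (ℓ m : ℕ) :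
    |mom (iter k α (ℓ + 1)) m - mom (iter k α ℓ) m| ≤ 1 * (1 / 2) ^ ℓ := by
  induction ℓ generalizing m with
  | zero =>
    rw [pow_zero, mul_one, abs_le]
    constructor <;> linarith [mom_nonneg (iter k α 1) m, mom_le_one (iter k α 1) m,
      mom_nonneg (iter k α 0) m, mom_le_one (iter k α 0) m]
  | succ ℓ ih =>
    have := abs_mom_recursion_sub_le_of_good hL hα hα (good_iter hL hα ℓ)
      (good_iter hL hα (ℓ + 1)) ih m
    rw [sub_self, abs_zero, mul_zero, zero_add] at this
    refine this.trans_eq ?_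
    rw [pow_succ]; ring

theorem exists_tendsto_mom_iter (m : ℕ) :
    ∃ x, Tendsto (fun ℓ => mom (iter k α ℓ) m) atTop (𝓝 x) := by
  refine cauchySeq_tendsto_of_complete (cauchySeq_of_le_geometric (1 / 2) 1 (by norm_num) fun ℓ => ?_)
  rw [dist_comm, Real.dist_eq]
  exact abs_mom_iter_succ_sub_le hL hα ℓ m

/-- Probability measures on [0,1] form a compact space. Each moment converges along the iteration,
so all cluster points share their moments and coincide. -/
theorem tendsto_iter : Tendsto (iter k α) atTop (𝓝 (fixedPt k α)) := by
  choose x hx using exists_tendsto_mom_iter hL hα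
  have hcl : ∀ ν, MapClusterPt ν atTop (iter k α) → ∀ m, mom ν m = x m := by
    intro ν hν m
    have h1 : MapClusterPt (mom ν m) atTop fun ℓ => mom (iter k α ℓ) m :=
      hν.continuousAt_comp (continuous_mom m).continuousAt
    have : NeBot (𝓝 (mom ν m) ⊓ 𝓝 (x m)) := h1.neBot.mono (inf_le_inf_left _ (hx m))
    exact eq_of_nhds_neBot this
  obtain ⟨ν, hν⟩ := exists_clusterPt_of_compactSpace (map (iter k α) atTop)
  have ht : Tendsto (iter k α) atTop (𝓝 ν) :=
    tendsto_nhds_of_unique_mapClusterPt fun ν' hν' =>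
      eq_of_forall_mom_eq fun m => by rw [hcl ν' hν' m, hcl ν hν m]
  exact tendsto_nhds_limUnder ⟨ν, ht⟩

theorem tendsto_mom_iter (m : ℕ) :
    Tendsto (fun ℓ => mom (iter k α ℓ) m) atTop (𝓝 (mom (fixedPt k α) m)) :=
  ((continuous_mom m).tendsto _).comp (tendsto_iter hL hα)

theorem good_fixedPt : Good k (fixedPt k α) :=
  (isClosed_good k).mem_of_tendsto (tendsto_iter hL hα) (Eventually.of_forall (good_iter hL hα))

theorem abs_mom_iter_sub_fixedPt_le (ℓ m : ℕ) :
    |mom (fixedPt k α) m - mom (iter k α ℓ) m| ≤ 2 * (1 / 2) ^ ℓ := by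
  have := dist_le_of_le_geometric_of_tendsto (1 / 2) 1 (by norm_num)
    (f := fun ℓ => mom (iter k α ℓ) m)
    (fun ℓ => by rw [dist_comm, Real.dist_eq]; exact abs_mom_iter_succ_sub_le hL hα ℓ m)
    (tendsto_mom_iter hL hα m) ℓ
  rw [dist_comm, Real.dist_eq] at this
  refine this.trans_eq ?_
  ring

/-- The contraction estimate gives continuity of the recursion along the iterates, in the sense of
moments, so weak continuity of 𝐑 is not needed. -/
theorem recursion_fixedPt : recursion k α (fixedPt k α) = fixedPt k α := by
  refine eq_of_forall_mom_eq fun m => ?_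
  have h0 : Tendsto (fun ℓ : ℕ => (1 / 2 : ℝ) * (2 * (1 / 2) ^ ℓ)) atTop (𝓝 0) := by
    have := ((tendsto_pow_atTop_nhds_zero_of_lt_one (r := (1 / 2 : ℝ)) (by norm_num)
      (by norm_num)).const_mul 2).const_mul (1 / 2)
    rwa [mul_zero, mul_zero] at this
  have h1 : Tendsto (fun ℓ => mom (iter k α (ℓ + 1)) m) atTop
      (𝓝 (mom (recursion k α (fixedPt k α)) m)) := by
    refine tendsto_iff_dist_tendsto_zero.2 (squeeze_zero (fun _ => dist_nonneg) (fun ℓ => ?_) h0)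
    rw [dist_comm, Real.dist_eq]
    have := abs_mom_recursion_sub_le_of_good hL hα hα (good_iter hL hα ℓ) (good_fixedPt hL hα)
      (abs_mom_iter_sub_fixedPt_le hL hα ℓ) m
    rwa [sub_self, abs_zero, mul_zero, zero_add] at this
  exact tendsto_nhds_unique h1 ((tendsto_add_atTop_iff_nat 1).2 (tendsto_mom_iter hL hα m))

end Limit

/-- The moments of the fixed points depend on the density in a Lipschitz way. -/
theorem abs_mom_fixedPt_sub_le {k : ℕ} (hL : Large k) {α₀ α₁ : ℝ}
    (hα₀ : α₀ ∈ Set.Icc (lbd k) (ubd k)) (hα₁ : α₁ ∈ Set.Icc (lbd k) (ubd k)) (m : ℕ) :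
    |mom (fixedPt k α₁) m - mom (fixedPt k α₀) m| ≤
      8196 * (k * ((1 / 2) ^ k) ^ 2) * |α₁ - α₀| := by
  set f : ℕ → ℝ := fun m => |mom (fixedPt k α₁) m - mom (fixedPt k α₀) m| with hf
  have hb : BddAbove (Set.range f) := by
    refine ⟨1, ?_⟩
    rintro _ ⟨m, rfl⟩
    rw [hf, abs_le]
    constructor <;> linarith [mom_nonneg (fixedPt k α₁) m, mom_le_one (fixedPt k α₁) m,
      mom_nonneg (fixedPt k α₀) m, mom_le_one (fixedPt k α₀) m]
  -- The supremum of the moment differences reappears on the right with factor 1/2. Absorbing it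
  -- doubles 4098 to 8196.
  have h1 : ∀ m, f m ≤ 4098 * (k * ((1 / 2) ^ k) ^ 2) * |α₁ - α₀| + 1 / 2 * ⨆ m, f m := by
    intro m
    have := abs_mom_recursion_sub_le_of_good hL hα₀ hα₁ (good_fixedPt hL hα₀)
      (good_fixedPt hL hα₁) (fun m => le_ciSup hb m) m
    rwa [recursion_fixedPt hL hα₀, recursion_fixedPt hL hα₁] at this
  have h2 := ciSup_le h1
  have h3 := le_ciSup hb m
  linarith

/-! ### The clause term of the free energy -/

section Clause

variable {k : ℕ} {μ : ProbabilityMeasure unitInterval} {α : ℝ}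

/-- The clause weight has k factors, whereas `clauseLaw k` has k-1; hence the shift to `k + 1`. -/
theorem map_prod_inl (k : ℕ) (α : ℝ) (μ : ProbabilityMeasure unitInterval) :
    (law k α μ).map (fun ω => ∏ j ∈ Finset.range k, (ω.2 (Sum.inl j) : ℝ)) =
      clauseLaw (k + 1) μ := by
  have h1 : (law k α μ).map Prod.snd =
      Measure.infinitePi fun _ : Idx => (μ : Measure unitInterval) :=
    measurePreserving_snd.map_eq
  have h2 := Measure.map_infinitePi_infinitePi_of_inj
    (P := fun _ : Idx => (μ : Measure unitInterval)) (f := (Sum.inl : ℕ → Idx))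
    Sum.inl_injective
  rw [clauseLaw, Nat.add_sub_cancel, ← h2, ← h1,
    Measure.map_map (by fun_prop) (by fun_prop), Measure.map_map (by fun_prop) (by fun_prop)]
  rfl

theorem measurable_prod_inl (k : ℕ) :
    Measurable fun ω : Sample => ∏ j ∈ Finset.range k, (ω.2 (Sum.inl j) : ℝ) := by fun_prop

theorem ae_clauseWeight_pos (hk : 2 ≤ k) (h : Summable (mom μ)) (α : ℝ) :
    ∀ᵐ ω ∂(law k α μ), 0 < clauseWeight k ω := by
  filter_upwards [ae_law_lt_one (k := k) α (ae_lt_one_of_summable_mom h)] with ω hω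
  have := prod_range_lt_one (n := k) (by omega) (fun j => ω.2 (Sum.inl j)) (hω _)
  unfold clauseWeight
  linarith

theorem abs_log_one_sub_le {u : ℝ} (hu : u ∈ Set.Ico (0 : ℝ) 1) :
    |Real.log (1 - u)| ≤ (1 - u)⁻¹ := by
  have h0 : 0 < 1 - u := by linarith [hu.2]
  have h1 := Real.one_sub_inv_le_log_of_pos h0
  have h2 := Real.log_nonpos h0.le (by linarith [hu.1])
  rw [abs_of_nonpos h2]
  linarith

theorem integrable_log_clauseWeight (hk : 2 ≤ k) (h : Summable (mom μ)) (α : ℝ) :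
    Integrable (fun ω => Real.log (clauseWeight k ω)) (law k α μ) := by
  have h1 : Integrable (fun u => Real.log (1 - u)) (clauseLaw (k + 1) μ) := by
    refine (integrable_inv_one_sub_clauseLaw (by omega) h).mono'
      (Measurable.aestronglyMeasurable (by fun_prop)) ?_
    filter_upwards [ae_clauseLaw_mem (k := k + 1) (by omega) (ae_lt_one_of_summable_mom h)]
      with u hu
    exact abs_log_one_sub_le hu
  rw [← map_prod_inl k α μ] at h1
  exact h1.comp_measurable (measurable_prod_inl k)

theorem abs_neg_one_div_nat_le (j : ℕ) : |-(1 / (j : ℝ))| ≤ 1 := by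
  rw [abs_neg]
  exact (abs_div_nat_le 1 j).trans (by simp)

theorem hasSum_integral_log_clauseWeight (hk : 2 ≤ k) (h : Summable (mom μ)) (α : ℝ) :
    HasSum (fun j : ℕ => -(1 / (j : ℝ)) * mom μ j ^ k)
      (∫ ω, Real.log (clauseWeight k ω) ∂(law k α μ)) := by
  have h1 := hasSum_integral_clauseLaw (k := k + 1) (by omega) h
    (c := fun j : ℕ => -(1 / (j : ℝ))) (C := 1) abs_neg_one_div_nat_le
    (f := fun u => Real.log (1 - u))
    (fun u hu => (hasSum_neg_pow_div u hu.1 hu.2).congr_fun fun j => by ring)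
  rw [← map_prod_inl k α μ, integral_map (measurable_prod_inl k).aemeasurable
    (Measurable.aestronglyMeasurable (by fun_prop))] at h1
  exact h1

end Clause

/-! ### The free energy as a functional of the density and the law -/

/-- The free energy functional evaluated at an arbitrary law. -/
def freeEnergy (k : ℕ) (α : ℝ) (μ : ProbabilityMeasure unitInterval) : ℝ :=
  ∫ ω, Real.log (sF (logPair k ω)) ∂(law k α μ) +
    -- The series is the mean of -log(1 - ∏ η_j), with no contribution from j = 0 since division by
    -- zero gives 0.
    α * ((k : ℝ) - 1) * ∑' j : ℕ, mom μ j ^ k / j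

section FreeEnergy

variable {k : ℕ} {μ : ProbabilityMeasure unitInterval} {α : ℝ}

theorem ae_weights_pos (hk : 2 ≤ k) (h : Summable (mom μ)) (α : ℝ) :
    ∀ᵐ ω ∂(law k α μ), 0 < siteWeight k ω ∧ 0 < clauseWeight k ω := by
  filter_upwards [ae_clauseWeight_pos hk h α,
    ae_law_siteWeight hk α (ae_lt_one_of_summable_mom h)] with ω h1 h2
  exact ⟨h2.1 ▸ sF_pos _, h1⟩

theorem ae_logWeight_eq (hk : 2 ≤ k) (h : Summable (mom μ)) (α : ℝ) :
    logWeight k α =ᵐ[law k α μ] fun ω => Real.log (sF (logPair k ω)) -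
      α * ((k : ℝ) - 1) * Real.log (clauseWeight k ω) := by
  filter_upwards [ae_clauseWeight_pos hk h α,
    ae_law_siteWeight hk α (ae_lt_one_of_summable_mom h)] with ω h1 h2
  rw [logWeight, h2.1, Real.log_div (sF_pos _).ne' (Real.rpow_pos_of_pos h1 _).ne',
    Real.log_rpow h1]

theorem integrable_logWeight (hk : 2 ≤ k) (hα : 0 ≤ α) (h : Summable (mom μ)) :
    Integrable (logWeight k α) (law k α μ) :=
  ((integrable_log_sF hk hα h).sub ((integrable_log_clauseWeight hk h α).const_mul _)).congr
    (ae_logWeight_eq hk h α).symm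

theorem integral_logWeight (hk : 2 ≤ k) (hα : 0 ≤ α) (h : Summable (mom μ)) :
    ∫ ω, logWeight k α ω ∂(law k α μ) = freeEnergy k α μ := by
  rw [integral_congr_ae (ae_logWeight_eq hk h α), integral_sub (integrable_log_sF hk hα h)
    ((integrable_log_clauseWeight hk h α).const_mul _), integral_const_mul, freeEnergy,
    ← (hasSum_integral_log_clauseWeight hk h α).tsum_eq, sub_eq_add_neg, ← mul_neg, ← tsum_neg]
  congr 3
  ext j
  ring

theorem summable_mom_pow_div (h : Summable (mom μ)) {n : ℕ} (hn : n ≠ 0) :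
    Summable fun j : ℕ => mom μ j ^ n / j := by
  refine (summable_mom_pow h hn).of_norm_bounded fun j => ?_
  refine (abs_div_nat_le _ _).trans_eq ?_
  rw [abs_of_nonneg (pow_nonneg (mom_nonneg _ _) _)]

end FreeEnergy

/-- With N = n+2 the left side is the Taylor remainder y^N - x^N - N x^{N-1}(y-x). The next
remainder equals x times this one plus (x-y)(x^N - y^N), so it stays quadratic in x-y. -/
theorem abs_pow_bregman_le {x y : ℝ} (hx : 0 ≤ x) (hy : 0 ≤ y) (n : ℕ) :
    |((n : ℝ) + 1) * x ^ (n + 2) - (n + 2) * x ^ (n + 1) * y + y ^ (n + 2)| ≤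
      (n + 2) ^ 2 * max x y ^ n * (x - y) ^ 2 := by
  induction n with
  | zero =>
    have e : ((0 : ℕ) + 1 : ℝ) * x ^ (0 + 2) - ((0 : ℕ) + 2) * x ^ (0 + 1) * y + y ^ (0 + 2) =
      (x - y) ^ 2 := by push_cast; ring
    rw [e, abs_of_nonneg (sq_nonneg _)]
    push_cast
    nlinarith [sq_nonneg (x - y)]
  | succ n ih =>
    have e : ((n + 1 : ℕ) + 1 : ℝ) * x ^ (n + 1 + 2) - ((n + 1 : ℕ) + 2) * x ^ (n + 1 + 1) * y +
        y ^ (n + 1 + 2) =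
        x * (((n : ℝ) + 1) * x ^ (n + 2) - (n + 2) * x ^ (n + 1) * y + y ^ (n + 2)) +
          (x - y) * (x ^ (n + 2) - y ^ (n + 2)) := by push_cast; ring
    have h := abs_pow_sub_pow_le (a := x) (b := y) (n + 2)
    rw [abs_of_nonneg hx, abs_of_nonneg hy, show n + 2 - 1 = n + 1 by omega] at h
    rw [e]
    have hm : 0 ≤ max x y := hx.trans (le_max_left _ _)
    calc _ ≤ |x * (((n : ℝ) + 1) * x ^ (n + 2) - (n + 2) * x ^ (n + 1) * y + y ^ (n + 2))| +
          |(x - y) * (x ^ (n + 2) - y ^ (n + 2))| := abs_add_le _ _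
      _ ≤ max x y * ((n + 2) ^ 2 * max x y ^ n * (x - y) ^ 2) +
          |x - y| * (|x - y| * (n + 2 : ℕ) * max x y ^ (n + 1)) := by
          rw [abs_mul, abs_mul, abs_of_nonneg hx]
          gcongr
          exact le_max_left _ _
      _ = ((n + 2) ^ 2 + (n + 2)) * (max x y ^ (n + 1) * (x - y) ^ 2) := by
          rw [← sq_abs (x - y)]; push_cast; ring
      _ ≤ ((n + 1 : ℕ) + 2) ^ 2 * (max x y ^ (n + 1) * (x - y) ^ 2) := by
          gcongr
          push_cast
          nlinarith [Nat.cast_nonneg (α := ℝ) n]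
      _ = _ := by ring

/-! ### Stationarity of the free energy at fixed points -/

section Comparison

variable {k : ℕ} (hL : Large k) {α₀ α₁ : ℝ} (hα₀ : α₀ ∈ Set.Icc (lbd k) (ubd k))
  (hα₁ : α₁ ∈ Set.Icc (lbd k) (ubd k)) {μ₀ μ₁ : ProbabilityMeasure unitInterval}
  (hG₀ : Good k μ₀) (hG₁ : Good k μ₁)
include hL hα₀ hG₀ hG₁

-- The index 0 vanishes, the index 1 is of order 2^{-k} and sees only `D₁`, and the indices from 2
-- on have total weight O(4^{-k}) by `tsum_mom_pow_le`.
omit hα₀ in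
theorem tsum_bregman_le {D₁ D : ℝ} (hD₁ : |mom μ₁ 1 - mom μ₀ 1| ≤ D₁)
    (hD : ∀ m, |mom μ₁ m - mom μ₀ m| ≤ D) :
    Summable (fun j : ℕ => (((k : ℝ) - 1) * mom μ₁ j ^ k - k * mom μ₁ j ^ (k - 1) * mom μ₀ j +
      mom μ₀ j ^ k) / j) ∧
    |∑' j : ℕ, (((k : ℝ) - 1) * mom μ₁ j ^ k - k * mom μ₁ j ^ (k - 1) * mom μ₀ j +
      mom μ₀ j ^ k) / j| ≤
      8 * (1 / 2) ^ k * ((k : ℝ) ^ 2 * D₁ ^ 2) +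
        8192 * ((1 / 2) ^ k) ^ 2 * ((k : ℝ) ^ 2 * D ^ 2) := by
  have hk := hL.two_le
  have hk1000 := hL.thousand_le
  set B : ℕ → ℝ := fun j => ((k : ℝ) - 1) * mom μ₁ j ^ k - k * mom μ₁ j ^ (k - 1) * mom μ₀ j +
      mom μ₀ j ^ k with hBdef
  have hB : ∀ j, |B j| ≤ (k : ℝ) ^ 2 * (mom μ₁ j ^ (k - 2) + mom μ₀ j ^ (k - 2)) *
      |mom μ₁ j - mom μ₀ j| ^ 2 := by
    intro j
    have hx := mom_nonneg μ₁ j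
    have hy := mom_nonneg μ₀ j
    have h := abs_pow_bregman_le hx hy (k - 2)
    have e1 : k - 2 + 1 = k - 1 := by omega
    have e2 : k - 2 + 2 = k := by omega
    have e3 : ((k - 2 : ℕ) : ℝ) + 2 = k := by rw [Nat.cast_sub hk]; push_cast; ring
    have e4 : ((k - 2 : ℕ) : ℝ) + 1 = k - 1 := by rw [Nat.cast_sub hk]; push_cast; ring
    rw [e1, e2, e3, e4] at h
    rw [sq_abs]
    refine h.trans ?_
    gcongr
    rcases max_choice (mom μ₁ j) (mom μ₀ j) with h | h <;> rw [h] <;>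
      linarith [pow_nonneg hx (k - 2), pow_nonneg hy (k - 2)]
  have hBd : ∀ j : ℕ, |B j / j| ≤ |B j| := fun j => abs_div_nat_le _ _
  have hD0 := (abs_nonneg _).trans (hD 0)
  have s2 := summable_mom_pow hG₁.summable (n := k - 2) (by omega)
  have s3 := summable_mom_pow hG₀.summable (n := k - 2) (by omega)
  have hB2 : ∀ j, |B j / j| ≤ (k : ℝ) ^ 2 * D ^ 2 * (mom μ₁ j ^ (k - 2) + mom μ₀ j ^ (k - 2)) := by
    intro j
    refine (hBd j).trans ((hB j).trans ?_)
    have hp : 0 ≤ mom μ₁ j ^ (k - 2) + mom μ₀ j ^ (k - 2) :=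
      add_nonneg (pow_nonneg (mom_nonneg _ _) _) (pow_nonneg (mom_nonneg _ _) _)
    calc _ ≤ (k : ℝ) ^ 2 * (mom μ₁ j ^ (k - 2) + mom μ₀ j ^ (k - 2)) * D ^ 2 := by
          gcongr; exact hD j
      _ = _ := by ring
  have hs : Summable fun j : ℕ => |B j / j| :=
    ((s2.add s3).mul_left _).of_nonneg_of_le (fun j => abs_nonneg _) hB2
  refine ⟨hs.of_abs, ?_⟩
  have s2' : Summable fun j => mom μ₁ (j + 2) ^ (k - 2) :=
    (summable_nat_add_iff (f := fun j => mom μ₁ j ^ (k - 2)) 2).2 s2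
  have s3' : Summable fun j => mom μ₀ (j + 2) ^ (k - 2) :=
    (summable_nat_add_iff (f := fun j => mom μ₀ j ^ (k - 2)) 2).2 s3
  have t2 := hG₁.tsum_mom_pow_le hL (n := k - 2) (by omega)
  have t3 := hG₀.tsum_mom_pow_le hL (n := k - 2) (by omega)
  have h1 : |∑' j : ℕ, B j / j| ≤ ∑' j : ℕ, |B j / j| := by
    have := norm_tsum_le_tsum_norm (f := fun j : ℕ => B j / j) hs
    simpa only [Real.norm_eq_abs] using this
  refine h1.trans ?_
  rw [← hs.sum_add_tsum_nat_add 2]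
  refine add_le_add ?_ ?_
  · simp only [Finset.sum_range_succ, Finset.sum_range_zero, Nat.cast_zero, div_zero, abs_zero,
      zero_add, Nat.cast_one, div_one]
    have e2 : (1 / 2 : ℝ) ^ (k - 2) = 4 * (1 / 2) ^ k := by
      obtain ⟨m, rfl⟩ := Nat.exists_eq_add_of_le hk
      rw [Nat.add_sub_cancel_left, pow_add]; ring
    have m2 := pow_le_pow_left₀ (mom_nonneg μ₁ 1) hG₁.hi (k - 2)
    have m3 := pow_le_pow_left₀ (mom_nonneg μ₀ 1) hG₀.hi (k - 2)
    rw [e2] at m2 m3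
    calc _ ≤ _ := hB 1
      _ ≤ (k : ℝ) ^ 2 * (4 * (1 / 2) ^ k + 4 * (1 / 2) ^ k) * D₁ ^ 2 := by gcongr
      _ = _ := by ring
  · calc _ ≤ ∑' j, (k : ℝ) ^ 2 * D ^ 2 * (mom μ₁ (j + 2) ^ (k - 2) + mom μ₀ (j + 2) ^ (k - 2)) :=
        Summable.tsum_le_tsum (fun j => hB2 _)
          ((summable_nat_add_iff (f := fun j : ℕ => |B j / j|) 2).2 hs)
          ((s2'.add s3').mul_left _)
      _ = (k : ℝ) ^ 2 * D ^ 2 *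
          (∑' j, mom μ₁ (j + 2) ^ (k - 2) + ∑' j, mom μ₀ (j + 2) ^ (k - 2)) := by
          rw [tsum_mul_left, s2'.tsum_add s3']
      _ ≤ (k : ℝ) ^ 2 * D ^ 2 * (4096 * ((1 / 2) ^ k) ^ 2 + 4096 * ((1 / 2) ^ k) ^ 2) := by gcongr
      _ = _ := by ring

include hα₁

/-- Since μ₀ is a fixed point, the moments of 𝐑μ₀ in the first variation of the site term are those
of μ₀ itself, and this variation cancels that of the clause term. The errors left are the Taylor
remainders of x^k and the product of the intensity change with `gap`, both of second order. -/
theorem abs_freeEnergy_sub_le (hfix : recursion k α₀ μ₀ = μ₀) {D₁ D : ℝ}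
    (hD₁ : |mom μ₁ 1 - mom μ₀ 1| ≤ D₁) (hD : ∀ m, |mom μ₁ m - mom μ₀ m| ≤ D) :
    |freeEnergy k α₁ μ₁ - freeEnergy k α₀ μ₀ + (α₁ - α₀) * ∑' j : ℕ, mom μ₀ j ^ k / j| ≤
      8 * ((k : ℝ) ^ 2 * D₁ ^ 2) + 8192 * (1 / 2) ^ k * ((k : ℝ) ^ 2 * D ^ 2) +
      2 * (k * (1 / 2) ^ k * |α₁ - α₀| + 4 * (k : ℝ) ^ 2 * D₁ +
        (2048 * (k * ((1 / 2) ^ k) ^ 2) * |α₁ - α₀| + 4096 * ((k : ℝ) ^ 2 * (1 / 2) ^ k) * D)) *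
      (4098 * (k * ((1 / 2) ^ k) ^ 2) * |α₁ - α₀| + 8 * ((k : ℝ) ^ 2 * (1 / 2) ^ k) * D₁ +
        8192 * ((k : ℝ) ^ 2 * (1 / 2) ^ k) * D) := by
  have hk := hL.two_le
  have h0 := (density_pos hL hα₀).le
  have h1 := (density_pos hL hα₁).le
  have hm := abs_integral_log_sF_sub_le hk h0 h1 hG₀.summable hG₁.summable
    (le_intens_one hL hα₀ hG₀) (le_intens_one hL hα₁ hG₁)
  rw [hfix] at hm
  obtain ⟨hsB, hB⟩ := tsum_bregman_le hL hG₀ hG₁ hD₁ hD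
  have hT := tsum_abs_intens_sub_div_le hL hα₀ hG₀ hG₁ (α₁ := α₁) hD₁ hD
  have hg := gap_le hL hα₀ hG₀ hG₁ (α₁ := α₁) hD₁ hD
  have s1 := summable_mom_pow_div hG₁.summable (n := k) (by omega)
  have s0 := summable_mom_pow_div hG₀.summable (n := k) (by omega)
  have hsI : Summable fun j : ℕ =>
      (intens k α₁ μ₁ j - intens k α₀ μ₀ j) / j * mom μ₀ j := by
    refine (summable_abs_intens_sub hk hG₀.summable hG₁.summable (α₀ := α₀)
      (α₁ := α₁)).of_norm_bounded fun j => ?_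
    rw [norm_mul, Real.norm_eq_abs, Real.norm_of_nonneg (mom_nonneg _ _)]
    exact (mul_le_of_le_one_right (abs_nonneg _) (mom_le_one _ _)).trans (abs_div_nat_le _ _)
  -- As 2λ_j = αk m_j^{k-1}, all terms containing α₀ cancel, and those containing α₁ combine into
  -- the Taylor remainder.
  have key : (α₁ * ((k : ℝ) - 1) * ∑' j : ℕ, mom μ₁ j ^ k / j -
      α₀ * ((k : ℝ) - 1) * ∑' j : ℕ, mom μ₀ j ^ k / j) + (α₁ - α₀) * ∑' j : ℕ, mom μ₀ j ^ k / j -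
      2 * ∑' j : ℕ, (intens k α₁ μ₁ j - intens k α₀ μ₀ j) / j * mom μ₀ j =
      α₁ * ∑' j : ℕ, (((k : ℝ) - 1) * mom μ₁ j ^ k - k * mom μ₁ j ^ (k - 1) * mom μ₀ j +
      mom μ₀ j ^ k) / j := by
    have e := (((s1.hasSum.mul_left (α₁ * ((k : ℝ) - 1))).sub
      (s0.hasSum.mul_left (α₀ * ((k : ℝ) - 1)))).add (s0.hasSum.mul_left (α₁ - α₀))).sub
      (hsI.hasSum.mul_left 2)
    rw [← e.tsum_eq, ← tsum_mul_left]
    congr 1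
    ext j
    obtain ⟨n, rfl⟩ := Nat.exists_eq_add_of_le hk
    rw [intens, intens, show 2 + n - 1 = n + 1 by omega]
    push_cast
    ring
  have hr : α₁ * (1 / 2) ^ k ≤ 1 := by
    linarith [mul_half_pow_le_log hα₁, Real.log_two_lt_d9]
  have e : freeEnergy k α₁ μ₁ - freeEnergy k α₀ μ₀ + (α₁ - α₀) * ∑' j : ℕ, mom μ₀ j ^ k / j =
      α₁ * ∑' j : ℕ, (((k : ℝ) - 1) * mom μ₁ j ^ k - k * mom μ₁ j ^ (k - 1) * mom μ₀ j +
      mom μ₀ j ^ k) / j + (∫ ω, Real.log (sF (logPair k ω)) ∂(law k α₁ μ₁) -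
      ∫ ω, Real.log (sF (logPair k ω)) ∂(law k α₀ μ₀) +
      2 * ∑' j : ℕ, (intens k α₁ μ₁ j - intens k α₀ μ₀ j) / j * mom μ₀ j) := by
    rw [← key, freeEnergy, freeEnergy]; ring
  rw [e]
  refine (abs_add_le _ _).trans (add_le_add ?_ (hm.trans ?_))
  · rw [abs_mul, abs_of_nonneg h1]
    calc _ ≤ α₁ * (8 * (1 / 2) ^ k * ((k : ℝ) ^ 2 * D₁ ^ 2) +
        8192 * ((1 / 2) ^ k) ^ 2 * ((k : ℝ) ^ 2 * D ^ 2)) := by gcongr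
      _ = (α₁ * (1 / 2) ^ k) * (8 * ((k : ℝ) ^ 2 * D₁ ^ 2) +
          8192 * (1 / 2) ^ k * ((k : ℝ) ^ 2 * D ^ 2)) := by ring
      _ ≤ 1 * (8 * ((k : ℝ) ^ 2 * D₁ ^ 2) +
          8192 * (1 / 2) ^ k * ((k : ℝ) ^ 2 * D ^ 2)) := by gcongr
      _ = _ := one_mul _
  · have hg0 := gap_nonneg k (((k : ℝ) - 1) * Real.log 2) α₀ μ₀ α₁ μ₁
    have hT0 : 0 ≤ ∑' j : ℕ, |(intens k α₁ μ₁ j - intens k α₀ μ₀ j) / j| :=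
      tsum_nonneg fun j => abs_nonneg _
    exact mul_le_mul (mul_le_mul_of_nonneg_left hT zero_le_two) hg hg0
      (mul_nonneg zero_le_two (hT0.trans hT))

-- The term j = 1 is 2^{-k} up to a relative error 2k 2^{-k} by Bernoulli's inequality; the rest of
-- the series is O(4^{-k}).
omit hα₀ hα₁ hG₁ in
theorem abs_tsum_mom_pow_div_sub_le :
    |∑' j : ℕ, mom μ₀ j ^ k / j - (1 / 2) ^ k| ≤ 4100 * (k * (1 / 2) ^ k) * (1 / 2) ^ k := by
  have hk := hL.two_le
  have hk1 := hL.one_le_cast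
  have hs := summable_mom_pow_div hG₀.summable (n := k) (by omega)
  have hs2 := summable_mom_pow hG₀.summable (n := k) (by omega)
  have hp : 0 < (1 / 2 : ℝ) ^ k := by positivity
  have hp9 := hL.half_pow_le
  rw [← hs.sum_add_tsum_nat_add 2]
  simp only [Finset.sum_range_succ, Finset.sum_range_zero, Nat.cast_zero, div_zero,
      zero_add, Nat.cast_one, div_one]
  have h1 : mom μ₀ 1 ^ k ≤ (1 / 2) ^ k := pow_le_pow_left₀ (mom_nonneg _ _) hG₀.hi k
  have h2 : (1 / 2 : ℝ) ^ k - 2 * (k * (1 / 2) ^ k) * (1 / 2) ^ k ≤ mom μ₀ 1 ^ k := by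
    calc (1 / 2 : ℝ) ^ k - 2 * (k * (1 / 2) ^ k) * (1 / 2) ^ k
        = (1 / 2 : ℝ) ^ k * (1 + k * (-(2 * (1 / 2) ^ k))) := by ring
      _ ≤ (1 / 2 : ℝ) ^ k * (1 + -(2 * (1 / 2) ^ k)) ^ k := by
          gcongr
          exact one_add_mul_le_pow (by linarith) _
      _ = (1 / 2 - (1 / 2) ^ k) ^ k := by rw [← mul_pow]; congr 1; ring
      _ ≤ mom μ₀ 1 ^ k := pow_le_pow_left₀ (by linarith) hG₀.lo _
  have h3 : ∑' j : ℕ, mom μ₀ (j + 2) ^ k / ((j + 2 : ℕ) : ℝ) ≤ 4096 * ((1 / 2) ^ k) ^ 2 := by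
    refine le_trans (Summable.tsum_le_tsum (fun j => ?_)
      ((summable_nat_add_iff (f := fun j : ℕ => mom μ₀ j ^ k / j) 2).2 hs)
      ((summable_nat_add_iff (f := fun j => mom μ₀ j ^ k) 2).2 hs2))
      (hG₀.tsum_mom_pow_le hL (n := k) (by omega))
    refine div_le_self (pow_nonneg (mom_nonneg _ _) _) ?_
    push_cast
    linarith [Nat.cast_nonneg (α := ℝ) j]
  have h4 : 0 ≤ ∑' j : ℕ, mom μ₀ (j + 2) ^ k / ((j + 2 : ℕ) : ℝ) :=
    tsum_nonneg fun j => div_nonneg (pow_nonneg (mom_nonneg _ _) _) (Nat.cast_nonneg _)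
  have h5 : ((1 / 2 : ℝ) ^ k) ^ 2 ≤ (k * (1 / 2) ^ k) * (1 / 2) ^ k := by
    rw [sq]
    gcongr
    nlinarith
  have h6 : 0 ≤ (k * (1 / 2 : ℝ) ^ k) * (1 / 2) ^ k := by positivity
  rw [abs_le]
  constructor <;> linarith

end Comparison

/-! ### Decrease of Φ -/

section Phi

variable {k : ℕ} (hL : Large k) {α : ℝ} (hα : α ∈ Set.Icc (lbd k) (ubd k))
include hL hα

theorem Phi_eq : Phi k α = freeEnergy k α (fixedPt k α) :=
  integral_logWeight hL.two_le (density_pos hL hα).le (good_fixedPt hL hα).summable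

/-- The moments of the fixed points differ by O(k 4^{-k}|α'-α|), so the remainders are quadratic in
|α'-α|, and one such factor is at most 2. Three remainders of size k² 4^{-k}|α'-α| and five more
from replacing Σ_j m_j^k/j by 2^{-k} stay below the rate 2^{-k/4}. -/
theorem abs_Phi_sub_add_le {α' : ℝ} (hα' : α' ∈ Set.Icc (lbd k) (ubd k)) :
    |Phi k α' - Phi k α + (α' - α) * (1 / 2) ^ k| ≤
      (2 : ℝ) ^ (-(k : ℝ) / 4) * (|α' - α| * (1 / 2) ^ k) := by
  have hk1 := hL.one_le_cast
  have hG := good_fixedPt hL hα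
  have hG' := good_fixedPt hL hα'
  have hD := abs_mom_fixedPt_sub_le hL hα hα'
  have h1 := abs_freeEnergy_sub_le hL hα hα' hG hG' (recursion_fixedPt hL hα) (hD 1) hD
  have h2 := abs_tsum_mom_pow_div_sub_le hL hG
  rw [Phi_eq hL hα, Phi_eq hL hα']
  set F := freeEnergy k α' (fixedPt k α') - freeEnergy k α (fixedPt k α)
  set S := ∑' j : ℕ, mom (fixedPt k α) j ^ k / (j : ℝ)
  set q := (2 : ℝ) ^ (-(k : ℝ) / 4) with hq
  have hq0 : 0 < q := by positivity
  have hq1 : q ≤ 1 := Real.rpow_le_one_of_one_le_of_nonpos (by norm_num) (by linarith)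
  have hpq : 10 ^ 9 * ((k : ℝ) ^ 2 * (1 / 2) ^ k) ≤ q := by
    have h3 : q ^ 3 ≤ q := pow_le_of_le_one hq0.le hq1 (by norm_num)
    refine le_trans ?_ (hL.quarter_le.trans h3)
    rw [mul_assoc]
    gcongr
    · linarith
    · norm_num
  set p := (1 / 2 : ℝ) ^ k with hp
  have hp0 : 0 < p := by positivity
  set y := (k : ℝ) ^ 2 * p with hy
  have hy0 : 0 < y := by positivity
  have hkp : k * p ≤ y / 1000 := by rw [hy]; nlinarith [mul_pos (by linarith : 0 < (k : ℝ)) hp0]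
  have hpy : p ≤ y / 1000 := by nlinarith
  have hkp0 : 0 < k * p := by positivity
  have hy1 : 10 ^ 9 * y ≤ 1 := hpq.trans hq1
  set Δ := |α' - α| with hΔ
  have hΔ0 : 0 ≤ Δ := abs_nonneg _
  -- The interval of densities has length 2.
  have hΔ2 : Δ ≤ 2 := by
    rw [hΔ, abs_le]
    have a1 := hα.1
    have a2 := hα.2
    have a3 := hα'.1
    have a4 := hα'.2
    unfold lbd at a1 a3
    unfold ubd at a2 a4
    constructor <;> linarith
  have e1 : |F + (α' - α) * p| ≤ |F + (α' - α) * S| + Δ * |S - p| := by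
    have : F + (α' - α) * p = (F + (α' - α) * S) - (α' - α) * (S - p) := by ring
    rw [this, hΔ, ← abs_mul]
    exact abs_sub _ _
  have hκ : 8196 * (k * p ^ 2) * Δ = 8196 * (k * p) * (p * Δ) := by ring
  rw [hκ] at h1
  -- all terms are now bounded by multiples of `y * (p * Δ)`
  set w := p * Δ with hw
  have hw0 : 0 ≤ w := by positivity
  have hw2 : w ≤ 2 * p := by rw [hw]; nlinarith
  have b1 : 8 * ((k : ℝ) ^ 2 * (8196 * (k * p) * w) ^ 2) ≤ y * w := by
    calc 8 * ((k : ℝ) ^ 2 * (8196 * (k * p) * w) ^ 2)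
        = 8 * 8196 ^ 2 * (k * p) ^ 2 * (k : ℝ) ^ 2 * w * w := by ring
      _ ≤ 8 * 8196 ^ 2 * (y / 1000) ^ 2 * (k : ℝ) ^ 2 * (2 * p) * w := by gcongr
      _ = (16 * 8196 ^ 2 / 1000 ^ 2 * y ^ 2) * (y * w) := by rw [hy]; ring
      _ ≤ 1 * (y * w) := by
          gcongr
          nlinarith
      _ = _ := one_mul _
  have b2 : 8192 * p * ((k : ℝ) ^ 2 * (8196 * (k * p) * w) ^ 2) ≤ y * w := by
    refine le_trans ?_ b1
    gcongr
    linarith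
  have b3 : k * p * Δ + 4 * (k : ℝ) ^ 2 * (8196 * (k * p) * w) +
      (2048 * (k * p ^ 2) * Δ + 4096 * y * (8196 * (k * p) * w)) ≤ 2 * (k * w) := by
    have e : k * p * Δ + 4 * (k : ℝ) ^ 2 * (8196 * (k * p) * w) +
      (2048 * (k * p ^ 2) * Δ + 4096 * y * (8196 * (k * p) * w)) =
      (1 + 4 * 8196 * y + 2048 * p + 4096 * 8196 * y * p) * (k * w) := by rw [hw, hy]; ring
    rw [e]
    gcongr
    nlinarith
  have b4 : 4098 * (k * p ^ 2) * Δ + 8 * y * (8196 * (k * p) * w) +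
      8192 * y * (8196 * (k * p) * w) ≤ 8196 * (k * p) * w := by
    have e : 4098 * (k * p ^ 2) * Δ + 8 * y * (8196 * (k * p) * w) +
      8192 * y * (8196 * (k * p) * w) = (4098 + 8200 * 8196 * y) * ((k * p) * w) := by
        rw [hw]; ring
    rw [e, mul_assoc (8196 : ℝ)]
    gcongr
    linarith
  have b5 : 2 * (k * p * Δ + 4 * (k : ℝ) ^ 2 * (8196 * (k * p) * w) +
      (2048 * (k * p ^ 2) * Δ + 4096 * y * (8196 * (k * p) * w))) *
      (4098 * (k * p ^ 2) * Δ + 8 * y * (8196 * (k * p) * w) +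
      8192 * y * (8196 * (k * p) * w)) ≤ y * w := by
    calc _ ≤ 2 * (2 * (k * w)) * (8196 * (k * p) * w) := by gcongr
      _ = 4 * 8196 * (y * w) * w := by rw [hy]; ring
      _ ≤ 4 * 8196 * (y * w) * (2 * p) := by gcongr
      _ = (8 * 8196 * p) * (y * w) := by ring
      _ ≤ 1 * (y * w) := by gcongr; linarith
      _ = _ := one_mul _
  have b6 : Δ * |S - p| ≤ 5 * (y * w) := by
    calc Δ * |S - p| ≤ Δ * (4100 * (k * p) * p) := by gcongr
      _ = 4100 * (k * p) * w := by rw [hw]; ring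
      _ ≤ 4100 * (y / 1000) * w := by gcongr
      _ = 4.1 * (y * w) := by ring
      _ ≤ 5 * (y * w) := by gcongr; norm_num
  have b7 : 8 * (y * w) ≤ q * w := by
    rw [← mul_assoc]
    gcongr
    linarith
  have e2 : q * (Δ * p) = q * w := by rw [hw]; ring
  rw [e2]
  linarith

omit hα in
theorem strictAntiOn_Phi : StrictAntiOn (Phi k) (Set.Icc (lbd k) (ubd k)) := by
  intro a ha b hb hab
  have h := (abs_le.1 (abs_Phi_sub_add_le hL ha hb)).2
  have hk1 := hL.one_le_cast
  have hq : (2 : ℝ) ^ (-(k : ℝ) / 4) < 1 :=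
    Real.rpow_lt_one_of_one_lt_of_neg (by norm_num) (by linarith)
  rw [abs_of_pos (sub_pos.2 hab)] at h
  have hw : 0 < (b - a) * (1 / 2 : ℝ) ^ k := mul_pos (sub_pos.2 hab) (by positivity)
  nlinarith

omit hα in
theorem continuousOn_Phi : ContinuousOn (Phi k) (Set.Icc (lbd k) (ubd k)) := by
  have hk1 := hL.one_le_cast
  have hq : (2 : ℝ) ^ (-(k : ℝ) / 4) ≤ 1 :=
    Real.rpow_le_one_of_one_le_of_nonpos (by norm_num) (by linarith)
  refine LipschitzOnWith.continuousOn (K := 2) (LipschitzOnWith.of_dist_le_mul fun a ha b hb => ?_)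
  rw [Real.dist_eq, Real.dist_eq]
  have h := abs_Phi_sub_add_le hL hb ha
  have hp1 : (1 / 2 : ℝ) ^ k ≤ 1 := pow_le_one₀ (by norm_num) (by norm_num)
  have h2 : |Phi k a - Phi k b| ≤
      |Phi k a - Phi k b + (a - b) * (1 / 2) ^ k| + |(a - b) * (1 / 2) ^ k| := by
    have := abs_sub (Phi k a - Phi k b + (a - b) * (1 / 2) ^ k) ((a - b) * (1 / 2) ^ k)
    rwa [add_sub_cancel_right] at this
  have h3 : |(a - b) * (1 / 2) ^ k| ≤ |a - b| := by
    rw [abs_mul, abs_of_pos (by positivity : (0 : ℝ) < (1 / 2) ^ k)]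
    exact mul_le_of_le_one_right (abs_nonneg _) hp1
  have h4 : (2 : ℝ) ^ (-(k : ℝ) / 4) * (|a - b| * (1 / 2) ^ k) ≤ |a - b| := by
    calc _ ≤ 1 * (|a - b| * 1) := by gcongr
      _ = _ := by ring
  rw [NNReal.coe_ofNat]
  linarith

end Phi

/-! ### Poisson generating functions -/

section Poisson

variable (r : ℝ≥0)

theorem hasSum_poisson_pow (t : ℝ) :
    HasSum (fun n : ℕ => Real.exp (-r) * r ^ n / n.factorial * t ^ n)
      (Real.exp (r * (t - 1))) := by
  have h := (NormedSpace.expSeries_div_hasSum_exp ((r : ℝ) * t)).mul_left (Real.exp (-r))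
  rw [← Real.exp_eq_exp_ℝ, ← Real.exp_add, show -(r : ℝ) + r * t = r * (t - 1) by ring] at h
  refine h.congr_fun fun n => ?_
  rw [mul_pow]; ring

theorem integrable_poisson_pow {t : ℝ} (ht : 0 ≤ t) :
    Integrable (fun n : ℕ => t ^ n) (poissonMeasure r) := by
  rw [integrable_poissonMeasure_iff]
  simp only [Real.norm_of_nonneg (pow_nonneg ht _)]
  exact (hasSum_poisson_pow r t).summable

theorem integral_poisson_pow (t : ℝ) :
    ∫ n, t ^ n ∂(poissonMeasure r) = Real.exp (r * (t - 1)) := by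
  rw [integral_poissonMeasure]
  exact (hasSum_poisson_pow r t).tsum_eq

theorem hasSum_poisson_cast :
    HasSum (fun n : ℕ => Real.exp (-r) * r ^ n / n.factorial * n) r := by
  rw [← hasSum_nat_add_iff' 1]
  have h := (hasSum_poisson_pow r 1).mul_left (r : ℝ)
  simp only [sub_self, mul_zero, Real.exp_zero, mul_one, one_pow] at h
  simp only [Finset.sum_range_one, Nat.cast_zero, mul_zero, sub_zero]
  refine h.congr_fun fun n => ?_
  rw [Nat.factorial_succ, pow_succ]
  push_cast
  have : (n.factorial : ℝ) ≠ 0 := by positivity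
  field_simp

theorem integrable_poisson_cast : Integrable (fun n : ℕ => (n : ℝ)) (poissonMeasure r) := by
  rw [integrable_poissonMeasure_iff]
  simp only [Real.norm_of_nonneg (Nat.cast_nonneg _)]
  exact (hasSum_poisson_cast r).summable

theorem integral_poisson_cast : ∫ n, (n : ℝ) ∂(poissonMeasure r) = r := by
  rw [integral_poissonMeasure]
  exact (hasSum_poisson_cast r).tsum_eq

theorem integrable_poisson_prod_pow {t u : ℝ} (ht : 0 ≤ t) (hu : 0 ≤ u) :
    Integrable (fun d : ℕ × ℕ => t ^ d.1 * u ^ d.2)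
      ((poissonMeasure r).prod (poissonMeasure r)) :=
  (integrable_poisson_pow r ht).mul_prod (integrable_poisson_pow r hu)

theorem integral_poisson_prod_pow (t u : ℝ) :
    ∫ d, t ^ d.1 * u ^ d.2 ∂((poissonMeasure r).prod (poissonMeasure r)) =
      Real.exp (r * (t + u - 2)) := by
  rw [integral_prod_mul (fun n : ℕ => t ^ n) (fun n : ℕ => u ^ n), integral_poisson_pow,
    integral_poisson_pow, ← Real.exp_add]
  congr 1; ring

theorem integrable_poisson_prod_add :
    Integrable (fun d : ℕ × ℕ => (d.1 : ℝ) + d.2)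
      ((poissonMeasure r).prod (poissonMeasure r)) :=
  ((integrable_poisson_cast r).comp_fst _).add ((integrable_poisson_cast r).comp_snd _)

theorem integral_poisson_prod_add :
    ∫ d, ((d.1 : ℝ) + d.2) ∂((poissonMeasure r).prod (poissonMeasure r)) = 2 * r := by
  rw [integral_add ((integrable_poisson_cast r).comp_fst _)
    ((integrable_poisson_cast r).comp_snd _),
    integral_fun_fst (fun n : ℕ => (n : ℝ)), integral_fun_snd (fun n : ℕ => (n : ℝ)),
    integral_poisson_cast]
  simp
  ring

end Poisson

/-! ### Bounds for the logarithmic site weight -/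

section Pointwise

variable {u v : ℝ} (hu : 0 < u) (hv : 0 < v)
include hu hv

/-- The last argument is C = cosh(log(u/v)). For powers u, v of a fixed number, log u + log v is
linear in the degrees, while C and C² have explicit Poisson means. -/
theorem log_sq_add_sq : Real.log (u ^ 2 + v ^ 2) =
    Real.log u + Real.log v + Real.log 2 + Real.log ((u⁻¹ * v + u * v⁻¹) / 2) := by
  have h : 0 < (u⁻¹ * v + u * v⁻¹) / 2 := by positivity
  rw [← Real.log_mul hu.ne' hv.ne', ← Real.log_mul (by positivity) (by norm_num),
    ← Real.log_mul (by positivity) h.ne']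
  congr 1
  field_simp
  ring

theorem one_le_cosh_ratio : 1 ≤ (u⁻¹ * v + u * v⁻¹) / 2 := by
  have e : (u⁻¹ * v + u * v⁻¹) / 2 - 1 = (u - v) ^ 2 / (2 * u * v) := by
    field_simp; ring
  have : 0 ≤ (u - v) ^ 2 / (2 * u * v) := by positivity
  linarith

theorem log_site_le (hu1 : u ≤ 1) : Real.log (u ^ 2 + v ^ 2 - u ^ 2 * v ^ 2) ≤
    Real.log u + Real.log v + Real.log 2 + ((u⁻¹ * v + u * v⁻¹) / 2 - 1) := by
  have h1 := one_le_cosh_ratio hu hv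
  have h2 := Real.log_le_sub_one_of_pos (by linarith : 0 < (u⁻¹ * v + u * v⁻¹) / 2)
  have h3 := log_sq_add_sq hu hv
  have h4 : Real.log (u ^ 2 + v ^ 2 - u ^ 2 * v ^ 2) ≤ Real.log (u ^ 2 + v ^ 2) := by
    refine Real.log_le_log ?_ (by nlinarith [sq_nonneg (u * v)])
    have : u ^ 2 ≤ 1 := pow_le_one₀ hu.le hu1
    have : 0 < v ^ 2 := by positivity
    have : 0 < u ^ 2 := by positivity
    nlinarith
  linarith

/-- With C = cosh(log(u/v)) ≥ 1, the bound log C ≥ (C-1) - (C-1)²/2 involves only C and C². The term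
u²v² multiplies u²+v² by 1-y with y = uv/(2C) ≤ uv/2, and log(1-y) ≥ -2y ≥ -uv. -/
theorem le_log_site (hu1 : u ≤ 1) (hv1 : v ≤ 1) :
    Real.log u + Real.log v + Real.log 2 + (2 * ((u⁻¹ * v + u * v⁻¹) / 2) -
      ((u⁻¹ * v + u * v⁻¹) / 2) ^ 2 / 2 - 3 / 2) - u * v ≤
      Real.log (u ^ 2 + v ^ 2 - u ^ 2 * v ^ 2) := by
  have hC1 := one_le_cosh_ratio hu hv
  have h3 := log_sq_add_sq hu hv
  set C := (u⁻¹ * v + u * v⁻¹) / 2 with hC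
  have e : u ^ 2 + v ^ 2 = 2 * (u * v) * C := by rw [hC]; field_simp; ring
  have hg : 0 < u * v := by positivity
  have hg1 : u * v ≤ 1 := mul_le_one₀ hu1 hv.le hv1
  have hlog : 2 * C - C ^ 2 / 2 - 3 / 2 ≤ Real.log C := by
    have h := Real.le_log_one_add_of_nonneg (x := C - 1) (by linarith)
    rw [add_sub_cancel] at h
    refine le_trans ?_ h
    rw [le_div_iff₀ (by linarith)]
    have : 0 ≤ (C - 1) ^ 3 := pow_nonneg (by linarith) 3
    nlinarith
  set y := u * v / (2 * C) with hy
  have hy2 : 2 * y ≤ u * v := by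
    rw [hy, mul_div_assoc', div_le_iff₀ (by linarith)]
    nlinarith
  have hy0 : 0 < y := by positivity
  have hy1 : 0 < 1 - y := by linarith
  have e2 : u ^ 2 + v ^ 2 - u ^ 2 * v ^ 2 = (u ^ 2 + v ^ 2) * (1 - y) := by
    have : (u ^ 2 + v ^ 2) * y = u ^ 2 * v ^ 2 := by rw [e, hy]; field_simp
    linarith
  have h5 : -(2 * y) ≤ Real.log (1 - y) := by
    have h := Real.one_sub_inv_le_log_of_pos hy1
    refine le_trans ?_ h
    have : (1 - y)⁻¹ ≤ 1 + 2 * y := by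
      rw [inv_le_iff_one_le_mul₀ hy1]
      nlinarith
    linarith
  rw [e2, Real.log_mul (by positivity) hy1.ne', h3]
  linarith

end Pointwise

/-! ### The site term at δ_{1/2} -/

section Explicit

variable (r : ℝ≥0) {s : ℝ} (hs0 : 0 < s) (hs1 : s ≤ 1)

/-- The site weight as a function of the degrees when all the messages are equal. -/
def degSite (s : ℝ) (d : ℕ × ℕ) : ℝ :=
  Real.log ((s ^ d.1) ^ 2 + (s ^ d.2) ^ 2 - (s ^ d.1) ^ 2 * (s ^ d.2) ^ 2)

theorem degSite_ratio (s : ℝ) (d : ℕ × ℕ) :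
    ((s ^ d.1)⁻¹ * s ^ d.2 + s ^ d.1 * (s ^ d.2)⁻¹) / 2 =
      1 / 2 * (s⁻¹ ^ d.1 * s ^ d.2) + 1 / 2 * (s ^ d.1 * s⁻¹ ^ d.2) := by
  rw [inv_pow, inv_pow]; ring

include hs0 in
theorem degSite_ratio_sq (d : ℕ × ℕ) :
    (((s ^ d.1)⁻¹ * s ^ d.2 + s ^ d.1 * (s ^ d.2)⁻¹) / 2) ^ 2 =
      1 / 4 * ((s⁻¹ ^ 2) ^ d.1 * (s ^ 2) ^ d.2) + 1 / 4 * ((s ^ 2) ^ d.1 * (s⁻¹ ^ 2) ^ d.2) +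
        1 / 2 := by
  have e : ∀ (x : ℝ) (n : ℕ), (x ^ 2) ^ n = (x ^ n) ^ 2 := fun x n => by
    rw [← pow_mul, mul_comm, pow_mul]
  simp only [e, inv_pow]
  have h1 : 0 < s ^ d.1 := by positivity
  have h2 : 0 < s ^ d.2 := by positivity
  field_simp
  ring

include hs0 hs1 in
theorem integrable_degSite :
    Integrable (degSite s) ((poissonMeasure r).prod (poissonMeasure r)) := by
  refine (((integrable_poisson_cast r).comp_fst (poissonMeasure r)).const_mul
    (-(2 * Real.log s))).mono' Measurable.of_discrete.aestronglyMeasurable (ae_of_all _ fun d => ?_)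
  have a0 : 0 < (s ^ d.1) ^ 2 := by positivity
  have b0 : 0 < (s ^ d.2) ^ 2 := by positivity
  have a1 : (s ^ d.1) ^ 2 ≤ 1 := pow_le_one₀ (by positivity) (pow_le_one₀ hs0.le hs1)
  have b1 : (s ^ d.2) ^ 2 ≤ 1 := pow_le_one₀ (by positivity) (pow_le_one₀ hs0.le hs1)
  have h1 : (s ^ d.1) ^ 2 ≤ (s ^ d.1) ^ 2 + (s ^ d.2) ^ 2 - (s ^ d.1) ^ 2 * (s ^ d.2) ^ 2 := by
    nlinarith
  have h2 : (s ^ d.1) ^ 2 + (s ^ d.2) ^ 2 - (s ^ d.1) ^ 2 * (s ^ d.2) ^ 2 ≤ 1 := by nlinarith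
  have h3 := Real.log_le_log a0 h1
  rw [Real.log_pow, Real.log_pow] at h3
  push_cast at h3
  rw [degSite, Real.norm_eq_abs, abs_of_nonpos (Real.log_nonpos (by linarith) h2)]
  linarith

include hs0 hs1

theorem integral_degSite_le :
    ∫ d, degSite s d ∂((poissonMeasure r).prod (poissonMeasure r)) ≤
      2 * r * Real.log s + Real.log 2 + (Real.exp (r * (s⁻¹ + s - 2)) - 1) := by
  have i1 := (integrable_poisson_prod_add r).mul_const (Real.log s)
  have i2 := (integrable_poisson_prod_pow r (inv_nonneg.2 hs0.le) hs0.le).const_mul (1 / 2)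
  have i3 := (integrable_poisson_prod_pow r hs0.le (inv_nonneg.2 hs0.le)).const_mul (1 / 2)
  have h1 : ∀ d, degSite s d ≤ ((d.1 : ℝ) + d.2) * Real.log s + (1 / 2 * (s⁻¹ ^ d.1 * s ^ d.2) +
      1 / 2 * (s ^ d.1 * s⁻¹ ^ d.2)) + (Real.log 2 - 1) := by
    intro d
    have h := log_site_le (u := s ^ d.1) (v := s ^ d.2) (by positivity) (by positivity)
      (pow_le_one₀ hs0.le hs1)
    rw [degSite_ratio s, Real.log_pow, Real.log_pow] at h
    rw [degSite]
    linarith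
  have h2 := integral_mono (integrable_degSite r hs0 hs1)
    ((i1.add (i2.add i3)).add (integrable_const _)) h1
  have h3 := integral_add (i1.add (i2.add i3)) (integrable_const (Real.log 2 - 1))
  have h4 := integral_add i1 (i2.add i3)
  have h5 := integral_add i2 i3
  simp only [Pi.add_apply] at h2 h3 h4
  rw [h3, h4, h5, integral_mul_const, integral_poisson_prod_add, integral_const_mul,
    integral_const_mul, integral_poisson_prod_pow, integral_poisson_prod_pow,
    add_comm s s⁻¹, integral_const] at h2
  simp at h2
  linarith

theorem le_integral_degSite :
    2 * r * Real.log s + Real.log 2 + (2 * Real.exp (r * (s⁻¹ + s - 2)) -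
      (Real.exp (r * (s⁻¹ ^ 2 + s ^ 2 - 2)) + 1) / 4 - 3 / 2) - Real.exp (r * (s + s - 2)) ≤
    ∫ d, degSite s d ∂((poissonMeasure r).prod (poissonMeasure r)) := by
  have hi := inv_nonneg.2 hs0.le
  have i1 := (integrable_poisson_prod_add r).mul_const (Real.log s)
  have i2 := integrable_poisson_prod_pow r hi hs0.le
  have i3 := integrable_poisson_prod_pow r hs0.le hi
  have i4 := (integrable_poisson_prod_pow r (sq_nonneg s⁻¹) (sq_nonneg s)).const_mul (1 / 8)
  have i5 := (integrable_poisson_prod_pow r (sq_nonneg s) (sq_nonneg s⁻¹)).const_mul (1 / 8)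
  have i6 := integrable_poisson_prod_pow r hs0.le hs0.le
  have h1 : ∀ d : ℕ × ℕ, ((d.1 : ℝ) + d.2) * Real.log s + (s⁻¹ ^ d.1 * s ^ d.2 +
      s ^ d.1 * s⁻¹ ^ d.2) - (1 / 8 * ((s⁻¹ ^ 2) ^ d.1 * (s ^ 2) ^ d.2) +
      1 / 8 * ((s ^ 2) ^ d.1 * (s⁻¹ ^ 2) ^ d.2)) - s ^ d.1 * s ^ d.2 + (Real.log 2 - 7 / 4) ≤
      degSite s d := by
    intro d
    have h := le_log_site (u := s ^ d.1) (v := s ^ d.2) (by positivity) (by positivity)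
      (pow_le_one₀ hs0.le hs1) (pow_le_one₀ hs0.le hs1)
    rw [degSite_ratio_sq hs0, degSite_ratio s, Real.log_pow, Real.log_pow] at h
    rw [degSite]
    linarith
  have h2 := integral_mono ((((i1.add (i2.add i3)).sub (i4.add i5)).sub i6).add
    (integrable_const _)) (integrable_degSite r hs0 hs1) h1
  have h3 := integral_add (((i1.add (i2.add i3)).sub (i4.add i5)).sub i6)
    (integrable_const (Real.log 2 - 7 / 4))
  have h4 := integral_sub ((i1.add (i2.add i3)).sub (i4.add i5)) i6
  have h5 := integral_sub (i1.add (i2.add i3)) (i4.add i5)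
  have h6 := integral_add i1 (i2.add i3)
  have h7 := integral_add i2 i3
  have h8 := integral_add i4 i5
  simp only [Pi.add_apply, Pi.sub_apply] at h2 h3 h4 h5 h6
  rw [h3, h4, h5, h6, h7, h8, integral_mul_const, integral_poisson_prod_add, integral_const_mul,
    integral_const_mul, integral_poisson_prod_pow, integral_poisson_prod_pow,
    integral_poisson_prod_pow, integral_poisson_prod_pow, integral_poisson_prod_pow,
    add_comm s s⁻¹, add_comm (s ^ 2), integral_const] at h2
  simp only [probReal_univ, one_smul] at h2
  linarith

end Explicit

/-- When all messages equal 1/2, each clause factor is 1 - 2^{-(k-1)} = s², so Π⁺ and Π⁻ are powers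
of s² and only the degrees remain random. -/
theorem integral_log_sF_iter_zero {k : ℕ} (hk : 2 ≤ k) (α : ℝ) {s : ℝ}
    (hs : s ^ 2 = 1 - (1 / 2) ^ (k - 1)) :
    ∫ ω, Real.log (sF (logPair k ω)) ∂(law k α (iter k α 0)) =
      ∫ d, degSite s d ∂((poissonMeasure (α * k / 2).toNNReal).prod
        (poissonMeasure (α * k / 2).toNNReal)) := by
  have h0 : ∀ᵐ x : unitInterval ∂(iter k α 0 : Measure unitInterval), x = half := by
    change ∀ᵐ x : unitInterval ∂(Measure.dirac half), x = half
    rw [ae_dirac_eq]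
    exact rfl
  have hμ : ∀ᵐ x : unitInterval ∂(iter k α 0 : Measure unitInterval), (x : ℝ) < 1 := by
    filter_upwards [h0] with x hx
    rw [hx]
    norm_num [half]
  have h1 : ∀ᵐ ω ∂(law k α (iter k α 0)), ∀ i : Idx, ω.2 i = half := by
    unfold law
    refine Measure.quasiMeasurePreserving_snd.ae (p := fun η : Arr => ∀ i : Idx, η i = half) ?_
    rw [ae_all_iff]
    intro i
    exact (measurePreserving_eval_infinitePi
      (fun _ : Idx => (iter k α 0 : Measure unitInterval)) i).quasiMeasurePreserving.ae h0
  have h2 : (fun ω => Real.log (sF (logPair k ω))) =ᵐ[law k α (iter k α 0)]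
      fun ω => degSite s ω.1 := by
    filter_upwards [h1, ae_law_siteWeight hk α hμ] with ω e1 e2
    rw [← e2.1]
    have e3 : ∀ b n, signProd k b n ω.2 = (s ^ n) ^ 2 := by
      intro b n
      unfold signProd
      simp only [e1, Finset.prod_const, Finset.card_range]
      rw [← pow_mul, mul_comm, pow_mul, hs]
      rfl
    rw [siteWeight, PiPlus, PiMinus, e3, e3, degSite]
  rw [integral_congr_ae h2, law, integral_fun_fst (degSite s)]
  simp

theorem abs_pow_sub_half_pow_le {x : ℝ} (h0 : 0 ≤ x) (h1 : x ≤ 1) (m : ℕ) :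
    |x ^ m - (1 / 2) ^ m| ≤ (2 - 2 * (1 / 2) ^ m) * |x - 1 / 2| := by
  induction m with
  | zero => simp
  | succ m ih =>
    have e : x ^ (m + 1) - (1 / 2) ^ (m + 1) =
      x * (x ^ m - (1 / 2) ^ m) + (x - 1 / 2) * (1 / 2) ^ m := by ring
    rw [e]
    calc _ ≤ |x * (x ^ m - (1 / 2) ^ m)| + |(x - 1 / 2) * (1 / 2) ^ m| := abs_add_le _ _
      _ = x * |x ^ m - (1 / 2) ^ m| + |x - 1 / 2| * (1 / 2) ^ m := by
          rw [abs_mul, abs_mul, abs_of_nonneg h0,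
            abs_of_pos (by positivity : (0 : ℝ) < (1 / 2) ^ m)]
      _ ≤ 1 * ((2 - 2 * (1 / 2) ^ m) * |x - 1 / 2|) + |x - 1 / 2| * (1 / 2) ^ m := by gcongr
      _ = _ := by ring

theorem Good.abs_mom_sub_half_pow_le {k : ℕ} {μ : ProbabilityMeasure unitInterval}
    (hG : Good k μ) (hk : k ≠ 0) (m : ℕ) : |mom μ m - (1 / 2) ^ m| ≤ 2 / (k : ℝ) ^ 2 := by
  have hk0 : (0 : ℝ) < k := by positivity
  have i1 := integrable_unitInterval_pow μ 1
  have i2 := integrable_unitInterval_pow μ 2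
  have im := integrable_unitInterval_pow μ m
  have e1 : mom μ m - (1 / 2) ^ m =
      ∫ x : unitInterval, ((x : ℝ) ^ m - (1 / 2) ^ m) ∂(μ : Measure unitInterval) := by
    rw [integral_sub im (integrable_const _), integral_const]
    simp [mom]
  have e2 : ∫ x : unitInterval, ((k : ℝ) ^ 2 * ((x : ℝ) ^ 2 - (x : ℝ) ^ 1) +
      ((k : ℝ) ^ 2 / 4 + 1 / (k : ℝ) ^ 2)) ∂(μ : Measure unitInterval) =
      (k : ℝ) ^ 2 * (mom μ 2 - mom μ 1 + 1 / 4) + 1 / (k : ℝ) ^ 2 := by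
    have h := integral_add ((i2.sub i1).const_mul ((k : ℝ) ^ 2))
      (integrable_const ((k : ℝ) ^ 2 / 4 + 1 / (k : ℝ) ^ 2))
    have h' := integral_sub i2 i1
    simp only [Pi.sub_apply] at h
    rw [h, integral_const_mul, h', integral_const]
    simp [mom]
    ring
  rw [e1]
  refine (abs_integral_le_integral_abs).trans (le_trans (integral_mono
    (im.sub (integrable_const _)).abs
    (((i2.sub i1).const_mul ((k : ℝ) ^ 2)).add (integrable_const _)) fun x => ?_)
    (e2.trans_le ?_))
  · have h := abs_pow_sub_half_pow_le x.2.1 x.2.2 m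
    have h2 : (2 - 2 * (1 / 2 : ℝ) ^ m) * |(x : ℝ) - 1 / 2| ≤ 2 * |(x : ℝ) - 1 / 2| := by
      gcongr
      linarith [show (0 : ℝ) ≤ (1 / 2) ^ m by positivity]
    -- The arithmetic-geometric mean inequality, weighted so that a variance of at most 1/k⁴ makes
    -- both terms at most 1/k².
    have h3 : 2 * |(x : ℝ) - 1 / 2| ≤ (k : ℝ) ^ 2 * |(x : ℝ) - 1 / 2| ^ 2 + 1 / (k : ℝ) ^ 2 := by
      have e : (k : ℝ) ^ 2 * |(x : ℝ) - 1 / 2| ^ 2 + 1 / (k : ℝ) ^ 2 - 2 * |(x : ℝ) - 1 / 2| =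
          (k * |(x : ℝ) - 1 / 2| - 1 / k) ^ 2 := by field_simp; ring
      linarith [sq_nonneg (k * |(x : ℝ) - 1 / 2| - 1 / k)]
    rw [sq_abs] at h3
    refine h.trans (h2.trans (h3.trans_eq ?_))
    change _ = (k : ℝ) ^ 2 * ((x : ℝ) ^ 2 - (x : ℝ) ^ 1) + ((k : ℝ) ^ 2 / 4 + 1 / (k : ℝ) ^ 2)
    ring
  · have h : (k : ℝ) ^ 2 * (mom μ 2 - mom μ 1 + 1 / 4) ≤ (k : ℝ) ^ 2 * (1 / (k : ℝ) ^ 4) := by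
      gcongr
      exact hG.var
    have e : (k : ℝ) ^ 2 * (1 / (k : ℝ) ^ 4) = 1 / (k : ℝ) ^ 2 := by field_simp
    rw [e] at h
    refine (add_le_add_left h _).trans_eq ?_
    ring

/-! ### Elementary estimates at δ_{1/2} -/

section Numerics

/-- Here s⁻¹ + s - 2 = (1-s)²/s, and 1-s is p up to a relative error of order p. -/
theorem inv_add_sub_two_bounds {p s : ℝ} (hp0 : 0 < p) (hp1 : p ≤ 1 / 100) (hs0 : 0 < s)
    (hs : s ^ 2 = 1 - 2 * p) :
    s ≤ 1 - p ∧ p ^ 2 ≤ s⁻¹ + s - 2 ∧ s⁻¹ + s - 2 ≤ p ^ 2 * (1 + 8 * p) := by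
  have h1 : s ≤ 1 - p := by nlinarith
  have h2 : 1 - p - p ^ 2 ≤ s := by
    by_contra h
    push Not at h
    have h3 : s ^ 2 < (1 - p - p ^ 2) ^ 2 := by gcongr
    have : (1 - p - p ^ 2) ^ 2 = 1 - 2 * p - p ^ 2 * (1 - 2 * p - p ^ 2) := by ring
    have : 0 ≤ p ^ 2 * (1 - 2 * p - p ^ 2) := mul_nonneg (sq_nonneg _) (by nlinarith)
    linarith
  have e : s⁻¹ + s - 2 = (1 - s) ^ 2 / s := by field_simp; ring
  refine ⟨h1, ?_, ?_⟩
  · rw [e, le_div_iff₀ hs0]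
    nlinarith
  · rw [e, div_le_iff₀ hs0]
    have h3 : (1 - s) ^ 2 ≤ (p + p ^ 2) ^ 2 := by
      apply pow_le_pow_left₀ <;> linarith
    have h4 : (1 + p) ^ 2 ≤ (1 + 8 * p) * s := by nlinarith
    calc (1 - s) ^ 2 ≤ (p + p ^ 2) ^ 2 := h3
      _ = p ^ 2 * (1 + p) ^ 2 := by ring
      _ ≤ p ^ 2 * ((1 + 8 * p) * s) := by gcongr
      _ = _ := by ring

theorem abs_add_log_one_sub_le {x : ℝ} (h0 : 0 ≤ x) (h1 : x ≤ 1 / 50) :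
    |x + x ^ 2 / 2 + Real.log (1 - x)| ≤ 9 / 8 * x ^ 3 := by
  have h := Real.abs_log_sub_add_sum_range_le (x := x) (by rw [abs_of_nonneg h0]; linarith) 2
  rw [abs_of_nonneg h0] at h
  simp only [Finset.sum_range_succ, Finset.sum_range_zero] at h
  norm_num at h
  refine h.trans ?_
  rw [div_le_iff₀ (by linarith)]
  have : 0 ≤ x ^ 3 := pow_nonneg h0 3
  nlinarith

theorem exp_le_one_add_add_sq {x : ℝ} (h0 : 0 ≤ x) (h1 : x ≤ 1) :
    Real.exp x ≤ 1 + x + x ^ 2 := by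
  have := (abs_le.1 (Real.abs_exp_sub_one_sub_id_le (x := x) (by rwa [abs_of_nonneg h0]))).2
  linarith

theorem two_mul_log_bounds {ρ p s : ℝ} (hρ : 0 ≤ ρ) (hp0 : 0 < p) (hp1 : p ≤ 1 / 100)
    (hs : s ^ 2 = 1 - 2 * p) :
    -(2 * ρ * p) - 2 * ρ * p * p - 9 * (ρ * p * p * p) ≤ 2 * ρ * Real.log s ∧
    2 * ρ * Real.log s ≤ -(2 * ρ * p) - 2 * ρ * p * p + 9 * (ρ * p * p * p) := by
  have hlog := abs_le.1 (abs_add_log_one_sub_le (x := 2 * p) (by linarith) (by linarith))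
  have e : 2 * ρ * Real.log s = ρ * Real.log (1 - 2 * p) := by
    rw [← hs, Real.log_pow]; push_cast; ring
  rw [e]
  constructor
  · calc _ = ρ * (-(2 * p) - (2 * p) ^ 2 / 2 - 9 / 8 * (2 * p) ^ 3) := by ring
      _ ≤ _ := mul_le_mul_of_nonneg_left (by linarith [hlog.1]) hρ
  · calc _ ≤ ρ * (-(2 * p) - (2 * p) ^ 2 / 2 + 9 / 8 * (2 * p) ^ 3) :=
          mul_le_mul_of_nonneg_left (by linarith [hlog.2]) hρ
      _ = _ := by ring

/-- With v = ρ(s⁻¹+s-2), both expressions agree with v to first order, and v is close to ρp². The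
coefficient of ρp² has to be exact, as this term later cancels; squares of ρp² are negligible. -/
theorem fluctuation_bounds {ρ p s : ℝ} (hρ : 0 ≤ ρ) (hp0 : 0 < p) (hp1 : p ≤ 1 / 100)
    (hs0 : 0 < s) (hs : s ^ 2 = 1 - 2 * p) (hρp : 2 * ρ * p * p ≤ 1 / 100) :
    Real.exp (ρ * (s⁻¹ + s - 2)) - 1 ≤
      ρ * p * p + 8 * (ρ * p * p * p) + (2 * ρ * p * p) ^ 2 ∧
    ρ * p * p - 2 * (ρ * p * p * p) - 7 * (2 * ρ * p * p) ^ 2 ≤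
      2 * Real.exp (ρ * (s⁻¹ + s - 2)) - (Real.exp (ρ * (s⁻¹ ^ 2 + s ^ 2 - 2)) + 1) / 4 - 3 / 2 ∧
    Real.exp (ρ * (s + s - 2)) ≤ Real.exp (-(2 * ρ * p)) := by
  obtain ⟨hsp, hε0, hε1⟩ := inv_add_sub_two_bounds hp0 hp1 hs0 hs
  have e : s⁻¹ ^ 2 + s ^ 2 - 2 = 4 * (s⁻¹ + s - 2) + (s⁻¹ + s - 2) ^ 2 := by field_simp; ring
  rw [e]
  generalize s⁻¹ + s - 2 = ε at hε0 hε1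
  have hq0 : 0 ≤ ρ * p * p := by positivity
  have v0 : ρ * p * p ≤ ρ * ε := by
    calc ρ * p * p = ρ * p ^ 2 := by ring
      _ ≤ _ := mul_le_mul_of_nonneg_left hε0 hρ
  have v1 : ρ * ε ≤ ρ * p * p + 8 * (ρ * p * p * p) := by
    calc ρ * ε ≤ ρ * (p ^ 2 * (1 + 8 * p)) := mul_le_mul_of_nonneg_left hε1 hρ
      _ = _ := by ring
  have v2 : ρ * ε ≤ 2 * ρ * p * p := by
    have : ρ * p * p * p ≤ ρ * p * p * (1 / 100) := mul_le_mul_of_nonneg_left hp1 hq0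
    linarith
  have hεp : ε ≤ p := by nlinarith
  have hε : 0 ≤ ε := (sq_nonneg p).trans hε0
  refine ⟨?_, ?_, ?_⟩
  · have h3 := exp_le_one_add_add_sq (x := ρ * ε) (by linarith) (by linarith)
    have h4 : (ρ * ε) ^ 2 ≤ (2 * ρ * p * p) ^ 2 := pow_le_pow_left₀ (by linarith) v2 2
    linarith
  · have h3 := Real.add_one_le_exp (ρ * ε)
    have hve : ρ * ε * ε ≤ 2 * ρ * p * p * p := mul_le_mul v2 hεp hε (by linarith)
    have hve0 : 0 ≤ ρ * ε * ε := mul_nonneg (by linarith) hε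
    have hve1 : ρ * ε * ε ≤ ρ * ε := mul_le_of_le_one_right (by linarith) (by linarith)
    have h5 := exp_le_one_add_add_sq (x := 4 * (ρ * ε) + ρ * ε * ε) (by linarith) (by linarith)
    have h6 : (4 * (ρ * ε) + ρ * ε * ε) ^ 2 ≤ (5 * (2 * ρ * p * p)) ^ 2 :=
      pow_le_pow_left₀ (by linarith) (by linarith) 2
    have e4 : ρ * (4 * ε + ε ^ 2) = 4 * (ρ * ε) + ρ * ε * ε := by ring
    have e5 : (5 * (2 * ρ * p * p)) ^ 2 = 25 * (2 * ρ * p * p) ^ 2 := by ring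
    have : 0 ≤ (2 * ρ * p * p) ^ 2 := sq_nonneg _
    rw [e4]
    linarith
  · rw [Real.exp_le_exp]
    calc ρ * (s + s - 2) ≤ ρ * (-(2 * p)) := mul_le_mul_of_nonneg_left (by linarith) hρ
      _ = _ := by ring

end Numerics

/-! ### Signs of Φ at the ends of the interval and the unique zero -/

section Endpoints

variable {k : ℕ} (hL : Large k) {α : ℝ} (hα : α ∈ Set.Icc (lbd k) (ubd k))
include hL hα

/-- Stationarity at μ_α makes the cost of moving to δ_{1/2} quadratic: the first moments differ by
at most 2^{-k} and all moments by at most 2/k². -/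
theorem abs_freeEnergy_iter_zero_sub_Phi_le :
    |freeEnergy k α (iter k α 0) - Phi k α| ≤ 1 / 10 * (1 / 2) ^ k := by
  have hk := hL.two_le
  have hk1 := hL.one_le_cast
  have hG := good_fixedPt hL hα
  have h2 := hL.pow_mul_half_pow_le (i := 2) (by norm_num)
  have hD₁ : |mom (iter k α 0) 1 - mom (fixedPt k α) 1| ≤ (1 / 2) ^ k := by
    rw [mom_iter_zero, pow_one, abs_le]
    constructor <;> linarith [hG.lo, hG.hi, show (0 : ℝ) ≤ (1 / 2) ^ k by positivity]
  have hD : ∀ m, |mom (iter k α 0) m - mom (fixedPt k α) m| ≤ 2 / (k : ℝ) ^ 2 := by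
    intro m
    rw [mom_iter_zero, abs_sub_comm]
    exact hG.abs_mom_sub_half_pow_le (by omega) m
  have h := abs_freeEnergy_sub_le hL hα hα hG (good_iter_zero k α) (recursion_fixedPt hL hα) hD₁ hD
  rw [sub_self, zero_mul, add_zero, abs_zero, ← Phi_eq hL hα] at h
  refine h.trans ?_
  set p := (1 / 2 : ℝ) ^ k with hp
  have hp0 : 0 < p := by positivity
  have hk2 : (1000 : ℝ) ^ 2 ≤ (k : ℝ) ^ 2 := by gcongr
  have hpy : p ≤ (k : ℝ) ^ 2 * p / 1000 ^ 2 := by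
    rw [le_div_iff₀ (by norm_num)]
    nlinarith
  set y := (k : ℝ) ^ 2 * p with hy
  have hy0 : 0 < y := by positivity
  have ek : y * (2 / (k : ℝ) ^ 2) = 2 * p := by rw [hy]; field_simp
  have hk0 : (0 : ℝ) < (k : ℝ) ^ 2 := by positivity
  have e : 8 * ((k : ℝ) ^ 2 * p ^ 2) + 8192 * p * ((k : ℝ) ^ 2 * (2 / (k : ℝ) ^ 2) ^ 2) +
      2 * (k * p * 0 + 4 * (k : ℝ) ^ 2 * p + (2048 * (k * p ^ 2) * 0 +
        4096 * y * (2 / (k : ℝ) ^ 2))) * (4098 * (k * p ^ 2) * 0 + 8 * y * p +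
        8192 * y * (2 / (k : ℝ) ^ 2)) =
      (8 * y + 32768 * (1 / (k : ℝ) ^ 2) + 2 * (4 * y + 8192 * p) * (8 * y + 16384)) * p := by
    rw [mul_assoc 4096 y, mul_assoc 8192 y, ek, hy]
    field_simp
    ring
  rw [e]
  refine mul_le_mul_of_nonneg_right ?_ hp0.le
  have hkinv : 1 / (k : ℝ) ^ 2 ≤ 1 / 1000 ^ 2 := by gcongr
  have h3 : 2 * (4 * y + 8192 * p) * (8 * y + 16384) ≤ 2 * (5 * y) * 20000 := by
    gcongr <;> linarith
  linarith

theorem exists_sqrt_param : ∃ s : ℝ, 0 < s ∧ s ≤ 1 ∧ s ^ 2 = 1 - 2 * (1 / 2 : ℝ) ^ k ∧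
    ∫ ω, Real.log (sF (logPair k ω)) ∂(law k α (iter k α 0)) =
      ∫ d, degSite s d ∂((poissonMeasure (α * k / 2).toNNReal).prod
        (poissonMeasure (α * k / 2).toNNReal)) := by
  have hp9 := hL.half_pow_le
  have hp0 : 0 < (1 / 2 : ℝ) ^ k := by positivity
  have hs := Real.sq_sqrt (show 0 ≤ 1 - 2 * (1 / 2 : ℝ) ^ k by linarith)
  refine ⟨√(1 - 2 * (1 / 2 : ℝ) ^ k), Real.sqrt_pos.2 (by linarith),
    Real.sqrt_le_one.2 (by linarith), hs, ?_⟩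
  refine integral_log_sF_iter_zero hL.two_le α (hs.trans ?_)
  obtain ⟨m, rfl⟩ := Nat.exists_eq_add_of_le (show 1 ≤ k by have := hL.thousand_le; omega)
  rw [Nat.add_sub_cancel_left, pow_add]
  ring

omit hα in
theorem abs_tsum_mom_iter_zero_sub_le (α : ℝ) :
    |∑' j : ℕ, mom (iter k α 0) j ^ k / j - ((1 / 2) ^ k + ((1 / 2 : ℝ) ^ k) ^ 2 / 2)| ≤
      9 / 8 * ((1 / 2 : ℝ) ^ k) ^ 3 := by
  have hp9 := hL.half_pow_le
  have hp0 : 0 < (1 / 2 : ℝ) ^ k := by positivity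
  have h := (hasSum_neg_pow_div ((1 / 2 : ℝ) ^ k) hp0.le (by linarith)).tsum_eq
  have e : ∑' j : ℕ, mom (iter k α 0) j ^ k / j = -Real.log (1 - (1 / 2) ^ k) := by
    rw [← h, ← tsum_neg]
    congr 1
    ext j
    rw [mom_iter_zero, neg_neg, ← pow_mul, mul_comm, pow_mul]
  have h2 := abs_add_log_one_sub_le hp0.le (by linarith : (1 / 2 : ℝ) ^ k ≤ 1 / 50)
  rw [e, ← abs_neg]
  refine le_trans (le_of_eq ?_) h2
  congr 1
  ring

/-- Put p = 2^{-k} and ρ = αk/2. The logarithms of the clause factors give -2ρp - 2ρp², the degree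
fluctuations give ρp², and the clause term gives 2ρp - αp + ρp² - αp²/2. All terms in ρp and ρp²
cancel. -/
theorem freeEnergy_iter_zero_bounds :
    freeEnergy k α (iter k α 0) ≤ Real.log 2 - α * (1 / 2) ^ k -
      α * (1 / 2) ^ k * (1 / 2) ^ k / 2 + 1 / 100 * (1 / 2) ^ k ∧
    Real.log 2 - α * (1 / 2) ^ k - α * (1 / 2) ^ k * (1 / 2) ^ k / 2 -
      (1 + 1 / 50) * (1 / 2) ^ k ≤ freeEnergy k α (iter k α 0) := by
  have hk1 := hL.one_le_cast
  have hα0 := (density_pos hL hα).le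
  have hAge := mul_half_pow_ge hα
  have hAle := mul_half_pow_le_log hα
  have hlog2 := Real.log_two_lt_d9
  have h2 := hL.pow_mul_half_pow_le (i := 2) (by norm_num)
  have h1 := hL.pow_mul_half_pow_le (i := 1) (by norm_num)
  rw [pow_one] at h1
  have hp9 := hL.half_pow_le
  obtain ⟨s, hs0, hs1, hs, hint⟩ := exists_sqrt_param hL hα
  have hW := abs_le.1 (abs_tsum_mom_iter_zero_sub_le hL α)
  have hρ : 0 ≤ α * k / 2 := by positivity
  have hr : ((α * k / 2).toNNReal : ℝ) = α * k / 2 := Real.coe_toNNReal _ hρ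
  have hU := integral_degSite_le (α * k / 2).toNNReal hs0 hs1
  have hLo := le_integral_degSite (α * k / 2).toNNReal hs0 hs1
  rw [← hint, hr] at hU hLo
  have hkL : Real.exp (-(k * Real.log 2)) = (1 / 2 : ℝ) ^ k := by
    rw [← mul_neg, Real.exp_nat_mul, Real.exp_neg, Real.exp_log (by norm_num), one_div]
  rw [freeEnergy]
  generalize ∫ ω, Real.log (sF (logPair k ω)) ∂(law k α (iter k α 0)) = I at hU hLo
  generalize ∑' j : ℕ, mom (iter k α 0) j ^ k / (j : ℝ) = W at hW
  have hp0 : 0 < (1 / 2 : ℝ) ^ k := by positivity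
  generalize (1 / 2 : ℝ) ^ k = p at *
  clear hint
  have hA1 : α * p ≤ 1 := by linarith
  have hA0 : 0 ≤ α * p := by positivity
  have hkp0 : 0 ≤ k * p := by positivity
  have hap : 2 * (α * k / 2) * p * p ≤ k * p := by
    calc _ = k * p * (α * p) := by ring
      _ ≤ _ := mul_le_of_le_one_right hkp0 hA1
  have hyp : (k : ℝ) ^ 2 * p * p ≤ 1 / 10 ^ 9 * p :=
    mul_le_mul_of_nonneg_right (by linarith) hp0.le
  have happ : α * k / 2 * p * p * p ≤ 1 / 10 ^ 9 * p := by
    calc _ ≤ 2 * (α * k / 2) * p * p * p := by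
          have : 0 ≤ α * k / 2 * p * p * p := by positivity
          linarith
      _ ≤ k * p * p := mul_le_mul_of_nonneg_right hap hp0.le
      _ ≤ _ := mul_le_mul_of_nonneg_right (by linarith) hp0.le
  have hapap : (2 * (α * k / 2) * p * p) ^ 2 ≤ 1 / 10 ^ 9 * p := by
    calc _ ≤ (k * p) ^ 2 := pow_le_pow_left₀ (by positivity) hap 2
      _ = (k : ℝ) ^ 2 * p * p := by ring
      _ ≤ _ := hyp
  obtain ⟨l1, l2⟩ := two_mul_log_bounds hρ hp0 (by linarith) hs
  obtain ⟨f1, f2, f3⟩ := fluctuation_bounds hρ hp0 (by linarith) hs0 hs (by linarith)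
  have hc0 : 0 ≤ α * ((k : ℝ) - 1) := mul_nonneg hα0 (by linarith)
  have hA3 : 0 ≤ α * p * p * p := by positivity
  have c1 : α * ((k : ℝ) - 1) * W ≤ 2 * (α * k / 2) * p - α * p + α * k / 2 * p * p -
      α * p * p / 2 + 9 / 4 * (α * k / 2 * p * p * p) := by
    calc _ ≤ α * ((k : ℝ) - 1) * (p + p ^ 2 / 2 + 9 / 8 * p ^ 3) :=
          mul_le_mul_of_nonneg_left (by linarith [hW.2]) hc0
      _ = 2 * (α * k / 2) * p - α * p + α * k / 2 * p * p -
          α * p * p / 2 + 9 / 4 * (α * k / 2 * p * p * p) - 9 / 8 * (α * p * p * p) := by ring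
      _ ≤ _ := by linarith
  have c2 : 2 * (α * k / 2) * p - α * p + α * k / 2 * p * p - α * p * p / 2 -
      9 / 4 * (α * k / 2 * p * p * p) ≤ α * ((k : ℝ) - 1) * W := by
    calc _ ≤ 2 * (α * k / 2) * p - α * p + α * k / 2 * p * p -
          α * p * p / 2 - 9 / 4 * (α * k / 2 * p * p * p) + 9 / 8 * (α * p * p * p) := by linarith
      _ = α * ((k : ℝ) - 1) * (p + p ^ 2 / 2 - 9 / 8 * p ^ 3) := by ring
      _ ≤ _ := mul_le_mul_of_nonneg_left (by linarith [hW.1]) hc0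
  constructor
  · linarith
  · have h7 : Real.exp (-(2 * (α * k / 2) * p)) ≤ (1 + 1 / 100) * p := by
      calc _ ≤ Real.exp (2 * (k * p) + -(k * Real.log 2)) := by
            rw [Real.exp_le_exp]
            have : k * (Real.log 2 - 2 * p) ≤ k * (α * p) :=
              mul_le_mul_of_nonneg_left hAge (by linarith)
            linarith
        _ = Real.exp (2 * (k * p)) * p := by rw [Real.exp_add, hkL]
        _ ≤ _ := by
            refine mul_le_mul_of_nonneg_right ?_ hp0.le
            have := exp_sub_one_le (x := 2 * (k * p)) (by linarith) (by linarith)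
            linarith
    linarith

omit hα hL in
theorem lbd_mem (k : ℕ) : lbd k ∈ Set.Icc (lbd k) (ubd k) := ⟨le_rfl, by unfold lbd ubd; linarith⟩

omit hα hL in
theorem ubd_mem (k : ℕ) : ubd k ∈ Set.Icc (lbd k) (ubd k) := ⟨by unfold lbd ubd; linarith, le_rfl⟩

omit hα hL in
theorem two_pow_mul_half_pow (k : ℕ) : (2 : ℝ) ^ k * (1 / 2) ^ k = 1 := by
  rw [← mul_pow]; norm_num

-- As α 2^{-k} = log 2 - 2·2^{-k}, the value is at least (2 - (log 2)/2 - 1.02 - 0.1)·2^{-k}, which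
-- is positive.
omit hα in
theorem Phi_lbd_pos : 0 < Phi k (lbd k) := by
  have h1 := (freeEnergy_iter_zero_bounds hL (lbd_mem k)).2
  have h2 := (abs_le.1 (abs_freeEnergy_iter_zero_sub_Phi_le hL (lbd_mem k))).2
  have hp9 := hL.half_pow_le
  have hp0 : 0 < (1 / 2 : ℝ) ^ k := by positivity
  have hlog2 := Real.log_two_lt_d9
  have e : lbd k * (1 / 2) ^ k = Real.log 2 - 2 * (1 / 2) ^ k := by
    rw [lbd, sub_mul, mul_right_comm, two_pow_mul_half_pow, one_mul]
  rw [e] at h1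
  nlinarith

-- As α 2^{-k} = log 2, the value is at most (-(log 2)/2 + 0.01 + 0.1)·2^{-k}, which is negative.
omit hα in
theorem Phi_ubd_neg : Phi k (ubd k) < 0 := by
  have h1 := (freeEnergy_iter_zero_bounds hL (ubd_mem k)).1
  have h2 := (abs_le.1 (abs_freeEnergy_iter_zero_sub_Phi_le hL (ubd_mem k))).1
  have hp0 : 0 < (1 / 2 : ℝ) ^ k := by positivity
  have hlog1 := Real.log_two_gt_d9
  have e : ubd k * (1 / 2) ^ k = Real.log 2 := by
    rw [ubd, mul_right_comm, two_pow_mul_half_pow, one_mul]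
  rw [e] at h1
  nlinarith

omit hα in
theorem existsUnique_zero_Phi :
    ∃! α : ℝ, α ∈ Set.Icc (lbd k) (ubd k) ∧ Phi k α = 0 := by
  have hle : lbd k ≤ ubd k := (lbd_mem k).2
  obtain ⟨α, hα, h0⟩ := intermediate_value_Icc' hle (continuousOn_Phi hL)
    ⟨(Phi_ubd_neg hL).le, (Phi_lbd_pos hL).le⟩
  exact ⟨α, ⟨hα, h0⟩, fun β hβ => (strictAntiOn_Phi hL).injOn hβ.1 hα (hβ.2.trans h0.symm)⟩

end Endpoints

end KSat

end

theorem proposition2 :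
    ∃ (k₀ : ℕ) (C : ℝ), ∀ k : ℕ, k₀ ≤ k →
      -- `Φ` is well-defined on the interval
      (∀ α ∈ Set.Icc (KSat.lbd k) (KSat.ubd k),
        Tendsto (KSat.iter k α) atTop (𝓝 (KSat.fixedPt k α)) ∧
        KSat.recursion k α (KSat.fixedPt k α) = KSat.fixedPt k α ∧
        (∀ᵐ ω ∂(KSat.law k α (KSat.fixedPt k α)),
          0 < KSat.siteWeight k ω ∧ 0 < KSat.clauseWeight k ω) ∧
        Integrable (KSat.logWeight k α) (KSat.law k α (KSat.fixedPt k α))) ∧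
      -- it is strictly decreasing there
      StrictAntiOn (KSat.Phi k) (Set.Icc (KSat.lbd k) (KSat.ubd k)) ∧
      -- it has a unique zero there
      (∃! α : ℝ, α ∈ Set.Icc (KSat.lbd k) (KSat.ubd k) ∧ KSat.Phi k α = 0) ∧
      -- quantitative decrease, with an error constant independent of `k` and of the densities
      (∀ α' ∈ Set.Icc (KSat.lbd k) (KSat.ubd k), ∀ α'' ∈ Set.Icc (KSat.lbd k) (KSat.ubd k),
        α' ≤ α'' →
        |KSat.Phi k α'' - KSat.Phi k α' - (-((α'' - α') * (2 : ℝ) ^ (-(k : ℝ))))| ≤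
          C * (2 : ℝ) ^ (-(k : ℝ) / 4) * ((α'' - α') * (2 : ℝ) ^ (-(k : ℝ)))) := by
  obtain ⟨k₀, hk₀⟩ := eventually_atTop.1 KSat.eventually_large
  -- The constant 1 suffices: all numerical factors are absorbed by the choice of `k₀`.
  refine ⟨k₀, 1, fun k hk => ?_⟩
  have hL := hk₀ k hk
  refine ⟨fun α hα => ?_, KSat.strictAntiOn_Phi hL, KSat.existsUnique_zero_Phi hL,
    fun α' hα' α'' hα'' hle => ?_⟩
  · have hs := (KSat.good_fixedPt hL hα).summable
    exact ⟨KSat.tendsto_iter hL hα, KSat.recursion_fixedPt hL hα,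
      KSat.ae_weights_pos hL.two_le hs α,
      KSat.integrable_logWeight hL.two_le (KSat.density_pos hL hα).le hs⟩
  · have h := KSat.abs_Phi_sub_add_le hL hα' hα''
    have e : (2 : ℝ) ^ (-(k : ℝ)) = (1 / 2) ^ k := by
      rw [Real.rpow_neg zero_le_two, Real.rpow_natCast, one_div, inv_pow]
    rw [e, sub_neg_eq_add, one_mul]
    rwa [abs_of_nonneg (sub_nonneg.2 hle)] at h
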